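/- Let $n\ge 5$ be an integer and put $d=n-2$, $$\alpha=2\Big(1+\sqrt{\tfrac{d-4}{3(d-2)}}\Big),\qquad \beta=\tfrac13\Big(2d-8+\sqrt{3(d-2)(d-4)}\Big),\qquad \phi_0(x)=\frac{\alpha}{|x|^2+\beta}\quad(x\in\mathbb R^n),$$ where, for $n=5$, the square roots are the principal complex ones. For complex-valued $u_1$ let $$N(x,u_1)=(n-4)\,u_1^2\,\big(3-3|x|^2\phi_0(x)-|x|^2u_1\big),\qquad \mathbf N(u_1,u_2)=\big(0,\,N(\cdot,u_1)\big).$$ With $\mathcal Fu(\xi)=(2\pi)^{-n/2}\int_{\mathbb R^n} u(x)e^{-i\xi\cdot x}\,dx$ and $\|u\|_{\dot H^s}=\||\cdot|^s\mathcal Fu\|_{L^2(\mathbb R^n)}$, let for $0\le s_1\le s_2$ $$\|u\|_{\dot H^{s_1}\cap\dot H^{s_2}}^2=\|u\|_{\dot H^{s_1}}^2+\mathbf 1_{(0,\infty)}(s_2-s_1)\,\|u\|_{\dot H^{s_2}}^2 .$$ For $1\le s_1\le s_2$, let $\mathcal H^{s_1,s_2}$ be the completion of the space $C^\infty_{c,r}(\mathbb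 R^n)\times C^\infty_{c,r}(\mathbb R^n)$ of pairs of radial test functions (complex-valued) under the norm $$\|(u_1,u_2)\|_{\mathcal H^{s_1,s_2}}^2=\|u_1\|_{\dot H^{s_1}\cap\dot H^{s_2}}^2+\|u_2\|_{\dot H^{s_1-1}\cap\dot H^{s_2-1}}^2 .$$ For $s_1<n/2$ its elements are regarded as pairs of almost everywhere defined functions through the continuous embedding $\mathcal H^{s_1,s_2}\hookrightarrow L^{p(s_1)}(\mathbb R^n)\times L^{p(s_1-1)}(\mathbb R^n)$, $\frac n{p(s)}=\frac n2-s$, that extends the identity on pairs of test functions. **(i)** Suppose $1\le s_1\le\frac{n-3}2$ and $s_2\ge\frac n2-1$. Then $\mathbf N$ is a well-defined map of $\mathcal H^{s_1,s_2}$ into itself, and for every $\delta>0$ there is a constant $C>0$, depending only on $n,s_1,s_2,\delta$, such that $$\|\mathbf N(\mathbf u)-\mathbf N(\mathbf v)\|_{\mathcal H^{s_1,s_2}}\le C\,\big(\|\mathbf u\|_{\mathcal H^{s_1,s_2}}+\|\mathbf v\|_{\mathcal H^{s_1,s_2}}\big)\,\|\mathbf u-\mathbf v\|_{\mathcal H^{s_1,s_2}}$$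 for all $\mathbf u,\mathbf v\in\mathcal H^{s_1,s_2}$ of norm at most $\delta$. **(ii)** By (i), $\mathbf N$ is locally Lipschitz continuous on $\mathcal H^{\frac{n-3}2,\frac n2-1}$, and this is the largest of the spaces $\mathcal H^{s_1,s_2}$ with this property: if $1\le s_1\le s_2$ and $\mathbf N$ is, in the norm of $\mathcal H^{s_1,s_2}$, Lipschitz continuous on the pairs of radial test functions in some ball around $0$, then $s_1\le\frac{n-3}2$ and $s_2\ge\frac n2-1$, and the identity on pairs of test functions extends to a continuous linear injection $\mathcal H^{s_1,s_2}\hookrightarrow\mathcal H^{\frac{n-3}2,\frac n2-1}$. -/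

import Mathlib

open MeasureTheory Filter Topology
open scoped ENNReal ContDiff ComplexConjugate

noncomputable section

namespace YangMillsNonlin

/-- The Euclidean space `ℝⁿ`. -/
abbrev Rn (n : ℕ) : Type := EuclideanSpace ℝ (Fin n)

/-- The Fourier transform `(𝓕u)(ξ) = (2π)^{-n/2} ∫ u(x) e^{-i ξ·x} dx`. -/
def fourierT {n : ℕ} (u : Rn n → ℂ) (ξ : Rn n) : ℂ :=
  (((2 * Real.pi) ^ (-(n : ℝ) / 2) : ℝ) : ℂ) *
    ∫ x, Complex.exp (-(Complex.I * ((inner ℝ ξ x : ℝ) : ℂ))) * u x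

/-- The radial test space `C^∞_{c,r}(ℝⁿ)` of smooth, compactly supported, radial,
complex-valued functions. -/
def RadialTest (n : ℕ) : Submodule ℂ (Rn n → ℂ) where
  carrier := {f | ContDiff ℝ ∞ f ∧ HasCompactSupport f ∧ ∀ x y, ‖x‖ = ‖y‖ → f x = f y}
  add_mem' := by
    rintro f g ⟨hf1, hf2, hf3⟩ ⟨hg1, hg2, hg3⟩
    exact ⟨hf1.add hg1, hf2.add hg2, fun x y h => by simp [hf3 x y h, hg3 x y h]⟩
  zero_mem' := ⟨contDiff_const, HasCompactSupport.zero, fun _ _ _ => rfl⟩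
  smul_mem' := by
    rintro c f ⟨hf1, hf2, hf3⟩
    exact ⟨hf1.const_smul c, hf2.smul_left (f := fun _ => c), fun x y h => by simp [hf3 x y h]⟩

/-- The homogeneous Sobolev inner product `⟨|·|^s 𝓕u, |·|^s 𝓕v⟩_{L²}`, conjugate-linear in the
first argument. -/
def homInner {n : ℕ} (s : ℝ) (u v : Rn n → ℂ) : ℂ :=
  ∫ ξ, conj (((‖ξ‖ ^ s : ℝ) : ℂ) * fourierT u ξ) * (((‖ξ‖ ^ s : ℝ) : ℂ) * fourierT v ξ)

open Classical in
/-- The inner product of `Ḣ^{s₁} ∩ Ḣ^{s₂}`; the second term is present only if `s₁ < s₂`. -/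
def capInner {n : ℕ} (s₁ s₂ : ℝ) (u v : Rn n → ℂ) : ℂ :=
  homInner s₁ u v + if 0 < s₂ - s₁ then homInner s₂ u v else 0

/-- A pair of Sobolev exponents `1 ≤ s₁ ≤ s₂`. -/
structure Exponents where
  s₁ : ℝ
  s₂ : ℝ
  one_le : 1 ≤ s₁
  le : s₁ ≤ s₂

/-- The space `C^∞_{c,r}(ℝⁿ) × C^∞_{c,r}(ℝⁿ)`, which is to carry the norm of `𝓗^{s₁,s₂}`. -/
def TestPair (n : ℕ) (_e : Exponents) : Type := RadialTest n × RadialTest n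

instance (n : ℕ) (e : Exponents) : AddCommGroup (TestPair n e) :=
  inferInstanceAs (AddCommGroup (RadialTest n × RadialTest n))

instance (n : ℕ) (e : Exponents) : Module ℂ (TestPair n e) :=
  inferInstanceAs (Module ℂ (RadialTest n × RadialTest n))

/-- First component of a test pair, as a function on `ℝⁿ`. -/
def TestPair.fst {n : ℕ} {e : Exponents} (φ : TestPair n e) : Rn n → ℂ := (Prod.fst φ).1

/-- Second component of a test pair, as a function on `ℝⁿ`. -/
def TestPair.snd {n : ℕ} {e : Exponents} (φ : TestPair n e) : Rn n → ℂ := (Prod.snd φ).1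

/-- The inner product of `𝓗^{s₁,s₂}` on test pairs. -/
def pairInner {n : ℕ} {e : Exponents} (φ ψ : TestPair n e) : ℂ :=
  capInner e.s₁ e.s₂ φ.fst ψ.fst + capInner (e.s₁ - 1) (e.s₂ - 1) φ.snd ψ.snd

/-- The Fourier transform of a test function is a Schwartz function. -/
lemma exists_schwartz {n : ℕ} (f : RadialTest n) :
    ∃ g : SchwartzMap (Rn n) ℂ, ∀ ξ, fourierT f.1 ξ = g ξ := by
  obtain ⟨f, hf1, hf2, hf3⟩ := f
  let F : SchwartzMap (Rn n) ℂ := hf2.toSchwartzMap hf1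
  have hpi : (2 * Real.pi)⁻¹ ≠ 0 := by positivity
  let L : Rn n ≃L[ℝ] Rn n := ContinuousLinearEquiv.smulLeft (Units.mk0 _ hpi)
  let G : SchwartzMap (Rn n) ℂ :=
    SchwartzMap.compCLMOfContinuousLinearEquiv ℂ L (FourierTransform.fourier F)
  refine ⟨(((2 * Real.pi) ^ (-(n : ℝ) / 2) : ℝ) : ℂ) • G, fun ξ => ?_⟩
  have hG : G ξ = FourierTransform.fourier (F : Rn n → ℂ) ((2 * Real.pi)⁻¹ • ξ) := by
    rw [← SchwartzMap.fourier_coe]; rfl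
  rw [smul_apply, hG, Real.fourier_eq', smul_eq_mul, fourierT]
  congr 1
  refine integral_congr_ae (Eventually.of_forall fun x => ?_)
  have : F x = f x := rfl
  simp only [smul_eq_mul, this]
  congr 2
  rw [real_inner_smul_right, real_inner_comm ξ x]
  have : (Real.pi : ℂ) ≠ 0 := by exact_mod_cast Real.pi_ne_zero
  push_cast
  field_simp

lemma integrable_homInner {n : ℕ} {s : ℝ} (hs : 0 ≤ s) (f g : RadialTest n) :
    Integrable (fun ξ => conj (((‖ξ‖ ^ s : ℝ) : ℂ) * fourierT f.1 ξ) *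
      (((‖ξ‖ ^ s : ℝ) : ℂ) * fourierT g.1 ξ)) := by
  obtain ⟨F, hF⟩ := exists_schwartz f
  obtain ⟨G, hG⟩ := exists_schwartz g
  simp only [hF, hG]
  obtain ⟨C, hC0, hC⟩ := F.decay 0 0
  obtain ⟨k, hk⟩ := exists_nat_ge (s + s)
  have hint := (((G.integrable (μ := volume)).norm).add
    (G.integrable_pow_mul volume k)).const_mul C
  have hcont : Continuous fun ξ : Rn n => ((‖ξ‖ ^ s : ℝ) : ℂ) :=
    Complex.continuous_ofReal.comp (continuous_norm.rpow_const fun _ => Or.inr hs)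
  refine hint.mono' ?_ (Eventually.of_forall fun ξ => ?_)
  · exact ((Complex.continuous_conj.comp (hcont.mul F.continuous)).mul
      (hcont.mul G.continuous)).aestronglyMeasurable
  · have hFξ : ‖F ξ‖ ≤ C := by simpa using hC ξ
    have h0 : 0 ≤ ‖ξ‖ := norm_nonneg _
    have hp : ‖ξ‖ ^ s * ‖ξ‖ ^ s ≤ 1 + ‖ξ‖ ^ k := by
      rw [← Real.rpow_add_of_nonneg h0 hs hs]
      rcases le_total ‖ξ‖ 1 with h | h
      · have := Real.rpow_le_one h0 h (add_nonneg hs hs)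
        have := pow_nonneg h0 k
        linarith
      · have := Real.rpow_le_rpow_of_exponent_le h hk
        rw [Real.rpow_natCast] at this
        linarith
    have hs' : 0 ≤ ‖ξ‖ ^ s := Real.rpow_nonneg h0 _
    simp only [norm_mul, RCLike.norm_conj, Complex.norm_real, Real.norm_eq_abs, abs_of_nonneg hs',
      Pi.add_apply]
    calc ‖ξ‖ ^ s * ‖F ξ‖ * (‖ξ‖ ^ s * ‖G ξ‖)
        = ‖F ξ‖ * ((‖ξ‖ ^ s * ‖ξ‖ ^ s) * ‖G ξ‖) := by ring
      _ ≤ C * ((1 + ‖ξ‖ ^ k) * ‖G ξ‖) := by gcongr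
      _ = C * (‖G ξ‖ + ‖ξ‖ ^ k * ‖G ξ‖) := by ring

lemma fourierT_add {n : ℕ} (f g : RadialTest n) (ξ : Rn n) :
    fourierT (f.1 + g.1) ξ = fourierT f.1 ξ + fourierT g.1 ξ := by
  have key : ∀ h : RadialTest n, Integrable fun x : Rn n =>
      Complex.exp (-(Complex.I * ((inner ℝ ξ x : ℝ) : ℂ))) * h.1 x := by
    rintro ⟨h, h1, h2, h3⟩
    refine Continuous.integrable_of_hasCompactSupport ?_ h2.mul_left
    have hc := h1.continuous
    exact Continuous.mul (by fun_prop) hc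
  simp only [fourierT, Pi.add_apply, mul_add]
  rw [integral_add (key f) (key g), mul_add]

lemma fourierT_smul {n : ℕ} (c : ℂ) (f : Rn n → ℂ) (ξ : Rn n) :
    fourierT (c • f) ξ = c * fourierT f ξ := by
  simp only [fourierT, Pi.smul_apply, smul_eq_mul, mul_left_comm _ c]
  rw [integral_const_mul, mul_left_comm]

lemma homInner_conj {n : ℕ} (s : ℝ) (f g : Rn n → ℂ) :
    conj (homInner s g f) = homInner s f g := by
  rw [homInner, ← integral_conj]
  refine integral_congr_ae (Eventually.of_forall fun x => ?_)
  simp [mul_comm]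

lemma homInner_nonneg {n : ℕ} (s : ℝ) (f : Rn n → ℂ) : 0 ≤ (homInner s f f).re := by
  have : homInner s f f =
      ((∫ ξ, ‖((‖ξ‖ ^ s : ℝ) : ℂ) * fourierT f ξ‖ ^ 2 : ℝ) : ℂ) := by
    rw [homInner, ← integral_complex_ofReal]
    refine integral_congr_ae (Eventually.of_forall fun x => ?_)
    simp only [Complex.conj_mul']
    push_cast
    rfl
  rw [this, Complex.ofReal_re]
  positivity

lemma homInner_add {n : ℕ} {s : ℝ} (hs : 0 ≤ s) (f g h : RadialTest n) :
    homInner s (f.1 + g.1) h.1 = homInner s f.1 h.1 + homInner s g.1 h.1 := by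
  rw [homInner, homInner, homInner,
    ← integral_add (integrable_homInner hs f h) (integrable_homInner hs g h)]
  refine integral_congr_ae (Eventually.of_forall fun x => ?_)
  simp only [fourierT_add, mul_add, map_add, add_mul]

lemma homInner_smul {n : ℕ} (s : ℝ) (c : ℂ) (f h : Rn n → ℂ) :
    homInner s (c • f) h = conj c * homInner s f h := by
  rw [homInner, homInner, ← integral_const_mul]
  refine integral_congr_ae (Eventually.of_forall fun x => ?_)
  simp only [fourierT_smul, map_mul]
  ring

lemma capInner_conj {n : ℕ} (s₁ s₂ : ℝ) (f g : Rn n → ℂ) :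
    conj (capInner s₁ s₂ g f) = capInner s₁ s₂ f g := by
  unfold capInner; split_ifs <;> simp [homInner_conj]

lemma capInner_nonneg {n : ℕ} (s₁ s₂ : ℝ) (f : Rn n → ℂ) : 0 ≤ (capInner s₁ s₂ f f).re := by
  have h1 := homInner_nonneg s₁ f
  have h2 := homInner_nonneg s₂ f
  unfold capInner; split_ifs
  · rw [Complex.add_re]; positivity
  · simpa using h1

lemma capInner_add {n : ℕ} {s₁ s₂ : ℝ} (h₁ : 0 ≤ s₁) (h₂ : 0 ≤ s₂) (f g h : RadialTest n) :
    capInner s₁ s₂ (f.1 + g.1) h.1 = capInner s₁ s₂ f.1 h.1 + capInner s₁ s₂ g.1 h.1 := by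
  unfold capInner; split_ifs
  · rw [homInner_add h₁, homInner_add h₂]; ring
  · rw [homInner_add h₁]; ring

lemma capInner_smul {n : ℕ} (s₁ s₂ : ℝ) (c : ℂ) (f h : Rn n → ℂ) :
    capInner s₁ s₂ (c • f) h = conj c * capInner s₁ s₂ f h := by
  unfold capInner; split_ifs
  · rw [homInner_smul, homInner_smul]; ring
  · rw [homInner_smul]; ring

/-- `pairInner` is a (semi-definite) inner product. -/
@[reducible] def pairCore (n : ℕ) (e : Exponents) :
    PreInnerProductSpace.Core ℂ (TestPair n e) where
  inner := pairInner
  conj_inner_symm φ ψ := by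
    change conj (pairInner ψ φ) = pairInner φ ψ
    simp [pairInner, capInner_conj]
  re_inner_nonneg φ := by
    change 0 ≤ (pairInner φ φ).re
    rw [pairInner, Complex.add_re]
    exact add_nonneg (capInner_nonneg _ _ _) (capInner_nonneg _ _ _)
  add_left φ ψ χ := by
    have h1 := e.one_le
    have h2 := e.le
    have ha := capInner_add (s₁ := e.s₁) (s₂ := e.s₂) (by linarith) (by linarith)
      (Prod.fst φ) (Prod.fst ψ) (Prod.fst χ)
    have hb := capInner_add (s₁ := e.s₁ - 1) (s₂ := e.s₂ - 1) (by linarith) (by linarith)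
      (Prod.snd φ) (Prod.snd ψ) (Prod.snd χ)
    change capInner _ _ ((Prod.fst φ).1 + (Prod.fst ψ).1) (Prod.fst χ).1 +
      capInner _ _ ((Prod.snd φ).1 + (Prod.snd ψ).1) (Prod.snd χ).1 = _
    rw [ha, hb]
    simp only [pairInner, TestPair.fst, TestPair.snd]
    ring
  smul_left φ ψ c := by
    change capInner _ _ (c • (Prod.fst φ).1) (Prod.fst ψ).1 +
      capInner _ _ (c • (Prod.snd φ).1) (Prod.snd ψ).1 = _
    rw [capInner_smul, capInner_smul]
    simp only [pairInner, TestPair.fst, TestPair.snd]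
    ring

instance (n : ℕ) (e : Exponents) : SeminormedAddCommGroup (TestPair n e) :=
  @InnerProductSpace.Core.toSeminormedAddCommGroup ℂ (TestPair n e) _ _ _ (pairCore n e)

instance (n : ℕ) (e : Exponents) : InnerProductSpace ℂ (TestPair n e) :=
  InnerProductSpace.ofCore (pairCore n e)

/-- The Hilbert space `𝓗^{s₁,s₂}`: the completion of `C^∞_{c,r}(ℝⁿ) × C^∞_{c,r}(ℝⁿ)`. -/
abbrev HSpace (n : ℕ) (e : Exponents) : Type := UniformSpace.Completion (TestPair n e)

/-- The exponent `p(s)` of the critical Sobolev embedding, `n / p(s) = n / 2 - s`. -/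
def critExp (n : ℕ) (s : ℝ) : ℝ≥0∞ := ENNReal.ofReal (2 * n / (n - 2 * s))

/-- The element `U` of `𝓗^{s₁,s₂}` (with `s₁ < n / 2`) is, under the continuous embedding
`𝓗^{s₁,s₂} ↪ L^{p(s₁)} × L^{p(s₁ - 1)}` extending the identity on test pairs, the pair of
almost everywhere defined functions `(u₁, u₂)`. -/
def Represents {n : ℕ} {e : Exponents} (U : HSpace n e) (u₁ u₂ : Rn n → ℂ) : Prop :=
  MemLp u₁ (critExp n e.s₁) volume ∧ MemLp u₂ (critExp n (e.s₁ - 1)) volume ∧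
    ∃ φ : ℕ → TestPair n e,
      Tendsto (fun k => (φ k : HSpace n e)) atTop (𝓝 U) ∧
      Tendsto (fun k => eLpNorm ((φ k).fst - u₁) (critExp n e.s₁) volume) atTop (𝓝 0) ∧
      Tendsto (fun k => eLpNorm ((φ k).snd - u₂) (critExp n (e.s₁ - 1)) volume) atTop (𝓝 0)

/-- `α(d) = 2 (1 + √((d-4)/(3(d-2))))`, with the principal complex square root (the usual real
one for `d ≥ 4`). -/
def alphaConst (d : ℝ) : ℂ :=
  2 * (1 + (((d - 4) / (3 * (d - 2)) : ℝ) : ℂ) ^ (1 / 2 : ℂ))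

/-- `β(d) = (2d - 8 + √(3(d-2)(d-4))) / 3`, with the principal complex square root (the usual real
one for `d ≥ 4`). -/
def betaConst (d : ℝ) : ℂ :=
  1 / 3 * (2 * (d : ℂ) - 8 + ((3 * (d - 2) * (d - 4) : ℝ) : ℂ) ^ (1 / 2 : ℂ))

/-- The self-similar profile `φ₀(x) = α(d) / (|x|² + β(d))` on `ℝⁿ`, where `d = n - 2`. -/
def profile (n : ℕ) (x : Rn n) : ℂ :=
  alphaConst ((n : ℝ) - 2) / (((‖x‖ ^ 2 : ℝ) : ℂ) + betaConst ((n : ℝ) - 2))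

/-- `N(x, u₁) = (n - 4) u₁² (3 - 3 |x|² φ₀(x) - |x|² u₁)`. -/
def scalarN (n : ℕ) (x : Rn n) (z : ℂ) : ℂ :=
  ((n : ℂ) - 4) * z ^ 2 *
    (3 - 3 * ((‖x‖ ^ 2 : ℝ) : ℂ) * profile n x - ((‖x‖ ^ 2 : ℝ) : ℂ) * z)

/-- `F` is the nonlinear operator `𝐍(u₁, u₂) = (0, N(·, u₁))` on `𝓗^{s₁,s₂}`, the elements of which
are viewed as pairs of functions (in particular each element is such a pair). -/
def IsNonlinearity {n : ℕ} {e : Exponents} (F : HSpace n e → HSpace n e) : Prop :=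
  ∀ U : HSpace n e, (∃ u₁ u₂, Represents U u₁ u₂) ∧
    ∀ u₁ u₂, Represents U u₁ u₂ → Represents (F U) 0 (fun x => scalarN n x (u₁ x))

/-- The test pair `χ` is `𝐍(φ) = (0, N(·, φ₁))` (almost everywhere). -/
def IsNOf {n : ℕ} {e : Exponents} (φ χ : TestPair n e) : Prop :=
  χ.fst = 0 ∧ χ.snd =ᵐ[volume] fun x => scalarN n x (φ.fst x)

/-- `𝐍` is Lipschitz continuous with respect to the norm of `𝓗^{s₁,s₂}` on the test pairs in
some ball around zero. -/
def LipschitzNearZero (n : ℕ) (e : Exponents) : Prop :=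
  ∃ δ > 0, ∃ C : ℝ, ∀ φ ψ χ η : TestPair n e, ‖φ‖ ≤ δ → ‖ψ‖ ≤ δ → IsNOf φ χ → IsNOf ψ η →
    ‖χ - η‖ ≤ C * ‖φ - ψ‖

/-- The exponents `((n-3)/2, n/2-1)`. -/
def optExponents (n : ℕ) (hn : 5 ≤ n) : Exponents where
  s₁ := ((n : ℝ) - 3) / 2
  s₂ := (n : ℝ) / 2 - 1
  one_le := by
    have : (5 : ℝ) ≤ n := by exact_mod_cast hn
    linarith
  le := by linarith

/-- A test pair, its norm being forgotten and replaced by that for other exponents. -/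
def TestPair.change {n : ℕ} {e : Exponents} (e' : Exponents) (φ : TestPair n e) :
    TestPair n e' := φ

end YangMillsNonlin

end

/-! Write d = n − 2 and N(x,u) = (n−4)(a(x)u² − |x|²u³) with a = 3 − 3|x|²φ₀. Everything happens on
the Fourier side, where products of functions become convolutions and only the moduli of Fourier
transforms matter.

Sufficiency. The constant part of a is handled on ℝⁿ: Sobolev embedding and Hölder give Ḣ¹ ·
Ḣ^{n/2−1} → L², and |ξ|^k ≤ 2^k(|η|^k + |ξ−η|^k) distributes derivatives of any order over the
factors (`wNorm_lconvolution_weighted`). The weight |x|² is removed by a change of dimension. If u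
is radial on ℝ^{d+2}, the vector field x u on ℝ^d has Fourier transform −iξ û
(`fourier_inner_mul_comp`), so its Ḣ^s norms on ℝ^d are those of u on ℝ^{d+2} up to one constant for
all s (`exists_wNorm_fourier_eq`). Since x|x|²avw = ((xa)·(xv)) xw, a weighted cubic product on ℝⁿ
becomes an unweighted one on ℝ^d (`shiftMaj_le_lconvolution`). There Ḣ^{(d−1)/2} · Ḣ¹ · Ḣ^{(d−1)/2}
→ L², and (d−1)/2 = (n−3)/2 is the lower threshold.

The remaining part of a is a multiple of |x|²/(|x|²+β). It fits the same trilinear scheme with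
1/(|x|²+β) as one of the three factors, once x/(|x|²+β) has a Fourier majorant with finite weighted
norms (`fourierMajorant_resolvent`). This comes from writing the potential as a Laplace integral of
Gaussians along a ray w(0,∞) with Re w, Re wβ > 0; the ray has to leave the real axis when n = 5,
where β is complex with negative real part. For n = 6 one has β = 0, but then |x|²φ₀ is constant off
the origin and no potential is left.

The resulting Lipschitz bound on test pairs extends to the completion
(`exists_extension_completion`). Convergence almost everywhere along subsequences identifies the
extension with N. An element of the completion is determined by its functions, because a sequence
that is Cauchy in a Sobolev norm and null in a Lebesgue norm is null in the Sobolev norm; hence the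
operator is unique.

Necessity. Combining f with −f and then rescaling the amplitude separates the Lipschitz bound into a
quadratic and a cubic homogeneous bound (`exists_homogeneous_bounds`). Concentrated bumps violate
the quadratic one if s₂ < n/2 − 1, since a is nonzero at the origin after cancellation of its
singularity; spread-out bumps violate the cubic one if s₁ > (n−3)/2. The inclusion is then
interpolation of weights, and its injectivity is again a closability statement (`exists_inclusion`).
-/

noncomputable section

namespace YangMillsNonlin

open FourierTransform Module

/-! ### Plancherel's theorem on L¹ ∩ L² and weighted L² norms -/

section

variable {E : Type*} [NormedAddCommGroup E] [InnerProductSpace ℝ E] [FiniteDimensional ℝ E]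
  [MeasurableSpace E] [BorelSpace E]

/-- Integration in polar coordinates for nonnegative radial functions. -/
lemma lintegral_fun_norm [Nontrivial E] {f : ℝ → ℝ≥0∞} (hf : Measurable f) :
    ∫⁻ x : E, f ‖x‖ = finrank ℝ E * volume (Metric.ball (0 : E) 1) *
      ∫⁻ y in Set.Ioi (0 : ℝ), ENNReal.ofReal (y ^ (finrank ℝ E - 1)) * f y := by
  have hmp := (volume : Measure E).measurePreserving_homeomorphUnitSphereProd
  calc ∫⁻ x : E, f ‖x‖ = ∫⁻ x in ({(0)}ᶜ : Set E), f ‖x‖ := by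
        rw [restrict_compl_singleton]
    _ = ∫⁻ x : ({(0)}ᶜ : Set E), f ‖x.1‖ ∂((volume : Measure E).comap (↑)) := by
        rw [lintegral_subtype_comap (measurableSet_singleton _).compl fun x ↦ f (‖x‖)]
    _ = ∫⁻ x, f x.2 ∂(volume : Measure E).toSphere.prod (.volumeIoiPow (finrank ℝ E - 1)) := by
        have := hmp.lintegral_comp (f := fun x => f x.2)
          (hf.comp (measurable_subtype_coe.comp measurable_snd))
        simpa using this
    _ = (volume : Measure E).toSphere Set.univ *
          ∫⁻ x : Set.Ioi (0 : ℝ), f x ∂.volumeIoiPow (finrank ℝ E - 1) := by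
        rw [lintegral_prod _ (by fun_prop)]
        simp [mul_comm]
    _ = _ := by
        rw [Measure.toSphere_apply_univ, Measure.volumeIoiPow,
          lintegral_withDensity_eq_lintegral_mul _ (by fun_prop) (by fun_prop)]
        congr 1
        exact lintegral_subtype_comap measurableSet_Ioi
          fun a => ENNReal.ofReal (a ^ (finrank ℝ E - 1)) * f a

/-- On `L¹ ∩ L²` the Fourier integral agrees with the Fourier transform of `L²`. -/
lemma fourier_toLp_two_ae {g : E → ℂ} (h1 : Integrable g) (h2 : MemLp g 2) :
    (𝓕 (h2.toLp g) : Lp (α := E) ℂ 2 volume) =ᵐ[volume] 𝓕 g := by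
  -- Two locally integrable functions agree if all test functions pair equally with them. Against φ
  -- both sides give ∫ φ̂ g: one through the transform of tempered distributions, the other through
  -- the multiplication formula for L¹.
  refine ae_eq_of_integral_contDiff_smul_eq ((Lp.memLp _).locallyIntegrable (by norm_num)) ?_ ?_
  · refine Continuous.locallyIntegrable ?_
    exact VectorFourier.fourierIntegral_continuous Real.continuous_fourierChar
      (by exact continuous_inner) h1
  · intro φ hφ hφc
    have hφ₁ : HasCompactSupport (Complex.ofRealCLM ∘ φ) := hφc.comp_left rfl
    have hφ₂ : ContDiff ℝ ∞ (Complex.ofRealCLM ∘ φ) := by fun_prop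
    let Φ : SchwartzMap E ℂ := hφ₁.toSchwartzMap hφ₂
    have hΦ : ∀ x, Φ x = (φ x : ℂ) := fun x => rfl
    have e1 : ∫ x, φ x • (𝓕 (h2.toLp g) : Lp (α := E) ℂ 2 volume) x
        = Lp.toTemperedDistribution (𝓕 (h2.toLp g) : Lp (α := E) ℂ 2 volume) Φ := by
      rw [Lp.toTemperedDistribution_apply]
      simp [hΦ]
    rw [e1, ← Lp.fourier_toTemperedDistribution_eq, TemperedDistribution.fourier_apply,
      Lp.toTemperedDistribution_apply]
    have e2 : ∫ x, (𝓕 Φ : SchwartzMap E ℂ) x • (h2.toLp g) x = ∫ x, 𝓕 (Φ : E → ℂ) x • g x := by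
      refine integral_congr_ae ?_
      filter_upwards [h2.coeFn_toLp] with x hx
      rw [hx, SchwartzMap.fourier_coe]
    rw [e2]
    have := VectorFourier.integral_fourierIntegral_smul_eq_flip (L := innerₗ E)
      (μ := volume) (ν := volume) (f := (Φ : E → ℂ)) (g := g)
      Real.continuous_fourierChar (by exact continuous_inner) Φ.integrable h1
    simp only [flip_innerₗ] at this
    refine this.trans ?_
    refine integral_congr_ae (Eventually.of_forall fun x => ?_)
    simp only [hΦ, Complex.real_smul, smul_eq_mul]
    rfl

lemma eLpNorm_fourier_eq {g : E → ℂ} (h1 : Integrable g) (h2 : MemLp g 2) :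
    eLpNorm (𝓕 g) 2 volume = eLpNorm g 2 volume := by
  rw [← eLpNorm_congr_ae (fourier_toLp_two_ae h1 h2), ← eLpNorm_congr_ae h2.coeFn_toLp,
    ← Lp.enorm_def, ← Lp.enorm_def]
  simp only [enorm_eq_nnnorm]
  congr 1
  exact Subtype.ext (Lp.norm_fourier_eq _)

lemma eLpNorm_fourierInv_eq {g : E → ℂ} (h1 : Integrable g) (h2 : MemLp g 2) :
    eLpNorm (𝓕⁻ g) 2 volume = eLpNorm g 2 volume := by
  have hneg : MeasurePreserving (fun x : E => -x) := Measure.measurePreserving_neg _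
  rw [Real.fourierInv_eq_fourier_comp_neg, eLpNorm_fourier_eq h1.comp_neg
    (h2.comp_measurePreserving hneg)]
  exact eLpNorm_comp_measurePreserving h2.1 hneg

/-- The weighted norm `‖|·|^s G‖_{L²}` of a nonnegative function. -/
def wNorm (s : ℝ) (G : E → ℝ≥0∞) : ℝ≥0∞ := eLpNorm (fun ξ => ‖ξ‖ₑ ^ s * G ξ) 2 volume

lemma wNorm_sq (s : ℝ) (G : E → ℝ≥0∞) :
    wNorm s G ^ 2 = ∫⁻ ξ, (‖ξ‖ₑ ^ s * G ξ) ^ 2 := by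
  rw [wNorm, eLpNorm_eq_lintegral_rpow_enorm_toReal (by norm_num) (by norm_num)]
  rw [← ENNReal.rpow_natCast, ← ENNReal.rpow_mul]
  norm_num

end

/-! ### The critical Sobolev embedding -/

section

variable {E : Type*} [NormedAddCommGroup E] [InnerProductSpace ℝ E] [FiniteDimensional ℝ E]
  [MeasurableSpace E] [BorelSpace E]

lemma enorm_fourierInv_le (G : E → ℂ) (x : E) : ‖𝓕⁻ G x‖ₑ ≤ ∫⁻ ξ, ‖G ξ‖ₑ := by
  rw [Real.fourierInv_eq]
  refine (enorm_integral_le_lintegral_enorm _).trans (le_of_eq ?_)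
  refine lintegral_congr fun ξ => ?_
  rw [← ofReal_norm, ← ofReal_norm, Circle.norm_smul]

/-- Integral of a negative power of the norm over a ball. -/
lemma lintegral_ball_rpow [Nontrivial E] {s : ℝ} (hs : 2 * s < finrank ℝ E) {A : ℝ} (hA : 0 < A) :
    ∫⁻ ξ in {ξ : E | ‖ξ‖ ≤ A}, ENNReal.ofReal (‖ξ‖ ^ (-(2 * s))) =
      finrank ℝ E * volume (Metric.ball (0 : E) 1) *
        ENNReal.ofReal (A ^ ((finrank ℝ E : ℝ) - 2 * s) / ((finrank ℝ E : ℝ) - 2 * s)) := by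
  have hm : 0 < finrank ℝ E := finrank_pos
  have hS : MeasurableSet {ξ : E | ‖ξ‖ ≤ A} := measurableSet_le measurable_norm measurable_const
  rw [← lintegral_indicator hS]
  have h1 : ∀ ξ : E, Set.indicator {ξ : E | ‖ξ‖ ≤ A}
      (fun ξ => ENNReal.ofReal (‖ξ‖ ^ (-(2 * s)))) ξ =
      (Set.Iic A).indicator (fun r : ℝ => ENNReal.ofReal (r ^ (-(2 * s)))) ‖ξ‖ := by
    intro ξ; simp [Set.indicator]
  simp_rw [h1]
  rw [lintegral_fun_norm (Measurable.indicator (by fun_prop) measurableSet_Iic)]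
  congr 1
  have h2 : ∀ y ∈ Set.Ioi (0 : ℝ), ENNReal.ofReal (y ^ (finrank ℝ E - 1)) *
      (Set.Iic A).indicator (fun r : ℝ => ENNReal.ofReal (r ^ (-(2 * s)))) y =
      (Set.Iic A).indicator (fun r : ℝ => ENNReal.ofReal (r ^ ((finrank ℝ E : ℝ) - 2 * s - 1))) y := by
    intro y hy
    have hy : 0 < y := hy
    by_cases hyA : y ∈ Set.Iic A
    · rw [Set.indicator_of_mem hyA, Set.indicator_of_mem hyA,
        ← ENNReal.ofReal_mul (by positivity), ← Real.rpow_natCast, ← Real.rpow_add hy]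
      congr 2
      rw [Nat.cast_sub hm]; push_cast; ring
    · simp [Set.indicator_of_notMem hyA]
  rw [setLIntegral_congr_fun measurableSet_Ioi h2, lintegral_indicator measurableSet_Iic,
    Measure.restrict_restrict measurableSet_Iic, Set.inter_comm, Set.Ioi_inter_Iic,
    ← ofReal_integral_eq_lintegral_ofReal]
  · rw [← intervalIntegral.integral_of_le hA.le, integral_rpow (Or.inl (by linarith)),
      Real.zero_rpow (by linarith)]
    congr 1
    rw [sub_zero, show (finrank ℝ E : ℝ) - 2 * s - 1 + 1 = (finrank ℝ E : ℝ) - 2 * s by ring]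
  · have := intervalIntegral.intervalIntegrable_rpow' (a := 0) (b := A)
      (r := (finrank ℝ E : ℝ) - 2 * s - 1) (by linarith)
    rwa [intervalIntegrable_iff_integrableOn_Ioc_of_le hA.le] at this
  · filter_upwards [ae_restrict_mem measurableSet_Ioc] with y hy
    exact Real.rpow_nonneg hy.1.le _

/-- The low-frequency part of a function in `Ḣ^s` has small integrable Fourier transform. -/
lemma lintegral_low_le [Nontrivial E] {s : ℝ} (hs : 2 * s < finrank ℝ E) :
    ∃ c : ℝ, 0 < c ∧ ∀ (G : E → ℝ≥0∞), Measurable G → ∀ A : ℝ, 0 < A →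
      ∫⁻ ξ in {ξ : E | ‖ξ‖ ≤ A}, G ξ ≤
        ENNReal.ofReal (c * A ^ (((finrank ℝ E : ℝ) - 2 * s) / 2)) * wNorm s G := by
  set m : ℝ := ((finrank ℝ E : ℕ) : ℝ) with hm
  set V : ℝ≥0∞ := finrank ℝ E * volume (Metric.ball (0 : E) 1) with hV
  have hVfin : V ≠ ⊤ := ENNReal.mul_ne_top (by simp) measure_ball_lt_top.ne
  have hm0 : 0 < m - 2 * s := by linarith
  -- Cauchy–Schwarz against |ξ|^{-s} on the ball produces the first summand; the 1 is added only to
  -- make the constant visibly positive.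
  refine ⟨(V.toReal / (m - 2 * s)) ^ (1 / 2 : ℝ) + 1, by positivity, fun G hG A hA => ?_⟩
  have hS : MeasurableSet {ξ : E | ‖ξ‖ ≤ A} := measurableSet_le measurable_norm measurable_const
  have hz : ∀ᵐ ξ : E ∂volume.restrict {ξ : E | ‖ξ‖ ≤ A}, ξ ≠ 0 :=
    ae_restrict_of_ae (Measure.ae_ne volume 0)
  calc ∫⁻ ξ in {ξ : E | ‖ξ‖ ≤ A}, G ξ
      = ∫⁻ ξ in {ξ : E | ‖ξ‖ ≤ A}, (ENNReal.ofReal (‖ξ‖ ^ (-s))) * (‖ξ‖ₑ ^ s * G ξ) := by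
        refine lintegral_congr_ae ?_
        filter_upwards [hz] with ξ hξ
        have hpos : 0 < ‖ξ‖ := norm_pos_iff.2 hξ
        rw [← mul_assoc, ← ofReal_norm, ENNReal.ofReal_rpow_of_pos hpos,
          ← ENNReal.ofReal_mul (by positivity), ← Real.rpow_add hpos]
        simp
    _ ≤ (∫⁻ ξ in {ξ : E | ‖ξ‖ ≤ A}, (ENNReal.ofReal (‖ξ‖ ^ (-s))) ^ (2:ℝ)) ^ (1 / 2 : ℝ) *
        (∫⁻ ξ in {ξ : E | ‖ξ‖ ≤ A}, (‖ξ‖ₑ ^ s * G ξ) ^ (2:ℝ)) ^ (1 / 2 : ℝ) :=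
        ENNReal.lintegral_mul_le_Lp_mul_Lq _ (by constructor <;> norm_num)
          (by fun_prop) (by fun_prop)
    _ ≤ ENNReal.ofReal (((V.toReal / (m - 2 * s)) ^ (1 / 2 : ℝ)) * A ^ ((m - 2 * s) / 2))
        * wNorm s G := by
        gcongr
        · have : ∀ ξ : E, (ENNReal.ofReal (‖ξ‖ ^ (-s))) ^ (2:ℝ) =
              ENNReal.ofReal (‖ξ‖ ^ (-(2 * s))) := by
            intro ξ
            rw [ENNReal.ofReal_rpow_of_nonneg (by positivity) (by norm_num),
              ← Real.rpow_mul (norm_nonneg _)]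
            ring_nf
          simp_rw [this]
          rw [lintegral_ball_rpow hs hA, ← hV, ← ENNReal.ofReal_toReal hVfin,
            ← ENNReal.ofReal_mul (by positivity),
            ENNReal.ofReal_rpow_of_nonneg (by positivity) (by norm_num)]
          refine le_of_eq ?_
          rw [ENNReal.toReal_ofReal (by positivity)]
          congr 1
          rw [show V.toReal * (A ^ (m - 2 * s) / (m - 2 * s)) =
            V.toReal / (m - 2 * s) * A ^ (m - 2 * s) by ring,
            Real.mul_rpow (by positivity) (by positivity), ← Real.rpow_mul hA.le]
          ring_nf
        · rw [wNorm, eLpNorm_eq_lintegral_rpow_enorm_toReal (by norm_num) (by norm_num)]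
          simp only [ENNReal.toReal_ofNat, enorm_eq_self]
          gcongr
          exact Measure.restrict_le_self
    _ ≤ _ := by
        gcongr
        linarith

/-- A level-dependent frequency splitting. At height t the frequencies below a cut-off A(t)
contribute at most t/4 in sup norm, so the superlevel set is controlled by the L² norm of the high
frequencies through Chebyshev and Plancherel. The layer cake formula and Fubini then reassemble
|ξ|^{2s}|G|². The argument needs p > 2, so s = 0 is treated separately, where the claim is
Plancherel. -/
theorem sobolev_embedding [Nontrivial E] {s : ℝ} (hs0 : 0 ≤ s) (hs : 2 * s < finrank ℝ E) :
    ∃ C : ℝ≥0∞, C ≠ ⊤ ∧ ∀ G : E → ℂ, StronglyMeasurable G → Integrable G → MemLp G 2 →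
      eLpNorm (𝓕⁻ G) (ENNReal.ofReal (2 * finrank ℝ E / (finrank ℝ E - 2 * s))) volume
        ≤ C * wNorm s (fun ξ => ‖G ξ‖ₑ) := by
  rcases hs0.eq_or_lt with rfl | hs0
  · refine ⟨1, by simp, fun G _ h1 h2 => ?_⟩
    have hm : (finrank ℝ E : ℝ) ≠ 0 := by simpa using finrank_pos.ne'
    rw [mul_zero, sub_zero, mul_div_assoc, div_self hm, mul_one, one_mul, wNorm]
    simp only [ENNReal.rpow_zero, one_mul, ENNReal.ofReal_ofNat]
    rw [eLpNorm_fourierInv_eq h1 h2]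
    exact (eLpNorm_enorm G).symm.le
  obtain ⟨c, hc, hlow⟩ := lintegral_low_le (E := E) hs
  set m : ℝ := ((finrank ℝ E : ℕ) : ℝ) with hm
  have hκ : 0 < m - 2 * s := by linarith
  have hmpos : 0 < m := by linarith
  set p : ℝ := 2 * m / (m - 2 * s) with hp
  have hp2 : 2 < p := by rw [hp, lt_div_iff₀ hκ]; linarith
  -- This identity singles out the critical p: integrating t^{p-3} up to a multiple of
  -- |ξ|^{(m-2s)/2} returns exactly the weight |ξ|^{2s}.
  have hps : (m - 2 * s) / 2 * (p - 2) = 2 * s := by rw [hp]; field_simp; ring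
  set K : ℝ := p * 4 * ((4 * c) ^ (p - 2) / (p - 2)) with hK
  have hp2' : 0 < p - 2 := by linarith
  have hK0 : 0 < K := by positivity
  refine ⟨(ENNReal.ofReal K) ^ (1 / p), by
    refine ENNReal.rpow_ne_top_of_nonneg (by positivity) (by simp), fun G hGm h1 h2 => ?_⟩
  have hGe : Measurable fun ξ => ‖G ξ‖ₑ := hGm.measurable.enorm
  set W := wNorm s (fun ξ => ‖G ξ‖ₑ) with hW
  have hpK : ENNReal.ofReal K ^ (1 / p) ≠ 0 := by
    simp only [ne_eq, ENNReal.rpow_eq_zero_iff, ENNReal.ofReal_eq_zero, not_or]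
    exact ⟨fun h => absurd h.1 (by linarith), fun h => by simp at h⟩
  rcases eq_or_ne W ⊤ with hWt | hWt
  · rw [hWt, ENNReal.mul_top hpK]; exact le_top
  rcases eq_or_ne W 0 with hW0 | hW0
  · have : (fun ξ => ‖ξ‖ₑ ^ s * ‖G ξ‖ₑ) =ᵐ[volume] 0 := by
      rw [hW, wNorm, eLpNorm_eq_zero_iff (Measurable.aestronglyMeasurable (by fun_prop))
        (by norm_num)] at hW0
      exact hW0
    have hG0 : G =ᵐ[volume] 0 := by
      filter_upwards [this, Measure.ae_ne volume 0] with ξ h hξ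
      have hpos : ‖ξ‖ₑ ^ s ≠ 0 := by
        simp [hξ]
      simpa [hpos] using h
    have : 𝓕⁻ G = 0 := by
      funext x
      rw [Real.fourierInv_congr_ae hG0 x, Real.fourierInv_eq]; simp
    rw [this]; simp
  set M : ℝ := W.toReal with hM
  have hM0 : 0 < M := ENNReal.toReal_pos hW0 hWt
  have hWM : W = ENNReal.ofReal M := (ENNReal.ofReal_toReal hWt).symm
  -- the cut-off frequency belonging to the level `t`
  let A : ℝ → ℝ := fun t => (t / (4 * c * M)) ^ (2 / (m - 2 * s))
  have hApos : ∀ t, 0 < t → 0 < A t := fun t ht => by positivity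
  have hAeq : ∀ t, 0 < t → c * A t ^ ((m - 2 * s) / 2) * M = t / 4 := by
    intro t ht
    simp only [A]
    rw [← Real.rpow_mul (by positivity), show 2 / (m - 2 * s) * ((m - 2 * s) / 2) = 1 by field_simp,
      Real.rpow_one]
    field_simp
  have hAlt : ∀ t r, 0 < t → 0 ≤ r → A t < r → t < 4 * c * M * r ^ ((m - 2 * s) / 2) := by
    intro t r ht hr h
    have h3 : A t ^ ((m - 2 * s) / 2) < r ^ ((m - 2 * s) / 2) :=
      Real.rpow_lt_rpow (hApos t ht).le h (by linarith)
    have := hAeq t ht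
    have h4 : 0 < c * M := by positivity
    nlinarith
  have hcont : Continuous (𝓕⁻ G) := by
    rw [Real.fourierInv_eq_fourier_comp_neg]
    exact VectorFourier.fourierIntegral_continuous Real.continuous_fourierChar
      (by exact continuous_inner) h1.comp_neg
  -- Where the function exceeds t and its low-frequency part is at most t/4, the high-frequency part
  -- exceeds t/2; Chebyshev in L² at that height gives the factor 4/t².
  have hlevel : ∀ t, 0 < t → volume {x : E | t < ‖𝓕⁻ G x‖} ≤
      ENNReal.ofReal (4 / t ^ 2) * ∫⁻ ξ, {ξ : E | A t < ‖ξ‖}.indicator (fun ξ => ‖G ξ‖ₑ ^ 2) ξ := by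
    intro t ht
    set L := {ξ : E | ‖ξ‖ ≤ A t} with hL
    have hLm : MeasurableSet L := measurableSet_le measurable_norm measurable_const
    have hsplit : ∀ x, 𝓕⁻ G x = 𝓕⁻ (L.indicator G) x + 𝓕⁻ (Lᶜ.indicator G) x := by
      intro x
      rw [Real.fourierInv_eq, Real.fourierInv_eq, Real.fourierInv_eq, ← integral_add]
      · congr 1; funext ξ
        rw [← smul_add, ← Pi.add_apply, Set.indicator_self_add_compl]
      · have := (Real.fourierIntegral_convergent_iff (μ := volume) (-x)).2 (h1.indicator hLm)
        simpa using this
      · have := (Real.fourierIntegral_convergent_iff (μ := volume) (-x)).2 (h1.indicator hLm.compl)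
        simpa using this
    have hlo : ∀ x, ‖𝓕⁻ (L.indicator G) x‖ ≤ t / 4 := by
      intro x
      have h5 : ‖𝓕⁻ (L.indicator G) x‖ₑ ≤ ENNReal.ofReal (t / 4) := by
        refine (enorm_fourierInv_le _ x).trans ?_
        have : ∀ ξ, ‖L.indicator G ξ‖ₑ = L.indicator (fun ξ => ‖G ξ‖ₑ) ξ := fun ξ =>
          enorm_indicator_eq_indicator_enorm _ _
        simp_rw [this]
        rw [lintegral_indicator hLm]
        refine (hlow _ hGe (A t) (hApos t ht)).trans (le_of_eq ?_)
        rw [← hW, hWM, ← ENNReal.ofReal_mul (by have := hApos t ht; positivity), hAeq t ht]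
      rwa [← ofReal_norm, ENNReal.ofReal_le_ofReal_iff (by positivity)] at h5
    have hsub : {x : E | t < ‖𝓕⁻ G x‖} ⊆
        {x : E | ENNReal.ofReal (t / 2) ≤ ‖𝓕⁻ (Lᶜ.indicator G) x‖ₑ} := by
      intro x hx
      have hx : t < ‖𝓕⁻ G x‖ := hx
      rw [hsplit x] at hx
      have := norm_add_le (𝓕⁻ (L.indicator G) x) (𝓕⁻ (Lᶜ.indicator G) x)
      have := hlo x
      change ENNReal.ofReal (t / 2) ≤ _
      rw [← ofReal_norm]
      exact ENNReal.ofReal_le_ofReal (by linarith)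
    have hcheb := mul_meas_ge_le_pow_eLpNorm' (volume : Measure E) (p := 2) (by norm_num)
      (by norm_num) (f := 𝓕⁻ (Lᶜ.indicator G)) (by
        rw [Real.fourierInv_eq_fourier_comp_neg]
        exact (VectorFourier.fourierIntegral_continuous Real.continuous_fourierChar
          (by exact continuous_inner) (h1.indicator hLm.compl).comp_neg).aestronglyMeasurable)
      (ENNReal.ofReal (t / 2))
    rw [eLpNorm_fourierInv_eq (h1.indicator hLm.compl) (h2.indicator hLm.compl)] at hcheb
    have hnorm : eLpNorm (Lᶜ.indicator G) 2 volume ^ (2 : ℝ≥0∞).toReal =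
        ∫⁻ ξ, {ξ : E | A t < ‖ξ‖}.indicator (fun ξ => ‖G ξ‖ₑ ^ 2) ξ := by
      rw [eLpNorm_eq_lintegral_rpow_enorm_toReal (by norm_num) (by norm_num), ← ENNReal.rpow_mul]
      norm_num
      refine lintegral_congr fun ξ => ?_
      by_cases h : A t < ‖ξ‖
      · simp [hL, Set.indicator, h]
      · simp [hL, Set.indicator, h, not_lt.1 h]
    rw [hnorm] at hcheb
    refine (measure_mono hsub).trans ?_
    have ht2 : ENNReal.ofReal (t / 2) ^ (2 : ℝ≥0∞).toReal = ENNReal.ofReal (t ^ 2 / 4) := by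
      rw [ENNReal.ofReal_rpow_of_pos (by positivity)]; norm_num; congr 1; ring
    rw [ht2] at hcheb
    calc _ = ENNReal.ofReal (4 / t ^ 2) * (ENNReal.ofReal (t ^ 2 / 4) *
          volume {x : E | ENNReal.ofReal (t / 2) ≤ ‖𝓕⁻ (Lᶜ.indicator G) x‖ₑ}) := by
          rw [← mul_assoc, ← ENNReal.ofReal_mul (by positivity)]
          rw [show 4 / t ^ 2 * (t ^ 2 / 4) = 1 by field_simp]; simp
      _ ≤ _ := by gcongr
  have hfin : ∫⁻ x, ‖𝓕⁻ G x‖ₑ ^ p ≤ ENNReal.ofReal K * W ^ p := by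
    have e1 : ∫⁻ x, ‖𝓕⁻ G x‖ₑ ^ p = ∫⁻ x, ENNReal.ofReal (‖𝓕⁻ G x‖ ^ p) := by
      refine lintegral_congr fun x => ?_
      rw [← ofReal_norm, ENNReal.ofReal_rpow_of_nonneg (norm_nonneg _) (by linarith)]
    rw [e1, lintegral_rpow_eq_lintegral_meas_lt_mul volume
      (Eventually.of_forall fun x => norm_nonneg _) hcont.norm.aemeasurable (by linarith : 0 < p)]
    have hmeasF : Measurable fun q : ℝ × E => ENNReal.ofReal (4 * q.1 ^ (p - 3)) *
        {q : ℝ × E | A q.1 < ‖q.2‖}.indicator (fun q => ‖G q.2‖ₑ ^ 2) q := by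
      have hset : MeasurableSet {q : ℝ × E | A q.1 < ‖q.2‖} := by
        refine measurableSet_lt ?_ (by fun_prop)
        simp only [A]; fun_prop
      have : Measurable fun q : ℝ × E => ‖G q.2‖ₑ ^ 2 :=
        (hGe.comp measurable_snd).pow_const 2
      exact Measurable.mul (by fun_prop) (this.indicator hset)
    calc ENNReal.ofReal p * ∫⁻ t in Set.Ioi 0, volume {x : E | t < ‖𝓕⁻ G x‖} *
          ENNReal.ofReal (t ^ (p - 1))
        ≤ ENNReal.ofReal p * ∫⁻ t in Set.Ioi 0, ∫⁻ ξ : E, ENNReal.ofReal (4 * t ^ (p - 3)) *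
          {q : ℝ × E | A q.1 < ‖q.2‖}.indicator (fun q => ‖G q.2‖ₑ ^ 2) (t, ξ) := by
          gcongr ENNReal.ofReal p * ?_
          refine setLIntegral_mono' measurableSet_Ioi fun t ht => ?_
          have ht : 0 < t := ht
          refine (mul_le_mul_left (hlevel t ht) _).trans (le_of_eq ?_)
          rw [lintegral_const_mul]
          · rw [mul_right_comm, ← ENNReal.ofReal_mul (by positivity)]
            congr 2
            rw [show p - 1 = (p - 3) + (2 : ℕ) by push_cast; ring, Real.rpow_add ht,
              Real.rpow_natCast]
            field_simp
          · exact (hGe.pow_const 2).indicator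
              (measurableSet_lt (measurable_const (a := A t)) measurable_norm)
      _ = ENNReal.ofReal p * ∫⁻ ξ : E, ∫⁻ t in Set.Ioi 0, ENNReal.ofReal (4 * t ^ (p - 3)) *
          {q : ℝ × E | A q.1 < ‖q.2‖}.indicator (fun q => ‖G q.2‖ₑ ^ 2) (t, ξ) := by
          rw [lintegral_lintegral_swap]
          exact hmeasF.aemeasurable
      _ ≤ ENNReal.ofReal p * ∫⁻ ξ : E, ‖G ξ‖ₑ ^ 2 *
          ENNReal.ofReal (4 * ((4 * c * M * ‖ξ‖ ^ ((m - 2 * s) / 2)) ^ (p - 2) / (p - 2))) := by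
          gcongr with ξ
          set B := 4 * c * M * ‖ξ‖ ^ ((m - 2 * s) / 2) with hB
          have hB0 : 0 ≤ B := by positivity
          calc _ ≤ ∫⁻ t in Set.Ioi 0, (Set.Ioc 0 B).indicator (fun t =>
                  ENNReal.ofReal (4 * t ^ (p - 3)) * ‖G ξ‖ₑ ^ 2) t := by
                refine setLIntegral_mono' measurableSet_Ioi fun t ht => ?_
                by_cases h : A t < ‖ξ‖
                · have := hAlt t ‖ξ‖ ht (norm_nonneg _) h
                  rw [Set.indicator_of_mem (show t ∈ Set.Ioc 0 B from ⟨ht, this.le⟩),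
                    Set.indicator_of_mem (show (t, ξ) ∈ {q : ℝ × E | A q.1 < ‖q.2‖} from h)]
                · rw [Set.indicator_of_notMem (show (t, ξ) ∉ {q : ℝ × E | A q.1 < ‖q.2‖} from h)]
                  simp
            _ = ∫⁻ t in Set.Ioc 0 B, ENNReal.ofReal (4 * t ^ (p - 3)) * ‖G ξ‖ₑ ^ 2 := by
                rw [lintegral_indicator measurableSet_Ioc, Measure.restrict_restrict
                  measurableSet_Ioc, Set.inter_eq_left.2 fun t ht => ht.1]
            _ = (∫⁻ t in Set.Ioc 0 B, ENNReal.ofReal (4 * t ^ (p - 3))) * ‖G ξ‖ₑ ^ 2 := by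
                rw [lintegral_mul_const]; fun_prop
            _ ≤ _ := by
                rw [mul_comm]
                gcongr
                rw [← ofReal_integral_eq_lintegral_ofReal]
                · refine ENNReal.ofReal_le_ofReal (le_of_eq ?_)
                  rw [integral_const_mul, ← intervalIntegral.integral_of_le hB0,
                    integral_rpow (Or.inl (by linarith)), Real.zero_rpow (by linarith)]
                  rw [sub_zero, show p - 3 + 1 = p - 2 by ring]
                · have := (intervalIntegral.intervalIntegrable_rpow' (a := 0) (b := B)
                    (r := p - 3) (by linarith)).const_mul 4
                  rwa [intervalIntegrable_iff_integrableOn_Ioc_of_le hB0] at this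
                · filter_upwards [ae_restrict_mem measurableSet_Ioc] with y hy
                  have := Real.rpow_nonneg hy.1.le (p - 3)
                  simp only [Pi.zero_apply]; positivity
      _ = ENNReal.ofReal p * ∫⁻ ξ : E, ENNReal.ofReal (4 * ((4 * c) ^ (p - 2) / (p - 2)) *
            M ^ (p - 2)) * (‖ξ‖ₑ ^ s * ‖G ξ‖ₑ) ^ 2 := by
          congr 1
          refine lintegral_congr fun ξ => ?_
          rw [mul_pow, mul_comm (‖G ξ‖ₑ ^ 2), ← mul_assoc]
          congr 1
          rw [Real.mul_rpow (by positivity) (by positivity), Real.mul_rpow (by positivity)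
            (by positivity), ← Real.rpow_mul (norm_nonneg _), hps, ← ofReal_norm,
            ENNReal.ofReal_rpow_of_nonneg (norm_nonneg _) hs0.le,
            ← ENNReal.ofReal_pow (by positivity),
            ← ENNReal.ofReal_mul (by positivity)]
          congr 1
          rw [← Real.rpow_natCast (‖ξ‖ ^ s), ← Real.rpow_mul (norm_nonneg _)]
          push_cast
          rw [mul_comm s 2]
          ring
      _ = ENNReal.ofReal p * (ENNReal.ofReal (4 * ((4 * c) ^ (p - 2) / (p - 2)) *
            M ^ (p - 2)) * W ^ 2) := by
          rw [lintegral_const_mul _ (by fun_prop), ← wNorm_sq]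
      _ = ENNReal.ofReal K * W ^ p := by
          rw [← mul_assoc, ← ENNReal.ofReal_mul (by positivity), hWM,
            ← ENNReal.ofReal_pow hM0.le, ← ENNReal.ofReal_mul (by positivity),
            ENNReal.ofReal_rpow_of_pos hM0, ← ENNReal.ofReal_mul hK0.le]
          congr 1
          have : M ^ p = M ^ (p - 2) * M ^ 2 := by
            rw [← Real.rpow_natCast, ← Real.rpow_add hM0]; congr 1; push_cast; ring
          rw [this, hK]; ring
  rw [eLpNorm_eq_lintegral_rpow_enorm_toReal (by simpa using (by linarith : 0 < p)) (by simp),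
    ENNReal.toReal_ofReal (by linarith)]
  calc (∫⁻ x, ‖𝓕⁻ G x‖ₑ ^ p) ^ (1 / p) ≤ (ENNReal.ofReal K * W ^ p) ^ (1 / p) := by gcongr
    _ = _ := by
      rw [ENNReal.mul_rpow_of_nonneg _ _ (by positivity), ← ENNReal.rpow_mul,
        mul_one_div_cancel (by linarith), ENNReal.rpow_one]

end

/-! ### Convolutions of nonnegative frequency functions, and truncation -/

section

variable {E : Type*} [NormedAddCommGroup E] [InnerProductSpace ℝ E] [FiniteDimensional ℝ E]
  [MeasurableSpace E] [BorelSpace E]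

/-- A nonnegative measurable function that is bounded and integrable. -/
structure BddIntegrable (A : E → ℝ≥0∞) : Prop where
  measurable : Measurable A
  bdd : ∃ M : ℝ≥0∞, M ≠ ⊤ ∧ ∀ ξ, A ξ ≤ M
  lintegral_ne_top : ∫⁻ ξ, A ξ ≠ ⊤

/-- A nonnegative extended real function as a complex-valued one. -/
def toComplexFun (A : E → ℝ≥0∞) (ξ : E) : ℂ := ((A ξ).toReal : ℂ)

namespace BddIntegrable

variable {A B : E → ℝ≥0∞}

lemma ne_top (hA : BddIntegrable A) (ξ : E) : A ξ ≠ ⊤ := by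
  obtain ⟨M, hM, h⟩ := hA.bdd
  exact ne_top_of_le_ne_top hM (h ξ)

lemma enorm_toComplexFun (hA : BddIntegrable A) (ξ : E) : ‖toComplexFun A ξ‖ₑ = A ξ := by
  rw [toComplexFun, ← ofReal_norm, Complex.norm_real, Real.norm_of_nonneg ENNReal.toReal_nonneg,
    ENNReal.ofReal_toReal (hA.ne_top ξ)]

lemma measurable_toComplexFun (hA : BddIntegrable A) : Measurable (toComplexFun A) :=
  Complex.measurable_ofReal.comp hA.measurable.ennreal_toReal

lemma integrable (hA : BddIntegrable A) : Integrable (toComplexFun A) := by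
  refine ⟨hA.measurable_toComplexFun.aestronglyMeasurable, ?_⟩
  simp only [HasFiniteIntegral, hA.enorm_toComplexFun]
  exact hA.lintegral_ne_top.lt_top

lemma memLp_two (hA : BddIntegrable A) : MemLp (toComplexFun A) 2 := by
  refine ⟨hA.measurable_toComplexFun.aestronglyMeasurable, ?_⟩
  obtain ⟨M, hM, h⟩ := hA.bdd
  rw [eLpNorm_lt_top_iff_lintegral_rpow_enorm_lt_top (by norm_num) (by norm_num)]
  simp only [hA.enorm_toComplexFun]
  calc ∫⁻ ξ, A ξ ^ (2 : ℝ≥0∞).toReal ≤ ∫⁻ ξ, M * A ξ := by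
        refine lintegral_mono fun ξ => ?_
        simp only [ENNReal.toReal_ofNat, ENNReal.rpow_ofNat, sq]
        gcongr; exact h ξ
    _ = M * ∫⁻ ξ, A ξ := lintegral_const_mul _ hA.measurable
    _ < ⊤ := ENNReal.mul_lt_top hM.lt_top hA.lintegral_ne_top.lt_top

end BddIntegrable

lemma lintegral_lconvolution {A B : E → ℝ≥0∞} (hA : Measurable A) (hB : Measurable B) :
    ∫⁻ x, (A ⋆ₗ B) x = (∫⁻ x, A x) * ∫⁻ x, B x := by
  simp only [lconvolution_def]
  rw [lintegral_lintegral_swap (by fun_prop)]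
  have : ∀ y, ∫⁻ x, A y * B (-y + x) = A y * ∫⁻ x, B x := by
    intro y
    rw [lintegral_const_mul _ (by fun_prop), lintegral_add_left_eq_self]
  simp_rw [this]
  rw [lintegral_mul_const _ hA]

lemma BddIntegrable.lconvolution {A B : E → ℝ≥0∞} (hA : BddIntegrable A) (hB : BddIntegrable B) :
    BddIntegrable (A ⋆ₗ B) := by
  refine ⟨measurable_lconvolution _ hA.measurable hB.measurable, ?_, ?_⟩
  · obtain ⟨M, hM, h⟩ := hB.bdd
    refine ⟨(∫⁻ ξ, A ξ) * M, ENNReal.mul_ne_top hA.lintegral_ne_top hM, fun ξ => ?_⟩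
    rw [lconvolution_def, ← lintegral_mul_const _ hA.measurable]
    exact lintegral_mono fun y => by gcongr; exact h _
  · rw [lintegral_lconvolution hA.measurable hB.measurable]
    exact ENNReal.mul_ne_top hA.lintegral_ne_top hB.lintegral_ne_top

open scoped Convolution in
lemma convolution_toComplexFun {A B : E → ℝ≥0∞} (hA : BddIntegrable A) (hB : BddIntegrable B) :
    (toComplexFun A ⋆[ContinuousLinearMap.mul ℂ ℂ] toComplexFun B) = toComplexFun (A ⋆ₗ B) := by
  funext x
  have h : ∀ t, (ContinuousLinearMap.mul ℂ ℂ) (toComplexFun A t) (toComplexFun B (x - t)) =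
      (((A t * B (-t + x)).toReal : ℝ) : ℂ) := by
    intro t
    simp [toComplexFun, ENNReal.toReal_mul, sub_eq_neg_add]
  rw [convolution_def]
  simp_rw [h]
  have hA' := hA.measurable
  have hB' := hB.measurable
  rw [integral_complex_ofReal, toComplexFun, lconvolution_def, integral_toReal (by fun_prop)]
  exact Eventually.of_forall fun t => ENNReal.mul_lt_top (hA.ne_top t).lt_top (hB.ne_top _).lt_top

/-- The point of the class of bounded integrable frequency functions: it is stable under
convolution, lies in L¹ ∩ L², and turns convolutions into honest pointwise products, to which Hölder
applies. -/
lemma fourierInv_toComplexFun_lconvolution {A B : E → ℝ≥0∞} (hA : BddIntegrable A)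
    (hB : BddIntegrable B) (x : E) : 𝓕⁻ (toComplexFun (A ⋆ₗ B)) x =
      𝓕⁻ (toComplexFun A) x * 𝓕⁻ (toComplexFun B) x := by
  rw [← convolution_toComplexFun hA hB, Real.fourierInv_eq_fourier_neg,
    Real.fourierInv_eq_fourier_neg, Real.fourierInv_eq_fourier_neg,
    Real.fourier_mul_convolution_eq hA.integrable hB.integrable]

lemma BddIntegrable.eLpNorm_fourierInv {A : E → ℝ≥0∞} (hA : BddIntegrable A) :
    eLpNorm (𝓕⁻ (toComplexFun A)) 2 volume = wNorm 0 A := by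
  rw [eLpNorm_fourierInv_eq hA.integrable hA.memLp_two, wNorm, ← eLpNorm_enorm]
  simp only [hA.enorm_toComplexFun, ENNReal.rpow_zero, one_mul]

lemma BddIntegrable.aestronglyMeasurable_fourierInv {A : E → ℝ≥0∞} (hA : BddIntegrable A) :
    AEStronglyMeasurable (𝓕⁻ (toComplexFun A)) volume := by
  rw [Real.fourierInv_eq_fourier_comp_neg]
  exact (VectorFourier.fourierIntegral_continuous Real.continuous_fourierChar
    (by exact continuous_inner) hA.integrable.comp_neg).aestronglyMeasurable

/-! ### Truncation -/

/-- Truncation in height and frequency. -/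
def trunc (A : E → ℝ≥0∞) (N : ℕ) (ξ : E) : ℝ≥0∞ :=
  (Metric.closedBall (0 : E) N).indicator (fun ξ => min (A ξ) N) ξ

lemma trunc_le (A : E → ℝ≥0∞) (N : ℕ) (ξ : E) : trunc A N ξ ≤ A ξ := by
  unfold trunc
  exact (Set.indicator_le_self _ _ _).trans (min_le_left _ _)

lemma trunc_bddIntegrable {A : E → ℝ≥0∞} (hA : Measurable A) (N : ℕ) :
    BddIntegrable (trunc A N) := by
  have hle : ∀ ξ, trunc A N ξ ≤ (Metric.closedBall (0 : E) N).indicator (fun _ => (N : ℝ≥0∞)) ξ :=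
    fun ξ => Set.indicator_le_indicator (min_le_right _ _)
  refine ⟨(hA.min measurable_const).indicator measurableSet_closedBall, ⟨N, by simp, fun ξ => ?_⟩, ?_⟩
  · exact (hle ξ).trans (Set.indicator_le_self _ _ _)
  · refine ne_top_of_le_ne_top ?_ (lintegral_mono hle)
    rw [lintegral_indicator_const measurableSet_closedBall]
    exact ENNReal.mul_ne_top (by simp) measure_closedBall_lt_top.ne

lemma trunc_mono (A : E → ℝ≥0∞) (ξ : E) : Monotone fun N => trunc A N ξ := by
  intro N M h
  have h' : (N : ℝ) ≤ M := by exact_mod_cast h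
  have h'' : (N : ℝ≥0∞) ≤ M := by exact_mod_cast h
  refine (Set.indicator_le_indicator_of_subset (Metric.closedBall_subset_closedBall h')
    (by simp) ξ).trans (Set.indicator_le_indicator (min_le_min le_rfl h''))

lemma iSup_trunc (A : E → ℝ≥0∞) (ξ : E) : ⨆ N, trunc A N ξ = A ξ := by
  refine le_antisymm (iSup_le fun N => trunc_le A N ξ) ?_
  obtain ⟨N0, hN0⟩ := exists_nat_ge ‖ξ‖
  refine le_of_forall_lt fun c hc => ?_
  obtain ⟨N1, hN1⟩ := ENNReal.exists_nat_gt hc.ne_top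
  refine lt_of_lt_of_le ?_ (le_iSup _ (max N0 N1))
  have hmem : ξ ∈ Metric.closedBall (0 : E) ((max N0 N1 : ℕ) : ℝ) := by
    rw [mem_closedBall_zero_iff]; refine hN0.trans ?_; exact_mod_cast le_max_left _ _
  rw [trunc, Set.indicator_of_mem hmem, lt_min_iff]
  exact ⟨hc, hN1.trans_le (by exact_mod_cast le_max_right _ _)⟩

lemma iSup_mul_iSup_of_monotone {u v : ℕ → ℝ≥0∞} (hu : Monotone u) (hv : Monotone v) :
    (⨆ N, u N) * ⨆ N, v N = ⨆ N, u N * v N := by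
  refine le_antisymm ?_ (iSup_le fun N => mul_le_mul' (le_iSup u N) (le_iSup v N))
  rw [ENNReal.iSup_mul]
  refine iSup_le fun N => ?_
  rw [ENNReal.mul_iSup]
  refine iSup_le fun M => ?_
  exact (mul_le_mul' (hu (le_max_left N M)) (hv (le_max_right N M))).trans
    (le_iSup (fun N => u N * v N) (max N M))

lemma iSup_lconvolution {A B : ℕ → E → ℝ≥0∞} (hA : ∀ N, Measurable (A N))
    (hB : ∀ N, Measurable (B N)) (hA' : ∀ ξ, Monotone fun N => A N ξ)
    (hB' : ∀ ξ, Monotone fun N => B N ξ) (x : E) :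
    ((fun ξ => ⨆ N, A N ξ) ⋆ₗ fun ξ => ⨆ N, B N ξ) x = ⨆ N, (A N ⋆ₗ B N) x := by
  simp only [lconvolution_def]
  rw [← lintegral_iSup]
  · exact lintegral_congr fun y => iSup_mul_iSup_of_monotone (hA' _) (hB' _)
  · intro N; have := hA N; have := hB N; fun_prop
  · intro N M h y; exact mul_le_mul' (hA' _ h) (hB' _ h)

lemma lconvolution_mono {A A' B B' : E → ℝ≥0∞} (hA : ∀ ξ, A ξ ≤ A' ξ) (hB : ∀ ξ, B ξ ≤ B' ξ)
    (x : E) : (A ⋆ₗ B) x ≤ (A' ⋆ₗ B') x :=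
  lintegral_mono fun _ => mul_le_mul' (hA _) (hB _)

lemma wNorm_mono {s : ℝ} {A B : E → ℝ≥0∞} (h : ∀ ξ, A ξ ≤ B ξ) : wNorm s A ≤ wNorm s B :=
  eLpNorm_mono_enorm fun ξ => by simpa using mul_le_mul_right (h ξ) _

/-- Monotone convergence. Bounds proved for truncations pass to arbitrary measurable frequency
functions, with no integrability hypothesis. -/
lemma wNorm_iSup_le {s : ℝ} {A : ℕ → E → ℝ≥0∞} (hA : ∀ N, Measurable (A N))
    (hA' : ∀ ξ, Monotone fun N => A N ξ) {c : ℝ≥0∞} (h : ∀ N, wNorm s (A N) ≤ c) :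
    wNorm s (fun ξ => ⨆ N, A N ξ) ≤ c := by
  have h2 : wNorm s (fun ξ => ⨆ N, A N ξ) ^ 2 ≤ c ^ 2 := by
    rw [wNorm_sq]
    have : ∀ ξ : E, (‖ξ‖ₑ ^ s * ⨆ N, A N ξ) ^ 2 = ⨆ N, (‖ξ‖ₑ ^ s * A N ξ) ^ 2 := by
      intro ξ
      rw [ENNReal.mul_iSup, sq, iSup_mul_iSup_of_monotone]
      · simp only [sq]
      · exact fun N M h => mul_le_mul_right (hA' ξ h) _
      · exact fun N M h => mul_le_mul_right (hA' ξ h) _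
    simp_rw [this]
    rw [lintegral_iSup]
    · refine iSup_le fun N => ?_
      rw [← wNorm_sq]
      gcongr; exact h N
    · intro N; have := hA N; fun_prop
    · intro N M h ξ; exact pow_le_pow_left' (mul_le_mul_right (hA' ξ h) _) 2
  exact (ENNReal.pow_le_pow_left_iff (by norm_num)).1 h2

end

/-! ### Product estimates by Hölder and Sobolev, and distribution of weights -/

section

variable {E : Type*} [NormedAddCommGroup E] [InnerProductSpace ℝ E] [FiniteDimensional ℝ E]
  [MeasurableSpace E] [BorelSpace E]

lemma BddIntegrable.sobolev [Nontrivial E] {s : ℝ} (hs0 : 0 ≤ s) (hs : 2 * s < finrank ℝ E) :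
    ∃ C : ℝ≥0∞, C ≠ ⊤ ∧ ∀ A : E → ℝ≥0∞, BddIntegrable A →
      eLpNorm (𝓕⁻ (toComplexFun A))
        (ENNReal.ofReal (2 * finrank ℝ E / (finrank ℝ E - 2 * s))) volume ≤ C * wNorm s A := by
  obtain ⟨C, hC, h⟩ := sobolev_embedding (E := E) hs0 hs
  refine ⟨C, hC, fun A hA => ?_⟩
  have := h _ hA.measurable_toComplexFun.stronglyMeasurable hA.integrable hA.memLp_two
  simpa only [hA.enorm_toComplexFun] using this

/-- The Sobolev exponent satisfies 1/p(s) = 1/2 − s/m, so Hölder's relation becomes linear in the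
indices. -/
lemma holderTriple_ofReal {m a b c : ℝ} (hm : 0 < m) (ha : 2 * a < m) (hb : 2 * b < m)
    (hc : 2 * c < m) (h : m / 2 + c = a + b) :
    ENNReal.HolderTriple (ENNReal.ofReal (2 * m / (m - 2 * a)))
      (ENNReal.ofReal (2 * m / (m - 2 * b))) (ENNReal.ofReal (2 * m / (m - 2 * c))) := by
  constructor
  have h1 : 0 < m - 2 * a := by linarith
  have h2 : 0 < m - 2 * b := by linarith
  have h3 : 0 < m - 2 * c := by linarith
  rw [← ENNReal.ofReal_inv_of_pos (by positivity), ← ENNReal.ofReal_inv_of_pos (by positivity),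
    ← ENNReal.ofReal_inv_of_pos (by positivity), ← ENNReal.ofReal_add (by positivity)
    (by positivity)]
  congr 1
  field_simp
  linarith

/-- The bilinear product estimate `Ḣ^a · Ḣ^b → L²` in terms of Fourier transforms. -/
theorem wNorm_lconvolution_le [Nontrivial E] {a b : ℝ} (ha0 : 0 ≤ a) (ha : 2 * a < finrank ℝ E)
    (hb0 : 0 ≤ b) (hb : 2 * b < finrank ℝ E) (hab : (finrank ℝ E : ℝ) / 2 = a + b) :
    ∃ C : ℝ≥0∞, C ≠ ⊤ ∧ ∀ A B : E → ℝ≥0∞, Measurable A → Measurable B →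
      wNorm 0 (A ⋆ₗ B) ≤ C * (wNorm a A * wNorm b B) := by
  have hm : 0 < (finrank ℝ E : ℝ) := by exact_mod_cast finrank_pos
  obtain ⟨C₁, hC₁, h₁⟩ := BddIntegrable.sobolev (E := E) ha0 ha
  obtain ⟨C₂, hC₂, h₂⟩ := BddIntegrable.sobolev (E := E) hb0 hb
  refine ⟨C₁ * C₂, ENNReal.mul_ne_top hC₁ hC₂, ?_⟩
  have key : ∀ A B : E → ℝ≥0∞, BddIntegrable A → BddIntegrable B →
      wNorm 0 (A ⋆ₗ B) ≤ C₁ * C₂ * (wNorm a A * wNorm b B) := by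
    intro A B hA hB
    have ht := holderTriple_ofReal (c := 0) hm ha hb (by linarith) (by linarith)
    rw [mul_zero, sub_zero, mul_div_cancel_right₀ _ hm.ne', ENNReal.ofReal_ofNat] at ht
    rw [← (hA.lconvolution hB).eLpNorm_fourierInv]
    have he : 𝓕⁻ (toComplexFun (A ⋆ₗ B)) = 𝓕⁻ (toComplexFun A) • 𝓕⁻ (toComplexFun B) :=
      funext fun x => fourierInv_toComplexFun_lconvolution hA hB x
    rw [he]
    refine (eLpNorm_smul_le_mul_eLpNorm hB.aestronglyMeasurable_fourierInv
      hA.aestronglyMeasurable_fourierInv (hpqr := ht)).trans ?_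
    refine (mul_le_mul' (h₁ A hA) (h₂ B hB)).trans (le_of_eq (by ring))
  intro A B hA hB
  -- Convolution of nonnegative functions commutes with increasing limits, so the general case is
  -- the supremum of the truncated ones.
  have hsup : A ⋆ₗ B = fun ξ => ⨆ N, (trunc A N ⋆ₗ trunc B N) ξ := by
    funext ξ
    rw [← iSup_lconvolution (fun N => (trunc_bddIntegrable hA N).measurable)
      (fun N => (trunc_bddIntegrable hB N).measurable) (trunc_mono A) (trunc_mono B)]
    simp only [iSup_trunc]
  rw [hsup]
  refine wNorm_iSup_le (fun N => measurable_lconvolution _ (trunc_bddIntegrable hA N).measurable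
    (trunc_bddIntegrable hB N).measurable) (fun ξ N M h => lconvolution_mono
      (fun η => trunc_mono A η h) (fun η => trunc_mono B η h) ξ) fun N => ?_
  refine (key _ _ (trunc_bddIntegrable hA N) (trunc_bddIntegrable hB N)).trans ?_
  gcongr
  · exact wNorm_mono (trunc_le A N)
  · exact wNorm_mono (trunc_le B N)

/-- The trilinear product estimate `Ḣ^a · Ḣ^b · Ḣ^c → L²` in terms of Fourier transforms. -/
theorem wNorm_lconvolution₃_le [Nontrivial E] {a b c : ℝ} (ha0 : 0 ≤ a)
    (ha : 2 * a < finrank ℝ E) (hb0 : 0 ≤ b) (hb : 2 * b < finrank ℝ E) (hc0 : 0 ≤ c)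
    (hc : 2 * c < finrank ℝ E) (habc : (finrank ℝ E : ℝ) = a + b + c) :
    ∃ C : ℝ≥0∞, C ≠ ⊤ ∧ ∀ A B D : E → ℝ≥0∞, Measurable A → Measurable B → Measurable D →
      wNorm 0 (A ⋆ₗ (B ⋆ₗ D)) ≤ C * (wNorm a A * wNorm b B * wNorm c D) := by
  have hm : 0 < (finrank ℝ E : ℝ) := by exact_mod_cast finrank_pos
  obtain ⟨C₁, hC₁, h₁⟩ := BddIntegrable.sobolev (E := E) ha0 ha
  obtain ⟨C₂, hC₂, h₂⟩ := BddIntegrable.sobolev (E := E) hb0 hb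
  obtain ⟨C₃, hC₃, h₃⟩ := BddIntegrable.sobolev (E := E) hc0 hc
  refine ⟨C₁ * C₂ * C₃, ENNReal.mul_ne_top (ENNReal.mul_ne_top hC₁ hC₂) hC₃, ?_⟩
  have key : ∀ A B D : E → ℝ≥0∞, BddIntegrable A → BddIntegrable B → BddIntegrable D →
      wNorm 0 (A ⋆ₗ (B ⋆ₗ D)) ≤ C₁ * C₂ * C₃ * (wNorm a A * wNorm b B * wNorm c D) := by
    intro A B D hA hB hD
    -- Hölder is used twice. The product of the last two factors lies in the Lebesgue space of index
    -- b + c − m/2 = m/2 − a, which pairs with index a to give L².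
    have ht' := holderTriple_ofReal (m := finrank ℝ E) (a := b) (b := c)
      (c := b + c - finrank ℝ E / 2) hm hb hc (by linarith) (by linarith)
    have ht := holderTriple_ofReal (m := finrank ℝ E) (a := a) (b := b + c - finrank ℝ E / 2)
      (c := 0) hm ha (by linarith) (by linarith) (by linarith)
    rw [mul_zero, sub_zero, mul_div_cancel_right₀ _ hm.ne', ENNReal.ofReal_ofNat] at ht
    rw [← (hA.lconvolution (hB.lconvolution hD)).eLpNorm_fourierInv]
    have he : 𝓕⁻ (toComplexFun (A ⋆ₗ (B ⋆ₗ D))) =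
        𝓕⁻ (toComplexFun A) • (𝓕⁻ (toComplexFun B) • 𝓕⁻ (toComplexFun D)) :=
      funext fun x => by
        rw [fourierInv_toComplexFun_lconvolution hA (hB.lconvolution hD),
          fourierInv_toComplexFun_lconvolution hB hD]
        rfl
    rw [he]
    refine (eLpNorm_smul_le_mul_eLpNorm (hB.aestronglyMeasurable_fourierInv.smul
      hD.aestronglyMeasurable_fourierInv) hA.aestronglyMeasurable_fourierInv (hpqr := ht)).trans ?_
    refine (mul_le_mul' (h₁ A hA) ((eLpNorm_smul_le_mul_eLpNorm hD.aestronglyMeasurable_fourierInv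
      hB.aestronglyMeasurable_fourierInv (hpqr := ht')).trans
        (mul_le_mul' (h₂ B hB) (h₃ D hD)))).trans (le_of_eq (by ring))
  intro A B D hA hB hD
  have hsup : A ⋆ₗ (B ⋆ₗ D) = fun ξ => ⨆ N, (trunc A N ⋆ₗ (trunc B N ⋆ₗ trunc D N)) ξ := by
    funext ξ
    have hBD : B ⋆ₗ D = fun ξ => ⨆ N, (trunc B N ⋆ₗ trunc D N) ξ := by
      funext ξ
      rw [← iSup_lconvolution (fun N => (trunc_bddIntegrable hB N).measurable)
        (fun N => (trunc_bddIntegrable hD N).measurable) (trunc_mono B) (trunc_mono D)]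
      simp only [iSup_trunc]
    rw [hBD, ← iSup_lconvolution (fun N => (trunc_bddIntegrable hA N).measurable)
      (fun N => measurable_lconvolution _ (trunc_bddIntegrable hB N).measurable
        (trunc_bddIntegrable hD N).measurable) (trunc_mono A)
      (fun ξ N M h => lconvolution_mono
        (fun η => trunc_mono B η h) (fun η => trunc_mono D η h) ξ)]
    simp only [iSup_trunc]
  rw [hsup]
  refine wNorm_iSup_le (fun N => measurable_lconvolution _ (trunc_bddIntegrable hA N).measurable
    (measurable_lconvolution _ (trunc_bddIntegrable hB N).measurable
    (trunc_bddIntegrable hD N).measurable)) (fun ξ N M h => lconvolution_mono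
      (fun η => trunc_mono A η h) (fun η => lconvolution_mono
      (fun η => trunc_mono B η h) (fun η => trunc_mono D η h) η) ξ) fun N => ?_
  refine (key _ _ _ (trunc_bddIntegrable hA N) (trunc_bddIntegrable hB N)
    (trunc_bddIntegrable hD N)).trans ?_
  gcongr
  · exact wNorm_mono (trunc_le A N)
  · exact wNorm_mono (trunc_le B N)
  · exact wNorm_mono (trunc_le D N)

/-- Multiplication by the weight `|·|^k`. -/
def pw (k : ℝ) (A : E → ℝ≥0∞) (ξ : E) : ℝ≥0∞ := ‖ξ‖ₑ ^ k * A ξ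

lemma measurable_pw (k : ℝ) {A : E → ℝ≥0∞} (hA : Measurable A) : Measurable (pw k A) := by
  unfold pw; fun_prop

lemma wNorm_pw {s k : ℝ} (hs : 0 ≤ s) (hk : 0 ≤ k) (A : E → ℝ≥0∞) :
    wNorm s (pw k A) = wNorm (s + k) A := by
  simp only [wNorm, pw, ENNReal.rpow_add_of_nonneg _ _ hs hk, mul_assoc]

lemma enorm_add_rpow_le {k : ℝ} (hk : 0 ≤ k) (x y : E) :
    ‖x + y‖ₑ ^ k ≤ 2 ^ k * (‖x‖ₑ ^ k + ‖y‖ₑ ^ k) := by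
  have h : ‖x + y‖ₑ ≤ 2 * max ‖x‖ₑ ‖y‖ₑ := by
    rw [two_mul]
    exact (enorm_add_le x y).trans (add_le_add (le_max_left _ _) (le_max_right _ _))
  calc ‖x + y‖ₑ ^ k ≤ (2 * max ‖x‖ₑ ‖y‖ₑ) ^ k := by gcongr
    _ = 2 ^ k * (max ‖x‖ₑ ‖y‖ₑ) ^ k := ENNReal.mul_rpow_of_nonneg _ _ hk
    _ ≤ _ := by
      gcongr
      rcases le_total ‖x‖ₑ ‖y‖ₑ with h | h
      · rw [max_eq_right h]; exact le_add_self
      · rw [max_eq_left h]; exact le_self_add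

/-- A fractional Leibniz rule that costs nothing: the frequency functions are nonnegative, so the
pointwise inequality |ξ|^k ≤ 2^k(|η|^k + |ξ−η|^k) can be integrated directly. -/
lemma pw_lconvolution_le {k : ℝ} (hk : 0 ≤ k) {A B : E → ℝ≥0∞} (hA : Measurable A)
    (hB : Measurable B) (ξ : E) :
    pw k (A ⋆ₗ B) ξ ≤ 2 ^ k * ((pw k A ⋆ₗ B) ξ + (A ⋆ₗ pw k B) ξ) := by
  have hA' := measurable_pw k hA
  have hB' := measurable_pw k hB
  simp only [lconvolution_def]
  rw [pw, lconvolution_def, ← lintegral_add_left (by fun_prop), ← lintegral_const_mul _ (by fun_prop),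
    ← lintegral_const_mul _ (by fun_prop)]
  refine lintegral_mono fun η => ?_
  have := enorm_add_rpow_le hk η (-η + ξ)
  rw [add_neg_cancel_left] at this
  calc _ ≤ 2 ^ k * (‖η‖ₑ ^ k + ‖-η + ξ‖ₑ ^ k) * (A η * B (-η + ξ)) := by gcongr
    _ = _ := by simp only [pw]; ring

lemma wNorm_add_le {s : ℝ} {A B : E → ℝ≥0∞} (hA : Measurable A) (hB : Measurable B) :
    wNorm s (fun ξ => A ξ + B ξ) ≤ wNorm s A + wNorm s B := by
  simp only [wNorm, mul_add]
  exact eLpNorm_add_le (Measurable.aestronglyMeasurable (by fun_prop))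
    (Measurable.aestronglyMeasurable (by fun_prop)) (by norm_num)

lemma wNorm_const_mul {s : ℝ} {A : E → ℝ≥0∞} (c : ℝ≥0∞) (hA : Measurable A) :
    wNorm s (fun ξ => c * A ξ) = c * wNorm s A := by
  have : wNorm s (fun ξ => c * A ξ) ^ 2 = (c * wNorm s A) ^ 2 := by
    rw [mul_pow, wNorm_sq, wNorm_sq, ← lintegral_const_mul _ (by fun_prop)]
    exact lintegral_congr fun ξ => by ring
  exact (ENNReal.pow_right_strictMono two_ne_zero).injective this

lemma wNorm_lconvolution_split {k : ℝ} (hk : 0 ≤ k) {A B : E → ℝ≥0∞} (hA : Measurable A)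
    (hB : Measurable B) :
    wNorm k (A ⋆ₗ B) ≤ 2 ^ k * (wNorm 0 (pw k A ⋆ₗ B) + wNorm 0 (A ⋆ₗ pw k B)) := by
  have hA' := measurable_pw k hA
  have hB' := measurable_pw k hB
  have h1 := measurable_lconvolution volume hA' hB
  have h2 := measurable_lconvolution volume hA hB'
  calc wNorm k (A ⋆ₗ B) = wNorm 0 (pw k (A ⋆ₗ B)) := by rw [wNorm_pw le_rfl hk, zero_add]
    _ ≤ wNorm 0 (fun ξ => 2 ^ k * ((pw k A ⋆ₗ B) ξ + (A ⋆ₗ pw k B) ξ)) :=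
        wNorm_mono fun ξ => pw_lconvolution_le hk hA hB ξ
    _ = 2 ^ k * wNorm 0 (fun ξ => (pw k A ⋆ₗ B) ξ + (A ⋆ₗ pw k B) ξ) :=
        wNorm_const_mul _ (h1.add h2)
    _ ≤ _ := by gcongr; exact wNorm_add_le h1 h2

lemma wNorm_lconvolution₃_split {k : ℝ} (hk : 0 ≤ k) {A B D : E → ℝ≥0∞} (hA : Measurable A)
    (hB : Measurable B) (hD : Measurable D) :
    wNorm k (A ⋆ₗ (B ⋆ₗ D)) ≤ 2 ^ k * (wNorm 0 (pw k A ⋆ₗ (B ⋆ₗ D)) +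
      2 ^ k * (wNorm 0 (A ⋆ₗ (pw k B ⋆ₗ D)) + wNorm 0 (A ⋆ₗ (B ⋆ₗ pw k D)))) := by
  have hA' := measurable_pw k hA
  have hB' := measurable_pw k hB
  have hD' := measurable_pw k hD
  have h1 := measurable_lconvolution volume hB' hD
  have h2 := measurable_lconvolution volume hB hD'
  have hBD := measurable_lconvolution volume hB hD
  refine (wNorm_lconvolution_split hk hA hBD).trans ?_
  gcongr
  calc wNorm 0 (A ⋆ₗ pw k (B ⋆ₗ D))
      ≤ wNorm 0 (fun ξ => 2 ^ k * ((A ⋆ₗ (pw k B ⋆ₗ D)) ξ + (A ⋆ₗ (B ⋆ₗ pw k D)) ξ)) := by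
        refine wNorm_mono fun ξ => ?_
        simp only [lconvolution_def (f := A)]
        rw [← lintegral_add_left (by fun_prop), ← lintegral_const_mul _ (by fun_prop)]
        refine lintegral_mono fun η => ?_
        calc _ ≤ A η * (2 ^ k * ((pw k B ⋆ₗ D) (-η + ξ) + (B ⋆ₗ pw k D) (-η + ξ))) := by
              gcongr; exact pw_lconvolution_le hk hB hD _
          _ = _ := by ring
    _ = 2 ^ k * wNorm 0 (fun ξ => (A ⋆ₗ (pw k B ⋆ₗ D)) ξ + (A ⋆ₗ (B ⋆ₗ pw k D)) ξ) :=
        wNorm_const_mul _ ((measurable_lconvolution volume hA h1).add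
          (measurable_lconvolution volume hA h2))
    _ ≤ _ := by
        gcongr
        exact wNorm_add_le (measurable_lconvolution volume hA h1)
          (measurable_lconvolution volume hA h2)

end

/-! ### Fourier transforms of products and of radial functions -/

section
variable {E : Type*} [NormedAddCommGroup E] [InnerProductSpace ℝ E] [FiniteDimensional ℝ E]
  [MeasurableSpace E] [BorelSpace E]

/-- The Fourier transform of a product is dominated by the convolution of Fourier transforms. -/
theorem enorm_fourier_mul_le {K g : E → ℂ} (hK : Integrable K) (hg : Integrable g) (ξ : E) :
    ‖𝓕 (fun x => 𝓕⁻ K x * g x) ξ‖ₑ ≤ ((fun η => ‖K η‖ₑ) ⋆ₗ fun η => ‖𝓕 g η‖ₑ) ξ := by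
  -- With g modulated by the character at ξ, the multiplication formula rewrites the transform as ∫
  -- K(−x) ĝ(x+ξ) dx. Only K and g need be integrable, not ĝ.
  let h : E → ℂ := fun x => Real.fourierChar (-inner ℝ x ξ) • g x
  have hh : Integrable h := (Real.fourierIntegral_convergent_iff ξ).2 hg
  have hflip := VectorFourier.integral_fourierIntegral_smul_eq_flip (L := innerₗ E)
      (μ := volume) (ν := volume) (f := fun x => K (-x)) (g := h)
      Real.continuous_fourierChar (by exact continuous_inner) hK.comp_neg hh
  simp only [flip_innerₗ] at hflip
  have e1 : 𝓕 (fun x => 𝓕⁻ K x * g x) ξ = ∫ x, K (-x) • 𝓕 g (x + ξ) := by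
    refine Eq.trans ?_ (hflip.trans ?_)
    · rw [Real.fourier_eq]
      refine integral_congr_ae (Eventually.of_forall fun x => ?_)
      simp only [Real.fourierInv_eq_fourier_comp_neg, h, smul_eq_mul, Circle.smul_def]
      rw [mul_left_comm]
      rfl
    · refine integral_congr_ae (Eventually.of_forall fun x => ?_)
      simp only [h]
      congr 1
      change ∫ v, Real.fourierChar (-inner ℝ v x) • _ = _
      rw [Real.fourier_eq]
      refine integral_congr_ae (Eventually.of_forall fun v => ?_)
      simp only [smul_smul, ← AddChar.map_add_eq_mul, inner_add_right]
      congr 2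
      ring
  rw [e1, ← integral_neg_eq_self]
  refine (enorm_integral_le_lintegral_enorm _).trans (le_of_eq ?_)
  rw [lconvolution_def]
  refine lintegral_congr fun η => ?_
  simp [enorm_mul]

/-- The reflection in the hyperplane orthogonal to x − y does it. -/
lemma exists_linearIsometryEquiv_of_norm_eq {x y : E} (h : ‖x‖ = ‖y‖) :
    ∃ A : E ≃ₗᵢ[ℝ] E, A x = y := ⟨_, Submodule.reflection_sub h⟩

/-- The Fourier transform of a radial function is radial. -/
lemma fourier_radial {u : E → ℂ} (hu : ∀ x y, ‖x‖ = ‖y‖ → u x = u y) {ξ η : E} (h : ‖ξ‖ = ‖η‖) :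
    𝓕 u ξ = 𝓕 u η := by
  obtain ⟨A, rfl⟩ := exists_linearIsometryEquiv_of_norm_eq h
  rw [← Real.fourier_comp_linearIsometry]
  have : u ∘ A = u := funext fun x => hu _ _ (by simp)
  rw [this]

end

/-- The Schwartz function underlying a test function. -/
def testSchwartz {n : ℕ} (u : RadialTest n) : SchwartzMap (Rn n) ℂ :=
  u.2.2.1.toSchwartzMap u.2.1

lemma coe_testSchwartz {n : ℕ} (u : RadialTest n) : (testSchwartz u : Rn n → ℂ) = u.1 := rfl

lemma continuous_fourier_test {n : ℕ} (u : RadialTest n) : Continuous (𝓕 u.1) := by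
  rw [← coe_testSchwartz, ← SchwartzMap.fourier_coe]; exact SchwartzMap.continuous _

lemma integrable_test {n : ℕ} (u : RadialTest n) : Integrable u.1 :=
  u.2.1.continuous.integrable_of_hasCompactSupport u.2.2.1

/-! ### From radial functions on ℝ^{d+2} to vector fields on ℝ^d -/

section DimensionShift

variable {d : ℕ}

lemma exists_splitting (d : ℕ) :
    Nonempty (WithLp 2 (Rn d × Rn 2) ≃ₗᵢ[ℝ] Rn (d + 2)) := by
  have : finrank ℝ (WithLp 2 (Rn d × Rn 2)) = d + 2 := by
    rw [(WithLp.linearEquiv 2 ℝ (Rn d × Rn 2)).finrank_eq]; simp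
  exact ⟨(stdOrthonormalBasis ℝ _).reindex (finCongr this) |>.repr⟩

lemma exists_linearIsometry (d : ℕ) : Nonempty (Rn d →ₗᵢ[ℝ] Rn (d + 2)) := by
  obtain ⟨L⟩ := exists_splitting d
  refine ⟨L.toLinearIsometry.comp ⟨(WithLp.linearEquiv 2 ℝ (Rn d × Rn 2)).symm.toLinearMap ∘ₗ
    LinearMap.inl ℝ _ _, fun x => ?_⟩⟩
  simp

/-- The integral over two transversal directions of a radial test function, and its
derivative. -/
lemma exists_transversal_integral (u : RadialTest (d + 2))
    (L : WithLp 2 (Rn d × Rn 2) ≃ₗᵢ[ℝ] Rn (d + 2)) (ι : Rn d →ₗᵢ[ℝ] Rn (d + 2)) :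
    ∃ T : Rn d → ℂ, (∀ y, T y = ∫ z : Rn 2, u.1 (L (WithLp.toLp 2 (y, z)))) ∧
      Continuous T ∧ HasCompactSupport T ∧
      ∀ y, HasFDerivAt T ((innerSL ℝ y).smulRight (-(2 * Real.pi) * u.1 (ι y))) y := by
  obtain ⟨u, hu, huc, hur⟩ := u
  simp only
  set e : Rn (d + 2) := EuclideanSpace.single 0 1 with he
  have hen : ‖e‖ = 1 := by simp [he]
  let g : ℝ → ℂ := fun q => u (√q • e)
  have hg : Continuous g := hu.continuous.comp (by fun_prop)
  have hgu : ∀ x : Rn (d + 2), u x = g (‖x‖ ^ 2) := by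
    intro x
    refine hur _ _ ?_
    rw [Real.sqrt_sq (norm_nonneg _), norm_smul, hen]; simp
  obtain ⟨R, hR0, hR⟩ : ∃ R : ℝ, 0 < R ∧ ∀ x, R ≤ ‖x‖ → u x = 0 := by
    obtain ⟨R, hR0, hR⟩ := huc.exists_pos_le_norm
    exact ⟨R, hR0, hR⟩
  set M := R ^ 2 with hM
  have hgM : ∀ q, M ≤ q → g q = 0 := by
    intro q hq
    refine hR _ ?_
    rw [norm_smul, hen, mul_one, Real.norm_of_nonneg (Real.sqrt_nonneg _)]
    exact Real.le_sqrt_of_sq_le hq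
  -- In the variable q = |x|², polar coordinates in the two transversal directions turn the integral
  -- into π∫ g(q) dq over q > |y|², which is −πG(|y|²). Exactly two extra dimensions make r dr a
  -- multiple of dq, so differentiating in y returns u itself times −2πy.
  let G : ℝ → ℂ := fun q => ∫ t in M..q, g t
  have hG : ∀ q, HasDerivAt G (g q) q := fun q =>
    intervalIntegral.integral_hasDerivAt_right (hg.intervalIntegrable _ _)
      (hg.stronglyMeasurableAtFilter _ _) hg.continuousAt
  have hGM : ∀ q, M ≤ q → G q = 0 := by
    intro q hq
    have : Set.EqOn g 0 (Set.uIcc M q) := by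
      intro t ht
      rw [Set.uIcc_of_le hq] at ht
      exact hgM t ht.1
    simp only [G]
    rw [intervalIntegral.integral_congr this]; simp
  have hGc : Continuous G := continuous_iff_continuousAt.2 fun q => (hG q).continuousAt
  refine ⟨fun y => -(Real.pi : ℂ) * G (‖y‖ ^ 2), fun y => ?_, by fun_prop, ?_, fun y => ?_⟩
  · have h1 : ∀ z : Rn 2, u (L (WithLp.toLp 2 (y, z))) = (fun r => g (‖y‖ ^ 2 + r ^ 2)) ‖z‖ := by
      intro z
      rw [hgu, L.norm_map, WithLp.prod_norm_sq_eq_of_L2]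
      rfl
    simp_rw [h1]
    rw [integral_fun_norm_addHaar volume (fun r => g (‖y‖ ^ 2 + r ^ 2))]
    have h2 : ∫ r in Set.Ioi (0 : ℝ), r ^ (finrank ℝ (Rn 2) - 1) • g (‖y‖ ^ 2 + r ^ 2) =
        0 - (1 / 2 : ℂ) * G (‖y‖ ^ 2) := by
      have hder : ∀ r : ℝ, HasDerivAt (fun r => (1 / 2 : ℂ) * G (‖y‖ ^ 2 + r ^ 2))
          (r • g (‖y‖ ^ 2 + r ^ 2)) r := by
        intro r
        have := ((hG (‖y‖ ^ 2 + r ^ 2)).scomp r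
          (((hasDerivAt_id r).pow 2).const_add (‖y‖ ^ 2))).const_mul (1 / 2 : ℂ)
        refine this.congr_deriv ?_
        simp; ring
      have hlim : Tendsto (fun r : ℝ => (1 / 2 : ℂ) * G (‖y‖ ^ 2 + r ^ 2)) atTop (𝓝 0) := by
        refine tendsto_const_nhds.congr' ?_
        filter_upwards [eventually_ge_atTop R] with r hr
        rw [hGM]; simp
        have : R ^ 2 ≤ r ^ 2 := by gcongr
        nlinarith [sq_nonneg ‖y‖]
      have hint : IntegrableOn (fun r : ℝ => r • g (‖y‖ ^ 2 + r ^ 2)) (Set.Ioi 0) := by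
        refine (Continuous.integrable_of_hasCompactSupport (by fun_prop) ?_).integrableOn
        refine HasCompactSupport.intro (isCompact_Icc (a := -R) (b := R)) fun r hr => ?_
        rw [hgM, smul_zero]
        have : R ^ 2 ≤ r ^ 2 := by
          rw [sq_le_sq, abs_of_pos hR0]
          by_contra h
          push Not at h
          exact hr ⟨(abs_lt.1 h).1.le, (abs_lt.1 h).2.le⟩
        nlinarith [sq_nonneg ‖y‖]
      have := integral_Ioi_of_hasDerivAt_of_tendsto (a := 0) (by
        exact (hder 0).continuousAt.continuousWithinAt) (fun r _ => hder r) hint hlim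
      simpa using this
    rw [h2]
    have hvol : (volume : Measure (Rn 2)).real (Metric.ball 0 1) = Real.pi := by
      rw [Measure.real, EuclideanSpace.volume_ball_fin_two]
      simp [Real.pi_pos.le]
    rw [hvol]
    simp
    ring
  · refine HasCompactSupport.intro (isCompact_closedBall (0 : Rn d) R) fun y hy => ?_
    rw [hGM, mul_zero]
    have : R < ‖y‖ := by simpa using hy
    exact pow_le_pow_left₀ hR0.le this.le 2
  · have h1 : HasFDerivAt (fun y : Rn d => ‖y‖ ^ 2) (2 • innerSL ℝ y) y :=
      (hasStrictFDerivAt_norm_sq y).hasFDerivAt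
    have h2 := ((hG (‖y‖ ^ 2)).hasFDerivAt.comp y h1).const_mul (-(Real.pi : ℂ))
    refine h2.congr_fderiv ?_
    ext v
    have : u (ι y) = g (‖y‖ ^ 2) := by rw [hgu, ι.norm_map]
    simp [this]
    ring

/-- Passing from `ℝ^{d+2}` to `ℝ^d` in the Fourier transform of radial functions. -/
theorem fourier_inner_mul_comp (ι : Rn d →ₗᵢ[ℝ] Rn (d + 2)) (u : RadialTest (d + 2)) (m ξ : Rn d) :
    𝓕 (fun x : Rn d => ((inner ℝ x m : ℝ) : ℂ) * u.1 (ι x)) ξ =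
      -Complex.I * ((inner ℝ ξ m : ℝ) : ℂ) * 𝓕 u.1 (ι ξ) := by
  obtain ⟨L⟩ := exists_splitting d
  obtain ⟨T, hT, hTc, hTs, hTd⟩ := exists_transversal_integral u L ι
  have hu := u.2.1.continuous
  -- the slice of the Fourier transform
  have hslice : 𝓕 u.1 (ι ξ) = 𝓕 T ξ := by
    rw [fourier_radial u.2.2.2 (η := L (WithLp.toLp 2 (ξ, 0)))
      (by simp)]
    rw [Real.fourier_eq, Real.fourier_eq, ← L.measurePreserving.integral_comp
      L.toHomeomorph.measurableEmbedding, ← (WithLp.volume_preserving_toLp (Rn d) (Rn 2)).integral_comp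
      (MeasurableEquiv.toLp 2 _).measurableEmbedding]
    have hint : Integrable (fun p : Rn d × Rn 2 => Real.fourierChar
        (-inner ℝ (L (WithLp.toLp 2 p)) (L (WithLp.toLp 2 (ξ, 0)))) • u.1 (L (WithLp.toLp 2 p)))
        (volume.prod volume) := by
      have h1 := (Real.fourierIntegral_convergent_iff (L (WithLp.toLp 2 (ξ, 0)))).2 (integrable_test u)
      have h2 := (L.measurePreserving.integrable_comp_emb
        L.toHomeomorph.measurableEmbedding).2 h1
      exact ((WithLp.volume_preserving_toLp (Rn d) (Rn 2)).integrable_comp_emb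
        (MeasurableEquiv.toLp 2 _).measurableEmbedding).2 h2
    refine (integral_prod _ hint).trans ?_
    refine integral_congr_ae (Eventually.of_forall fun y => ?_)
    simp only [hT, L.inner_map_map, WithLp.prod_inner_apply, inner_zero_right, add_zero]
    simp only [Circle.smul_def]
    exact integral_smul _ _
  have hdiff : Differentiable ℝ T := fun y => (hTd y).differentiableAt
  have hfd : fderiv ℝ T = fun y => (innerSL ℝ y).smulRight (-(2 * Real.pi) * u.1 (ι y)) :=
    funext fun y => (hTd y).fderiv
  have hfdi : Integrable (fderiv ℝ T) := by
    refine Continuous.integrable_of_hasCompactSupport ?_ (hTs.fderiv (𝕜 := ℝ))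
    rw [hfd]
    have : Continuous fun y => u.1 (ι y) := hu.comp ι.continuous
    fun_prop
  have hTi : Integrable T := hTc.integrable_of_hasCompactSupport hTs
  -- The gradient of T is −2πyu, so transforming it both ways relates the transform of yu to ξ times
  -- the transform of T, that is, to the slice of û.
  have key := congrArg (fun F => F ξ m) (Real.fourier_fderiv hTi hdiff hfdi)
  rw [Real.fourier_continuousLinearMap_apply hfdi] at key
  have e1 : (fun x => fderiv ℝ T x m) =
      fun x => (-(2 * Real.pi) : ℂ) • (((inner ℝ x m : ℝ) : ℂ) * u.1 (ι x)) := by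
    funext x
    rw [hfd]
    simp
    ring
  rw [e1] at key
  have e2 : 𝓕 (fun x => (-(2 * Real.pi) : ℂ) • (((inner ℝ x m : ℝ) : ℂ) * u.1 (ι x))) ξ =
      (-(2 * Real.pi) : ℂ) * 𝓕 (fun x => ((inner ℝ x m : ℝ) : ℂ) * u.1 (ι x)) ξ := by
    rw [Real.fourier_eq, Real.fourier_eq, ← integral_const_mul]
    refine integral_congr_ae (Eventually.of_forall fun y => ?_)
    simp only [Circle.smul_def, smul_eq_mul]; ring
  rw [e2, VectorFourier.fourierSMulRight_apply] at key
  have hpi : (2 * Real.pi : ℂ) ≠ 0 := by simp [Real.pi_ne_zero]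
  rw [hslice]
  refine mul_left_cancel₀ (neg_ne_zero.2 hpi) (key.trans ?_)
  have hin : (-innerSL ℝ) ξ m = -inner ℝ ξ m := rfl
  rw [hin, Complex.real_smul, smul_eq_mul]
  push_cast
  ring

end DimensionShift

/-! ### Fourier majorants on ℝ^d -/

section

variable {d : ℕ}

/-- The Fourier transform of `x ↦ x u(|x|)` on `ℝ^d`, in absolute value. -/
def shiftMaj (ι : Rn d →ₗᵢ[ℝ] Rn (d + 2)) (u : Rn (d + 2) → ℂ) (ξ : Rn d) : ℝ≥0∞ :=
  ‖ξ‖ₑ * ‖𝓕 u (ι ξ)‖ₑ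

lemma measurable_shiftMaj (ι : Rn d →ₗᵢ[ℝ] Rn (d + 2)) (u : RadialTest (d + 2)) :
    Measurable (shiftMaj ι u.1) := by
  have := ((continuous_fourier_test u).comp ι.continuous).measurable
  unfold shiftMaj
  exact measurable_enorm.mul this.enorm

lemma measurable_enorm_fourier {n : ℕ} (u : RadialTest n) :
    Measurable fun ξ => ‖𝓕 u.1 ξ‖ₑ := (continuous_fourier_test u).measurable.enorm

/-- Passing from dimension n to m = n − 2t loses r^{2t} in the volume element, and the extra weight
|ξ|^t restores it. The radial integral depends only on n, so t = 0 and t = 1 can be compared. -/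
lemma wNorm_sq_fourier_radial {m n : ℕ} (hm : 0 < m) (hn : 0 < n) {s t : ℝ}
    (ht : 0 ≤ t) (hs : 0 ≤ s) (u : RadialTest n) (ι : Rn m → Rn n) (hι : ∀ x, ‖ι x‖ = ‖x‖)
    (hi : (m : ℝ) + 2 * t = n) :
    wNorm s (fun ξ : Rn m => ‖ξ‖ₑ ^ t * ‖𝓕 u.1 (ι ξ)‖ₑ) ^ 2 =
      m * volume (Metric.ball (0 : Rn m) 1) * ∫⁻ r in Set.Ioi (0 : ℝ),
        ENNReal.ofReal (r ^ (2 * s + n - 1)) *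
          ‖𝓕 u.1 (r • EuclideanSpace.single (⟨0, hn⟩ : Fin n) (1 : ℝ))‖ₑ ^ 2 := by
  have : Nonempty (Fin m) := ⟨⟨0, hm⟩⟩
  have hcont := continuous_fourier_test u
  set e : Rn n := EuclideanSpace.single (⟨0, hn⟩ : Fin n) (1 : ℝ) with he
  have hen : ‖e‖ = 1 := by simp [he]
  have h1 : ∀ ξ : Rn m, (‖ξ‖ₑ ^ s * (‖ξ‖ₑ ^ t * ‖𝓕 u.1 (ι ξ)‖ₑ)) ^ 2 =
      (fun r : ℝ => (ENNReal.ofReal r ^ (s + t) * ‖𝓕 u.1 (r • e)‖ₑ) ^ 2) ‖ξ‖ := by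
    intro ξ
    rw [← mul_assoc, ← ENNReal.rpow_add_of_nonneg _ _ hs ht]
    simp only [ofReal_norm]
    rw [fourier_radial u.2.2.2 (ξ := ι ξ) (η := ‖ξ‖ • e)]
    rw [hι, norm_smul, hen]; simp
  rw [wNorm_sq]
  simp_rw [h1]
  have hmeas : Measurable fun r : ℝ => ‖𝓕 u.1 (r • e)‖ₑ := by
    have : Continuous fun r : ℝ => 𝓕 u.1 (r • e) := hcont.comp (by fun_prop)
    exact this.measurable.enorm
  rw [lintegral_fun_norm (f := fun r : ℝ => (ENNReal.ofReal r ^ (s + t) * ‖𝓕 u.1 (r • e)‖ₑ) ^ 2)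
    (by fun_prop)]
  have hfr : finrank ℝ (Rn m) = m := by simp
  rw [hfr]
  congr 1
  refine setLIntegral_congr_fun measurableSet_Ioi fun r hr => ?_
  have hr : 0 < r := hr
  rw [mul_pow, ← mul_assoc]
  congr 1
  rw [ENNReal.ofReal_rpow_of_pos hr, ← ENNReal.ofReal_pow (by positivity),
    ← ENNReal.ofReal_mul (by positivity), ← Real.rpow_natCast, ← Real.rpow_natCast,
    ← Real.rpow_mul hr.le, ← Real.rpow_add hr]
  congr 2
  rw [Nat.cast_sub hm]
  push_cast
  linarith

/-- For radial functions the homogeneous norms on `ℝ^{d+2}` are norms of the majorant on `ℝ^d`. -/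
theorem exists_wNorm_fourier_eq (hd : 0 < d) (ι : Rn d →ₗᵢ[ℝ] Rn (d + 2)) :
    ∃ κ : ℝ≥0∞, κ ≠ 0 ∧ κ ≠ ⊤ ∧ ∀ (s : ℝ), 0 ≤ s → ∀ u : RadialTest (d + 2),
      wNorm s (fun ξ => ‖𝓕 u.1 ξ‖ₑ) = κ * wNorm s (shiftMaj ι u.1) := by
  set c₁ : ℝ≥0∞ := ((d + 2 : ℕ) : ℝ≥0∞) * volume (Metric.ball (0 : Rn (d + 2)) 1) with hc₁
  set c₂ : ℝ≥0∞ := (d : ℝ≥0∞) * volume (Metric.ball (0 : Rn d) 1) with hc₂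
  have h1 : c₁ ≠ 0 := mul_ne_zero (by simp) (Metric.measure_ball_pos _ _ one_pos).ne'
  have h1' : c₁ ≠ ⊤ := ENNReal.mul_ne_top (by simp) measure_ball_lt_top.ne
  have h2 : c₂ ≠ 0 := mul_ne_zero (by simpa using hd.ne') (Metric.measure_ball_pos _ _ one_pos).ne'
  have h2' : c₂ ≠ ⊤ := ENNReal.mul_ne_top (by simp) measure_ball_lt_top.ne
  have h3 : c₁ / c₂ ≠ 0 := by simp [h1, h2']
  have h3' : c₁ / c₂ ≠ ⊤ := ENNReal.div_ne_top h1' h2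
  -- The square root of the ratio of the two sphere areas; this is why the constant does not depend
  -- on s.
  refine ⟨(c₁ / c₂) ^ (1 / 2 : ℝ), ?_, ?_, fun s hs u => ?_⟩
  · simp [ENNReal.rpow_eq_zero_iff, h3, h3']
  · exact ENNReal.rpow_ne_top_of_nonneg (by norm_num) h3'
  refine (ENNReal.pow_right_strictMono two_ne_zero).injective ?_
  have e1 := wNorm_sq_fourier_radial (m := d + 2) (n := d + 2) (by omega) (by omega) le_rfl hs u
    id (fun _ => rfl) (by simp)
  have e2 := wNorm_sq_fourier_radial (m := d) (n := d + 2) hd (by omega) zero_le_one hs u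
    ι ι.norm_map (by push_cast; ring)
  simp only [ENNReal.rpow_zero, one_mul, id] at e1
  simp only [ENNReal.rpow_one] at e2
  have hsq : ((c₁ / c₂) ^ (1 / 2 : ℝ)) ^ 2 = c₁ / c₂ := by
    rw [← ENNReal.rpow_natCast, ← ENNReal.rpow_mul]; norm_num
  rw [mul_pow, hsq, e1]
  have e2' : wNorm s (shiftMaj ι u.1) ^ 2 = _ := e2
  rw [e2', ← hc₁, ← hc₂, ← mul_assoc, ENNReal.div_mul_cancel h2 h2']

/-- `H` dominates the Fourier transforms of `x ↦ x_i a(ι x)` on `ℝ^d`. -/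
def FourierMajorant (ι : Rn d →ₗᵢ[ℝ] Rn (d + 2)) (a : Rn (d + 2) → ℂ) (H : Rn d → ℝ≥0∞) : Prop :=
  ∀ i : Fin d, ∃ K : Rn d → ℂ, Integrable K ∧ (∀ x, 𝓕⁻ K x = (x i : ℂ) * a (ι x)) ∧
    ∀ ξ, ‖K ξ‖ₑ ≤ H ξ

lemma inner_single_right (x : Rn d) (i : Fin d) : inner ℝ x (EuclideanSpace.single i (1 : ℝ)) = x i := by
  simp [EuclideanSpace.inner_single_right]

lemma fourier_coord_mul_comp (ι : Rn d →ₗᵢ[ℝ] Rn (d + 2)) (u : RadialTest (d + 2)) (i : Fin d)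
    (ξ : Rn d) :
    𝓕 (fun x : Rn d => (x i : ℂ) * u.1 (ι x)) ξ = -Complex.I * (ξ i : ℂ) * 𝓕 u.1 (ι ξ) := by
  have := fourier_inner_mul_comp ι u (EuclideanSpace.single i (1 : ℝ)) ξ
  simpa only [inner_single_right] using this

lemma enorm_fourier_coord_mul_comp (ι : Rn d →ₗᵢ[ℝ] Rn (d + 2)) (u : RadialTest (d + 2))
    (i : Fin d) (ξ : Rn d) :
    ‖𝓕 (fun x : Rn d => (x i : ℂ) * u.1 (ι x)) ξ‖ₑ = ‖ξ i‖ₑ * ‖𝓕 u.1 (ι ξ)‖ₑ := by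
  rw [fourier_coord_mul_comp, enorm_mul, enorm_mul]
  simp [← ofReal_norm]

lemma enorm_coord_le (ξ : Rn d) (i : Fin d) : ‖ξ i‖ₑ ≤ ‖ξ‖ₑ := by
  rw [← ofReal_norm, ← ofReal_norm]
  exact ENNReal.ofReal_le_ofReal (PiLp.norm_apply_le ξ i)

lemma hasCompactSupport_coord_mul_comp (ι : Rn d →ₗᵢ[ℝ] Rn (d + 2)) (u : RadialTest (d + 2))
    (i : Fin d) : HasCompactSupport fun x : Rn d => (x i : ℂ) * u.1 (ι x) :=
  HasCompactSupport.mul_left (u.2.2.1.comp_isClosedEmbedding ι.isometry.isClosedEmbedding)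

lemma contDiff_coord_mul_comp (ι : Rn d →ₗᵢ[ℝ] Rn (d + 2)) (u : RadialTest (d + 2))
    (i : Fin d) : ContDiff ℝ ∞ fun x : Rn d => (x i : ℂ) * u.1 (ι x) := by
  have h1 : ContDiff ℝ ∞ fun x : Rn d => (x i : ℂ) :=
    Complex.ofRealCLM.contDiff.comp (EuclideanSpace.proj (𝕜 := ℝ) i).contDiff
  exact h1.mul (u.2.1.comp ι.toContinuousLinearMap.contDiff)

lemma integrable_coord_mul_comp (ι : Rn d →ₗᵢ[ℝ] Rn (d + 2)) (u : RadialTest (d + 2))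
    (i : Fin d) : Integrable fun x : Rn d => (x i : ℂ) * u.1 (ι x) :=
  (contDiff_coord_mul_comp ι u i).continuous.integrable_of_hasCompactSupport
    (hasCompactSupport_coord_mul_comp ι u i)

/-- By the dimension shift the i-th component has transform of modulus |ξ_i||û| ≤ |ξ||û|. This lets
a test function take the first place in the trilinear estimate. -/
lemma fourierMajorant_test (ι : Rn d →ₗᵢ[ℝ] Rn (d + 2)) (u : RadialTest (d + 2)) :
    FourierMajorant ι u.1 (shiftMaj ι u.1) := by
  intro i
  let F : SchwartzMap (Rn d) ℂ :=
    (hasCompactSupport_coord_mul_comp ι u i).toSchwartzMap (contDiff_coord_mul_comp ι u i)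
  have hF : (F : Rn d → ℂ) = fun x => (x i : ℂ) * u.1 (ι x) := rfl
  refine ⟨𝓕 (F : Rn d → ℂ), ?_, fun x => ?_, fun ξ => ?_⟩
  · rw [← SchwartzMap.fourier_coe]; exact SchwartzMap.integrable _
  · rw [F.continuous.fourierInv_fourier_eq F.integrable
      (by rw [← SchwartzMap.fourier_coe]; exact SchwartzMap.integrable _)]
    rfl
  · rw [hF, enorm_fourier_coord_mul_comp]
    unfold shiftMaj
    gcongr
    exact enorm_coord_le ξ i

lemma continuous_fourierInv {K : Rn d → ℂ} (hK : Integrable K) : Continuous (𝓕⁻ K) := by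
  rw [Real.fourierInv_eq_fourier_comp_neg]
  exact VectorFourier.fourierIntegral_continuous Real.continuous_fourierChar
    (by exact continuous_inner) hK.comp_neg

lemma fourier_finset_sum {ι' : Type*} (s : Finset ι') {f : ι' → Rn d → ℂ}
    (hf : ∀ i ∈ s, Integrable (f i)) (ξ : Rn d) :
    𝓕 (fun x => ∑ i ∈ s, f i x) ξ = ∑ i ∈ s, 𝓕 (f i) ξ := by
  simp only [Real.fourier_eq, Finset.smul_sum]
  rw [integral_finsetSum]
  exact fun i hi => (Real.fourierIntegral_convergent_iff ξ).2 (hf i hi)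

lemma enorm_le_sum_coord (ξ : Rn d) : ‖ξ‖ₑ ≤ ∑ j, ‖ξ j‖ₑ := by
  have h : ‖ξ‖ ≤ ∑ j, ‖ξ j‖ := by
    rw [EuclideanSpace.norm_eq]
    refine Real.sqrt_le_iff.2 ⟨Finset.sum_nonneg fun j _ => norm_nonneg _, ?_⟩
    exact Finset.sum_sq_le_sq_sum_of_nonneg fun j _ => norm_nonneg _
  rw [← ofReal_norm]
  refine (ENNReal.ofReal_le_ofReal h).trans (le_of_eq ?_)
  rw [ENNReal.ofReal_sum_of_nonneg fun j _ => norm_nonneg _]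
  simp only [ofReal_norm]

/-- The majorant of `|x|² a v w` is dominated by the triple convolution of the majorants. -/
theorem shiftMaj_le_lconvolution (ι : Rn d →ₗᵢ[ℝ] Rn (d + 2)) {a : Rn (d + 2) → ℂ}
    {H : Rn d → ℝ≥0∞} (ha : FourierMajorant ι a H) (v w W : RadialTest (d + 2))
    (hW : ∀ x, W.1 x = ((‖x‖ ^ 2 : ℝ) : ℂ) * a x * v.1 x * w.1 x) (ξ : Rn d) :
    shiftMaj ι W.1 ξ ≤ (d : ℝ≥0∞) ^ 2 * (H ⋆ₗ (shiftMaj ι v.1 ⋆ₗ shiftMaj ι w.1)) ξ := by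
  set B := (H ⋆ₗ (shiftMaj ι v.1 ⋆ₗ shiftMaj ι w.1)) ξ with hB
  choose K hKi hK hKle using ha
  choose Kv hKvi hKv hKvle using fourierMajorant_test ι v
  have hcoord : ∀ j : Fin d, ‖ξ j‖ₑ * ‖𝓕 W.1 (ι ξ)‖ₑ ≤ d * B := by
    intro j
    rw [← enorm_fourier_coord_mul_comp]
    have hint1 : ∀ i, Integrable fun x : Rn d => 𝓕⁻ (Kv i) x * ((x j : ℂ) * w.1 (ι x)) := by
      intro i
      refine Continuous.integrable_of_hasCompactSupport ?_
        (hasCompactSupport_coord_mul_comp ι w j).mul_left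
      exact (continuous_fourierInv (hKvi i)).mul (contDiff_coord_mul_comp ι w j).continuous
    have hint2 : ∀ i, Integrable fun x : Rn d =>
        𝓕⁻ (K i) x * (𝓕⁻ (Kv i) x * ((x j : ℂ) * w.1 (ι x))) := by
      intro i
      refine Continuous.integrable_of_hasCompactSupport ?_
        (hasCompactSupport_coord_mul_comp ι w j).mul_left.mul_left
      exact (continuous_fourierInv (hKi i)).mul
        ((continuous_fourierInv (hKvi i)).mul (contDiff_coord_mul_comp ι w j).continuous)
    -- Expanding |x|² = Σ x_i² hands one coordinate to a, one to v, and leaves x_j for w, so each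
    -- factor becomes a component of a shifted field. The sums over i and j account for the constant
    -- d².
    have hsum : (fun x : Rn d => (x j : ℂ) * W.1 (ι x)) =
        fun x => ∑ i, 𝓕⁻ (K i) x * (𝓕⁻ (Kv i) x * ((x j : ℂ) * w.1 (ι x))) := by
      funext x
      simp only [hK, hKv, hW, ι.norm_map]
      rw [EuclideanSpace.norm_sq_eq]
      push_cast
      simp only [Finset.sum_mul, Finset.mul_sum, Real.norm_eq_abs]
      refine Finset.sum_congr rfl fun i _ => ?_
      have : ((|x i| : ℝ) : ℂ) ^ 2 = (x i : ℂ) ^ 2 := by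
        rw [← Complex.ofReal_pow, sq_abs, Complex.ofReal_pow]
      rw [this]; ring
    rw [hsum, fourier_finset_sum _ fun i _ => hint2 i]
    refine (enorm_sum_le _ _).trans ?_
    calc _ ≤ ∑ _i : Fin d, B := by
          refine Finset.sum_le_sum fun i _ => ?_
          refine (enorm_fourier_mul_le (hKi i) (hint1 i) ξ).trans ?_
          refine lconvolution_mono (hKle i) (fun η => ?_) ξ
          refine (enorm_fourier_mul_le (hKvi i) (integrable_coord_mul_comp ι w j) η).trans ?_
          refine lconvolution_mono (hKvle i) (fun ζ => ?_) η
          rw [enorm_fourier_coord_mul_comp]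
          unfold shiftMaj
          gcongr
          exact enorm_coord_le ζ j
      _ = d * B := by simp
  calc shiftMaj ι W.1 ξ ≤ (∑ j, ‖ξ j‖ₑ) * ‖𝓕 W.1 (ι ξ)‖ₑ := by
        unfold shiftMaj; gcongr; exact enorm_le_sum_coord ξ
    _ ≤ ∑ _j : Fin d, d * B := by
        rw [Finset.sum_mul]; exact Finset.sum_le_sum fun j _ => hcoord j
    _ = _ := by simp; ring

/-- The Fourier transform of a product of test functions. -/
lemma enorm_fourier_test_mul_le {n : ℕ} (u v W : RadialTest n) (hW : ∀ x, W.1 x = u.1 x * v.1 x)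
    (ξ : Rn n) : ‖𝓕 W.1 ξ‖ₑ ≤ ((fun η => ‖𝓕 u.1 η‖ₑ) ⋆ₗ fun η => ‖𝓕 v.1 η‖ₑ) ξ := by
  have hFi : Integrable (𝓕 u.1) := by
    rw [← coe_testSchwartz, ← SchwartzMap.fourier_coe]; exact SchwartzMap.integrable _
  have h : W.1 = fun x => 𝓕⁻ (𝓕 u.1) x * v.1 x := by
    funext x
    rw [u.2.1.continuous.fourierInv_fourier_eq (integrable_test u) hFi, hW]
  rw [h]
  exact enorm_fourier_mul_le hFi (integrable_test v) ξ

end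

/-! ### Power-law integrability and Gaussians with a coordinate factor -/

section

variable {d : ℕ}

/-- Both bounds hold everywhere off the origin, but the first is used only on the unit ball, where a
< m suffices, and the second only outside it, where b > m does. -/
lemma lintegral_lt_top_of_le_rpow {E : Type*} [NormedAddCommGroup E] [InnerProductSpace ℝ E]
    [FiniteDimensional ℝ E] [MeasurableSpace E] [BorelSpace E] [Nontrivial E] {F : E → ℝ≥0∞}
    {a b C₀ C₁ : ℝ} (ha : a < finrank ℝ E) (hb : (finrank ℝ E : ℝ) < b)
    (h₀ : ∀ x, x ≠ 0 → F x ≤ ENNReal.ofReal (C₀ * ‖x‖ ^ (-a)))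
    (h₁ : ∀ x, x ≠ 0 → F x ≤ ENNReal.ofReal (C₁ * ‖x‖ ^ (-b))) : ∫⁻ x, F x < ⊤ := by
  have hS : MeasurableSet {x : E | ‖x‖ ≤ 1} := measurableSet_le measurable_norm measurable_const
  have hb0 : 0 < b := by
    have : (0 : ℝ) < finrank ℝ E := by exact_mod_cast finrank_pos
    linarith
  rw [← lintegral_add_compl _ hS]
  refine ENNReal.add_lt_top.2 ⟨?_, ?_⟩
  · calc ∫⁻ x in {x : E | ‖x‖ ≤ 1}, F x
        ≤ ∫⁻ x in {x : E | ‖x‖ ≤ 1}, ENNReal.ofReal |C₀| *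
            ENNReal.ofReal (‖x‖ ^ (-(2 * (a / 2)))) := by
          refine lintegral_mono_ae ?_
          filter_upwards [ae_restrict_of_ae (Measure.ae_ne volume 0)] with x hx
          refine (h₀ x hx).trans ?_
          rw [← ENNReal.ofReal_mul (abs_nonneg _), mul_div_cancel₀ _ two_ne_zero]
          refine ENNReal.ofReal_le_ofReal ?_
          gcongr
          exact le_abs_self _
      _ = ENNReal.ofReal |C₀| * ∫⁻ x in {x : E | ‖x‖ ≤ 1},
            ENNReal.ofReal (‖x‖ ^ (-(2 * (a / 2)))) := lintegral_const_mul _ (by fun_prop)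
      _ < ⊤ := by
          rw [lintegral_ball_rpow (by linarith) one_pos]
          exact ENNReal.mul_lt_top (by simp) (ENNReal.mul_lt_top
            (ENNReal.mul_lt_top (by simp) measure_ball_lt_top) (by simp))
  · have hint := (integrable_one_add_norm (E := E) (μ := volume) hb).const_mul (|C₁| * 2 ^ b)
    refine lt_of_le_of_lt ?_ hint.2
    refine (setLIntegral_mono' hS.compl fun x hx => ?_).trans (setLIntegral_le_lintegral _ _)
    have hx : 1 < ‖x‖ := not_le.1 hx
    refine (h₁ x (by rw [← norm_pos_iff]; linarith)).trans ?_
    rw [Real.enorm_eq_ofReal (by positivity)]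
    refine ENNReal.ofReal_le_ofReal ?_
    simp only
    rw [mul_assoc]
    refine mul_le_mul (le_abs_self _) ?_ (by positivity) (abs_nonneg _)
    rw [Real.rpow_neg (by positivity), Real.rpow_neg (by positivity), ← div_eq_mul_inv,
      le_div_iff₀ (by positivity), inv_mul_le_iff₀ (by positivity),
      ← Real.mul_rpow (by positivity) (by positivity)]
    exact Real.rpow_le_rpow (by positivity) (by linarith) hb0.le

/-- `x ↦ x_i e^{-b|x|²}` as an inverse Fourier transform. -/
lemma fourierInv_coord_mul_gaussian {b : ℂ} (hb : 0 < b.re) (i : Fin d) (x : Rn d) :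
    𝓕⁻ (fun η : Rn d => ((b / Real.pi) ^ ((d : ℂ) / 2))⁻¹ * (-Complex.I * Real.pi / b) *
        ((η i : ℂ) * Complex.exp (-(Real.pi ^ 2 / b) * (‖η‖ : ℂ) ^ 2))) x =
      (x i : ℂ) * Complex.exp (-b * (‖x‖ : ℂ) ^ 2) := by
  -- The Gaussian with parameter B = π²/b transforms into a multiple of e^{-b|x|²}; differentiating
  -- this transform brings down the coordinate.
  set B : ℂ := Real.pi ^ 2 / b with hB
  have hb0 : b ≠ 0 := by rintro rfl; simp at hb
  have hpi : (Real.pi : ℂ) ≠ 0 := by simp [Real.pi_ne_zero]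
  have hBre : 0 < B.re := by
    rw [hB, Complex.div_re, ← Complex.ofReal_pow]
    simp only [Complex.ofReal_re, Complex.ofReal_im, zero_mul, zero_div, add_zero]
    have := Complex.normSq_pos.2 hb0
    positivity
  let f : Rn d → ℂ := fun v => Complex.exp (-B * (‖v‖ : ℂ) ^ 2)
  have hf : ∀ w, 𝓕 f w = (b / Real.pi) ^ ((d : ℂ) / 2) * Complex.exp (-b * (‖w‖ : ℂ) ^ 2) := by
    intro w
    have := fourier_gaussian_innerProductSpace (V := Rn d) hBre w
    have e1 : (Real.pi : ℂ) / B = b / Real.pi := by rw [hB]; field_simp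
    have e2 : -(Real.pi : ℂ) ^ 2 * (‖w‖ : ℂ) ^ 2 / B = -b * (‖w‖ : ℂ) ^ 2 := by rw [hB]; field_simp
    rw [e1, e2, show finrank ℝ (Rn d) = d by simp] at this
    exact this
  have hint : Integrable f := by
    have := GaussianFourier.integrable_cexp_neg_mul_sq_norm_add (V := Rn d) hBre 0 0
    simpa [f] using this
  have hnorm : ∀ v : Rn d, ‖f v‖ = Real.exp (-B.re * ‖v‖ ^ 2) := fun v =>
    norm_cexp_neg_mul_sq B ‖v‖
  have hne : Nontrivial (Rn d) := by
    have : Nonempty (Fin d) := ⟨i⟩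
    infer_instance
  have hfc : Continuous f := by fun_prop
  have hvint : Integrable fun v : Rn d => ‖v‖ * ‖f v‖ := by
    simp only [hnorm]
    have hd : finrank ℝ (Rn d) = d := by simp
    refine (integrable_fun_norm_addHaar (volume : Measure (Rn d))
      (f := fun r => r * Real.exp (-B.re * r ^ 2))).2 ?_
    have hpos : 0 < d := i.pos
    refine (integrableOn_rpow_mul_exp_neg_mul_sq hBre (s := d) (by
      have : (0 : ℝ) ≤ d := by positivity
      linarith)).congr_fun (fun y hy => ?_) measurableSet_Ioi
    simp only [hd, smul_eq_mul, Real.rpow_natCast]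
    rw [← mul_assoc, ← pow_succ, Nat.sub_add_cancel hpos]
  have hsm : Integrable (VectorFourier.fourierSMulRight (innerSL ℝ) f) := by
    refine (hvint.const_mul (2 * Real.pi * ‖innerSL ℝ (E := Rn d)‖)).mono'
      hfc.aestronglyMeasurable.fourierSMulRight (Eventually.of_forall fun v => ?_)
    refine (VectorFourier.norm_fourierSMulRight_le _ _ v).trans (le_of_eq (by ring))
  have key : ∀ w : Rn d, 𝓕 (fun η : Rn d => (η i : ℂ) * f η) w =
      -Complex.I * b / Real.pi * (w i : ℂ) * 𝓕 f w := by
    intro w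
    have h1 := Real.hasFDerivAt_fourier hint hvint w
    have h3 : HasFDerivAt (fun y : Rn d => ((‖y‖ ^ 2 : ℝ) : ℂ))
        (Complex.ofRealCLM.comp (2 • innerSL ℝ w)) w :=
      Complex.ofRealCLM.hasFDerivAt.comp w (hasStrictFDerivAt_norm_sq w).hasFDerivAt
    have h4 := (((h3.const_mul (-b)).cexp).const_mul ((b / Real.pi) ^ ((d : ℂ) / 2)))
    have heq : 𝓕 f = fun y : Rn d => (b / Real.pi) ^ ((d : ℂ) / 2) *
        Complex.exp (-b * ((‖y‖ ^ 2 : ℝ) : ℂ)) := by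
      funext y
      rw [hf]; push_cast; rfl
    have h2 := h4
    rw [← heq] at h2
    have h5 := congrArg (fun T => T (EuclideanSpace.single i (1 : ℝ))) (h1.unique h2)
    simp only at h5
    rw [Real.fourier_continuousLinearMap_apply hsm] at h5
    have e1 : (fun v => VectorFourier.fourierSMulRight (innerSL ℝ) f v
        (EuclideanSpace.single i (1 : ℝ))) =
        fun v => (-(2 * Real.pi * Complex.I)) * ((v i : ℂ) * f v) := by
      funext v
      rw [VectorFourier.fourierSMulRight_apply, innerSL_apply_apply, inner_single_right]
      simp
    have e2 : 𝓕 (fun v : Rn d => (-(2 * Real.pi * Complex.I)) * ((v i : ℂ) * f v)) w =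
        (-(2 * Real.pi * Complex.I)) * 𝓕 (fun v : Rn d => (v i : ℂ) * f v) w := by
      rw [Real.fourier_eq, Real.fourier_eq, ← integral_const_mul]
      refine integral_congr_ae (Eventually.of_forall fun y => ?_)
      simp only [Circle.smul_def, smul_eq_mul]; ring
    rw [e1, e2] at h5
    have hI : (-(2 * Real.pi * Complex.I) : ℂ) ≠ 0 := by simp [Real.pi_ne_zero]
    refine mul_left_cancel₀ hI (h5.trans ?_)
    have e3 : (innerSL ℝ w) (EuclideanSpace.single i (1 : ℝ)) = w i := by
      rw [innerSL_apply_apply, inner_single_right]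
    rw [hf]
    simp [e3]
    have hII := Complex.I_mul_I
    field_simp
    linear_combination ((b / Real.pi) ^ ((d : ℂ) / 2) * (w i : ℂ)) * hII
  rw [Real.fourierInv_eq_fourier_neg]
  have e4 : 𝓕 (fun η : Rn d => ((b / Real.pi) ^ ((d : ℂ) / 2))⁻¹ * (-Complex.I * Real.pi / b) *
        ((η i : ℂ) * Complex.exp (-(Real.pi ^ 2 / b) * (‖η‖ : ℂ) ^ 2))) (-x) =
      ((b / Real.pi) ^ ((d : ℂ) / 2))⁻¹ * (-Complex.I * Real.pi / b) *
        𝓕 (fun η : Rn d => (η i : ℂ) * f η) (-x) := by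
    rw [Real.fourier_eq, Real.fourier_eq, ← integral_const_mul]
    refine integral_congr_ae (Eventually.of_forall fun y => ?_)
    simp only [Circle.smul_def, smul_eq_mul, f, ← hB]; ring
  have hpow : (b / Real.pi) ^ ((d : ℂ) / 2) ≠ 0 := by
    rw [Complex.cpow_ne_zero_iff]; left; exact div_ne_zero hb0 hpi
  rw [e4, key, hf, norm_neg]
  have hII := Complex.I_sq
  simp only [PiLp.neg_apply, Complex.ofReal_neg]
  field_simp
  rw [hII]
  ring

end

/-! ### The Fourier majorant of the resolvent potential -/

section

variable {d : ℕ}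

/-- The inequality 1 + x ≤ e^x at x = y/N − 1, raised to the power N; the gain e^{-N} is discarded.
-/
lemma rpow_mul_exp_neg_le {y N : ℝ} (hy : 0 ≤ y) (hN : 0 < N) :
    y ^ N * Real.exp (-y) ≤ N ^ N := by
  have h1 : y / N ≤ Real.exp (y / N - 1) := by
    have := Real.add_one_le_exp (y / N - 1); linarith
  have h2 : (y / N) ^ N ≤ Real.exp (y / N - 1) ^ N := Real.rpow_le_rpow (by positivity) h1 hN.le
  rw [← Real.exp_mul, Real.div_rpow hy hN.le, div_le_iff₀ (by positivity)] at h2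
  have h3 : (y / N - 1) * N = y - N := by field_simp
  rw [h3] at h2
  calc y ^ N * Real.exp (-y) ≤ Real.exp (y - N) * N ^ N * Real.exp (-y) := by gcongr
    _ = N ^ N * Real.exp (-N) := by
        rw [mul_right_comm, ← Real.exp_add, mul_comm]; ring_nf
    _ ≤ N ^ N * 1 := by
        gcongr; exact Real.exp_le_one_iff.2 (by linarith)
    _ = N ^ N := mul_one _

/-- The integrand of the majorant of the resolvent potential. -/
def resolventIntegrand (d : ℕ) (κ γ : ℝ) (t : ℝ) (r : ℝ) : ℝ :=
  t ^ (-((d : ℝ) / 2) - 1) * Real.exp (-κ * t) * (r * Real.exp (-(γ / t) * r ^ 2))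

/-- The majorant of the resolvent potential. -/
def resolventMaj (κ γ : ℝ) (η : Rn d) : ℝ≥0∞ :=
  ∫⁻ t in Set.Ioi (0 : ℝ), ENNReal.ofReal (resolventIntegrand d κ γ t ‖η‖)

lemma measurable_resolventIntegrand (κ γ : ℝ) :
    Measurable fun p : ℝ × Rn d => resolventIntegrand d κ γ p.1 ‖p.2‖ := by
  unfold resolventIntegrand; fun_prop

lemma measurable_resolventMaj (κ γ : ℝ) : Measurable (resolventMaj κ γ : Rn d → ℝ≥0∞) := by
  have := (measurable_resolventIntegrand (d := d) κ γ).ennreal_ofReal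
  exact Measurable.lintegral_prod_left this

/-- Trade the Gaussian for the power (γ|η|²/t)^{-N}; the remaining integral of t^{N−d/2−1}e^{-κt}
converges at 0 because N > d/2. Since N is free, it can be taken near d/2 for small η and large for
large η. -/
lemma resolventMaj_le {κ γ : ℝ} (hκ : 0 < κ) (hγ : 0 < γ) {N : ℝ} (hN : (d : ℝ) / 2 < N) :
    ∃ C : ℝ, 0 ≤ C ∧ ∀ η : Rn d, η ≠ 0 →
      resolventMaj κ γ η ≤ ENNReal.ofReal (C * ‖η‖ ^ (-(2 * N - 1))) := by
  have hd0 : (0 : ℝ) ≤ (d : ℝ) / 2 := by positivity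
  have hN0 : 0 < N := by linarith
  have hI : IntegrableOn (fun t : ℝ => t ^ (N - (d : ℝ) / 2 - 1) * Real.exp (-κ * t))
      (Set.Ioi 0) := by
    have := integrableOn_rpow_mul_exp_neg_mul_rpow (s := N - (d : ℝ) / 2 - 1) (p := 1) (b := κ)
      (by linarith) one_pos hκ
    simpa only [Real.rpow_one] using this
  set J := ∫ t in Set.Ioi (0 : ℝ), t ^ (N - (d : ℝ) / 2 - 1) * Real.exp (-κ * t) with hJ
  have hJ0 : 0 ≤ J := setIntegral_nonneg measurableSet_Ioi fun t ht => by
    have ht : 0 < t := ht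
    positivity
  refine ⟨N ^ N * γ ^ (-N) * J, by positivity, fun η hη => ?_⟩
  have hr : 0 < ‖η‖ := norm_pos_iff.2 hη
  have hle : ∀ t ∈ Set.Ioi (0 : ℝ), ENNReal.ofReal (resolventIntegrand d κ γ t ‖η‖) ≤
      ENNReal.ofReal (N ^ N * γ ^ (-N) * ‖η‖ ^ (-(2 * N - 1))) *
        ENNReal.ofReal (t ^ (N - (d : ℝ) / 2 - 1) * Real.exp (-κ * t)) := by
    intro t ht
    have ht : 0 < t := ht
    rw [← ENNReal.ofReal_mul (by positivity)]
    refine ENNReal.ofReal_le_ofReal ?_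
    have h1 := rpow_mul_exp_neg_le (y := γ / t * ‖η‖ ^ 2) (by positivity) hN0
    have h2 : (γ / t * ‖η‖ ^ 2) ^ N = γ ^ N * t ^ (-N) * ‖η‖ ^ (2 * N) := by
      rw [Real.mul_rpow (by positivity) (by positivity), Real.div_rpow hγ.le ht.le,
        Real.rpow_neg ht.le, ← Real.rpow_natCast, ← Real.rpow_mul hr.le]
      push_cast; ring
    rw [h2, ← neg_mul] at h1
    have h3 : ‖η‖ * Real.exp (-(γ / t) * ‖η‖ ^ 2) ≤
        N ^ N * γ ^ (-N) * ‖η‖ ^ (-(2 * N - 1)) * t ^ N := by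
      have e1 : ‖η‖ ^ (-(2 * N - 1)) = ‖η‖ * (‖η‖ ^ (2 * N))⁻¹ := by
        rw [neg_sub, Real.rpow_sub hr, Real.rpow_one]; rfl
      rw [e1, Real.rpow_neg hγ.le]
      rw [Real.rpow_neg ht.le] at h1
      have p1 : 0 < γ ^ N := by positivity
      have p2 : 0 < t ^ N := by positivity
      have p3 : 0 < ‖η‖ ^ (2 * N) := by positivity
      have h4 : Real.exp (-(γ / t) * ‖η‖ ^ 2) ≤ N ^ N * (γ ^ N)⁻¹ * (‖η‖ ^ (2 * N))⁻¹ * t ^ N := by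
        calc _ = (γ ^ N)⁻¹ * (‖η‖ ^ (2 * N))⁻¹ * t ^ N *
              (γ ^ N * (t ^ N)⁻¹ * ‖η‖ ^ (2 * N) * Real.exp (-(γ / t) * ‖η‖ ^ 2)) := by
              field_simp
          _ ≤ (γ ^ N)⁻¹ * (‖η‖ ^ (2 * N))⁻¹ * t ^ N * N ^ N := by gcongr
          _ = _ := by ring
      calc _ ≤ ‖η‖ * (N ^ N * (γ ^ N)⁻¹ * (‖η‖ ^ (2 * N))⁻¹ * t ^ N) := by gcongr
        _ = _ := by ring
    unfold resolventIntegrand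
    calc _ ≤ t ^ (-((d : ℝ) / 2) - 1) * Real.exp (-κ * t) *
          (N ^ N * γ ^ (-N) * ‖η‖ ^ (-(2 * N - 1)) * t ^ N) := by gcongr
      _ = _ := by
        have : t ^ (N - (d : ℝ) / 2 - 1) = t ^ (-((d : ℝ) / 2) - 1) * t ^ N := by
          rw [← Real.rpow_add ht]; ring_nf
        rw [this]; ring
  calc resolventMaj κ γ η ≤ ∫⁻ t in Set.Ioi (0 : ℝ),
        ENNReal.ofReal (N ^ N * γ ^ (-N) * ‖η‖ ^ (-(2 * N - 1))) *
        ENNReal.ofReal (t ^ (N - (d : ℝ) / 2 - 1) * Real.exp (-κ * t)) :=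
        setLIntegral_mono' measurableSet_Ioi hle
    _ = ENNReal.ofReal (N ^ N * γ ^ (-N) * ‖η‖ ^ (-(2 * N - 1))) * ENNReal.ofReal J := by
        rw [lintegral_const_mul _ (by fun_prop), hJ, ofReal_integral_eq_lintegral_ofReal hI]
        filter_upwards [ae_restrict_mem measurableSet_Ioi] with t ht
        have ht : 0 < t := ht
        simp only [Pi.zero_apply]; positivity
    _ = _ := by
        rw [← ENNReal.ofReal_mul (by positivity)]
        congr 1; ring

lemma lintegral_resolventMaj_lt_top (hd : 0 < d) {κ γ : ℝ} (hκ : 0 < κ) (hγ : 0 < γ) :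
    ∫⁻ η : Rn d, resolventMaj κ γ η < ⊤ := by
  have : Nonempty (Fin d) := ⟨⟨0, hd⟩⟩
  have hfr : (finrank ℝ (Rn d) : ℝ) = d := by simp
  -- These choices of N give the decay exponents d − 3/4 and d + 1, on either side of d.
  obtain ⟨C₀, _, h₀⟩ := resolventMaj_le (d := d) hκ hγ (N := d / 2 + 1 / 8) (by linarith)
  obtain ⟨C₁, _, h₁⟩ := resolventMaj_le (d := d) hκ hγ (N := d / 2 + 1) (by linarith)
  exact lintegral_lt_top_of_le_rpow (by rw [hfr]; linarith) (by rw [hfr]; linarith) h₀ h₁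

lemma wNorm_resolventMaj_lt_top (hd : 0 < d) {κ γ : ℝ} (hκ : 0 < κ) (hγ : 0 < γ) {s : ℝ}
    (hs0 : 0 ≤ s) (hs : ((d : ℝ) - 1) / 2 ≤ s) :
    wNorm s (resolventMaj κ γ : Rn d → ℝ≥0∞) < ⊤ := by
  have : Nonempty (Fin d) := ⟨⟨0, hd⟩⟩
  have hd' : (0 : ℝ) < d := by exact_mod_cast hd
  have hfr : (finrank ℝ (Rn d) : ℝ) = d := by simp
  have key : ∀ N : ℝ, (d : ℝ) / 2 < N → ∃ C : ℝ, ∀ η : Rn d, η ≠ 0 →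
      (‖η‖ₑ ^ s * resolventMaj κ γ η) ^ 2 ≤
        ENNReal.ofReal (C * ‖η‖ ^ (-(2 * (2 * N - 1) - 2 * s))) := by
    intro N hN
    obtain ⟨C, hC, h⟩ := resolventMaj_le (d := d) hκ hγ hN
    refine ⟨C ^ 2, fun η hη => ?_⟩
    have hr : 0 < ‖η‖ := norm_pos_iff.2 hη
    calc _ ≤ (ENNReal.ofReal (‖η‖ ^ s) * ENNReal.ofReal (C * ‖η‖ ^ (-(2 * N - 1)))) ^ 2 := by
          rw [← ofReal_norm, ENNReal.ofReal_rpow_of_pos hr]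
          gcongr
          exact h η hη
      _ = _ := by
          rw [← ENNReal.ofReal_mul (by positivity), ← ENNReal.ofReal_pow (by positivity)]
          congr 1
          have : ‖η‖ ^ (-(2 * (2 * N - 1) - 2 * s)) = (‖η‖ ^ s * ‖η‖ ^ (-(2 * N - 1))) ^ 2 := by
            rw [← Real.rpow_add hr, ← Real.rpow_natCast, ← Real.rpow_mul hr.le]
            congr 1; push_cast; ring
          rw [this]; ring
  -- The two exponents are 2d − 3/2 − 2s, less than d because s ≥ (d−1)/2, and 2d.
  obtain ⟨C₀, h₀⟩ := key (d / 2 + 1 / 8) (by linarith)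
  obtain ⟨C₁, h₁⟩ := key ((s + d + 1) / 2) (by linarith)
  have hfin := lintegral_lt_top_of_le_rpow (by rw [hfr]; linarith) (by rw [hfr]; linarith) h₀ h₁
  rw [← wNorm_sq] at hfin
  by_contra h
  rw [not_lt, top_le_iff] at h
  rw [h] at hfin
  simp at hfin

/-- The resolvent potential `1 / (|x|² + β)` has a Fourier majorant. -/
theorem fourierMajorant_resolvent (ι : Rn d →ₗᵢ[ℝ] Rn (d + 2)) {w β : ℂ} (hw : 0 < w.re)
    (hwβ : 0 < (w * β).re) : ∃ H : Rn d → ℝ≥0∞, Measurable H ∧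
      FourierMajorant ι (fun x => 1 / (((‖x‖ ^ 2 : ℝ) : ℂ) + β)) H ∧
      ∀ s : ℝ, 0 ≤ s → ((d : ℝ) - 1) / 2 ≤ s → wNorm s H < ⊤ := by
  rcases Nat.eq_zero_or_pos d with rfl | hd
  · refine ⟨0, measurable_zero, fun i => i.elim0, fun s _ _ => ?_⟩
    simp [wNorm]
  have hw0 : w ≠ 0 := by rintro rfl; simp at hw
  have hwn : 0 < ‖w‖ := norm_pos_iff.2 hw0
  set κ := (w * β).re with hκ
  set γ : ℝ := (Real.pi ^ 2 / w).re with hγ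
  have hγ0 : 0 < γ := by
    rw [hγ, Complex.div_re, ← Complex.ofReal_pow]
    simp only [Complex.ofReal_re, Complex.ofReal_im, zero_mul, zero_div, add_zero]
    have := Complex.normSq_pos.2 hw0
    positivity
  set c : ℝ := ‖w‖ * ((‖w‖ / Real.pi) ^ ((d : ℝ) / 2))⁻¹ * (Real.pi / ‖w‖) with hc
  have hc0 : 0 ≤ c := by positivity
  refine ⟨fun η => ENNReal.ofReal c * resolventMaj κ γ η,
    (measurable_resolventMaj κ γ).const_mul _, fun i => ?_, fun s hs0 hs => ?_⟩
  · let k : ℝ → Rn d → ℂ := fun t η => w * Complex.exp (-(t * w * β)) *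
      ((((t * w : ℂ) / Real.pi) ^ ((d : ℂ) / 2))⁻¹ * (-Complex.I * Real.pi / (t * w)) *
        ((η i : ℂ) * Complex.exp (-(Real.pi ^ 2 / (t * w)) * (‖η‖ : ℂ) ^ 2)))
    have hkm : Measurable fun p : ℝ × Rn d => k p.1 p.2 := by
      have h1 : Measurable fun p : ℝ × Rn d => p.2 i :=
        (EuclideanSpace.proj (𝕜 := ℝ) i).continuous.measurable.comp measurable_snd
      simp only [k]
      fun_prop
    have hkle : ∀ t, 0 < t → ∀ η, ‖k t η‖ₑ ≤
        ENNReal.ofReal c * ENNReal.ofReal (resolventIntegrand d κ γ t ‖η‖) := by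
      intro t ht η
      rw [← ENNReal.ofReal_mul hc0, ← ofReal_norm]
      refine ENNReal.ofReal_le_ofReal ?_
      have n1 : ‖((t * w : ℂ) / Real.pi) ^ ((d : ℂ) / 2)‖ =
          t ^ ((d : ℝ) / 2) * (‖w‖ / Real.pi) ^ ((d : ℝ) / 2) := by
        have : (d : ℂ) / 2 = (((d : ℝ) / 2 : ℝ) : ℂ) := by push_cast; rfl
        rw [this, Complex.norm_cpow_real, norm_div, norm_mul, Complex.norm_real, Complex.norm_real,
          Real.norm_of_nonneg ht.le, Real.norm_of_nonneg Real.pi_pos.le, mul_div_assoc,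
          Real.mul_rpow ht.le (by positivity)]
      have n2 : ‖Complex.exp (-(t * w * β))‖ = Real.exp (-κ * t) := by
        rw [Complex.norm_exp]
        congr 1
        rw [mul_assoc, Complex.neg_re, Complex.re_ofReal_mul]; ring
      have n3 : ‖Complex.exp (-(Real.pi ^ 2 / (t * w)) * (‖η‖ : ℂ) ^ 2)‖ =
          Real.exp (-(γ / t) * ‖η‖ ^ 2) := by
        rw [norm_cexp_neg_mul_sq]
        congr 3
        rw [hγ, mul_comm, ← div_div, Complex.div_ofReal_re]
      have n4 : ‖((η i : ℝ) : ℂ)‖ ≤ ‖η‖ := by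
        rw [Complex.norm_real]; exact PiLp.norm_apply_le η i
      have n5 : ‖(-Complex.I * Real.pi / (t * w) : ℂ)‖ = Real.pi / ‖w‖ * t⁻¹ := by
        rw [norm_div, norm_mul, norm_mul, norm_neg, Complex.norm_I, Complex.norm_real,
          Complex.norm_real, Real.norm_of_nonneg ht.le, Real.norm_of_nonneg Real.pi_pos.le]
        field_simp
      simp only [k, norm_mul, norm_inv, n1, n2, n3]
      rw [n5]
      have e1 : t ^ (-((d : ℝ) / 2) - 1) = (t ^ ((d : ℝ) / 2))⁻¹ * t⁻¹ := by
        rw [Real.rpow_sub_one ht.ne', Real.rpow_neg ht.le]; rfl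
      unfold resolventIntegrand
      rw [e1, hc, mul_inv]
      calc _ ≤ ‖w‖ * Real.exp (-κ * t) * ((t ^ ((d : ℝ) / 2))⁻¹ *
            ((‖w‖ / Real.pi) ^ ((d : ℝ) / 2))⁻¹ * (Real.pi / ‖w‖ * t⁻¹) *
            (‖η‖ * Real.exp (-(γ / t) * ‖η‖ ^ 2))) := by gcongr
        _ = _ := by ring
    have hkint : Integrable (fun p : ℝ × Rn d => k p.1 p.2)
        ((volume.restrict (Set.Ioi 0)).prod volume) := by
      refine ⟨hkm.aestronglyMeasurable, ?_⟩
      rw [HasFiniteIntegral, lintegral_prod_symm' _ hkm.enorm]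
      calc _ ≤ ∫⁻ η : Rn d, ENNReal.ofReal c * resolventMaj κ γ η := by
            refine lintegral_mono fun η => ?_
            rw [resolventMaj, ← lintegral_const_mul' _ _ (by simp)]
            exact setLIntegral_mono' measurableSet_Ioi fun t ht => hkle t ht η
        _ = ENNReal.ofReal c * ∫⁻ η : Rn d, resolventMaj κ γ η :=
            lintegral_const_mul _ (measurable_resolventMaj κ γ)
        _ < ⊤ := ENNReal.mul_lt_top (by simp) (lintegral_resolventMaj_lt_top hd hwβ hγ0)
    refine ⟨fun η => ∫ t in Set.Ioi (0 : ℝ), k t η, hkint.integral_prod_right, fun x => ?_,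
      fun ξ => ?_⟩
    · rw [Real.fourierInv_eq]
      have hswap : ∫ η : Rn d, Real.fourierChar (inner ℝ η x) • ∫ t in Set.Ioi (0 : ℝ), k t η =
          ∫ t in Set.Ioi (0 : ℝ), 𝓕⁻ (k t) x := by
        simp only [Real.fourierInv_eq]
        rw [integral_integral_swap]
        · refine integral_congr_ae (Eventually.of_forall fun η => ?_)
          simp only [Circle.smul_def]
          exact (integral_smul _ _).symm
        · refine hkint.mono ?_ (Eventually.of_forall fun p => ?_)
          · have hc1 : Continuous fun p : ℝ × Rn d => Real.fourierChar (inner ℝ p.2 x) :=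
              Real.continuous_fourierChar.comp (by fun_prop)
            exact hc1.aestronglyMeasurable.smul hkm.aestronglyMeasurable
          · simp [Function.uncurry, Circle.norm_smul]
      rw [hswap]
      have hval : ∀ t ∈ Set.Ioi (0 : ℝ), 𝓕⁻ (k t) x =
          (x i : ℂ) * w * Complex.exp (-(w * (((‖x‖ ^ 2 : ℝ) : ℂ) + β)) * t) := by
        intro t ht
        have ht : 0 < t := ht
        have hre : 0 < ((t : ℂ) * w).re := by
          rw [Complex.re_ofReal_mul]; positivity
        have h1 := fourierInv_coord_mul_gaussian hre i x
        have h2 : 𝓕⁻ (k t) x = w * Complex.exp (-(t * w * β)) *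
            ((x i : ℂ) * Complex.exp (-((t : ℂ) * w) * (‖x‖ : ℂ) ^ 2)) := by
          rw [← h1, Real.fourierInv_eq, Real.fourierInv_eq, ← integral_const_mul]
          refine integral_congr_ae (Eventually.of_forall fun η => ?_)
          simp only [k, Circle.smul_def, smul_eq_mul]; ring
        rw [h2]
        have h3 : Complex.exp (-(w * (((‖x‖ ^ 2 : ℝ) : ℂ) + β)) * t) =
            Complex.exp (-(t * w * β)) * Complex.exp (-((t : ℂ) * w) * (‖x‖ : ℂ) ^ 2) := by
          rw [← Complex.exp_add]; congr 1; push_cast; ring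
        rw [h3]; ring
      rw [setIntegral_congr_fun measurableSet_Ioi hval, integral_const_mul]
      have hre : (-(w * (((‖x‖ ^ 2 : ℝ) : ℂ) + β))).re < 0 := by
        rw [mul_add, Complex.neg_re, Complex.add_re, mul_comm w ((‖x‖ ^ 2 : ℝ) : ℂ),
          Complex.re_ofReal_mul]
        have : 0 ≤ ‖x‖ ^ 2 * w.re := by positivity
        linarith
      rw [integral_exp_mul_complex_Ioi hre]
      have hne : ((‖x‖ ^ 2 : ℝ) : ℂ) + β ≠ 0 := by
        intro h
        rw [h] at hre
        simp at hre
      change _ = (x i : ℂ) * (1 / (((‖ι x‖ ^ 2 : ℝ) : ℂ) + β))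
      rw [ι.norm_map]
      simp only [Complex.ofReal_zero, mul_zero, Complex.exp_zero]
      field_simp
    · refine (enorm_integral_le_lintegral_enorm _).trans ?_
      simp only [resolventMaj]
      rw [← lintegral_const_mul' _ _ (by simp)]
      exact setLIntegral_mono' measurableSet_Ioi fun t ht => hkle t ht ξ
  · rw [wNorm_const_mul _ (measurable_resolventMaj κ γ)]
    exact ENNReal.mul_lt_top (by simp) (wNorm_resolventMaj_lt_top hd hwβ hγ0 hs0 hs)

end

/-! ### The coefficient of the nonlinearity -/

/-- The Laplace representation needs a half-plane containing both the positive axis and β. For d >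
4, β itself is positive; for d = 3 it is (−2 ± i√3)/3, off the negative axis. The excluded d = 4 has
β = 0. -/
lemma exists_rotation_beta {d : ℝ} (hd : d = 3 ∨ 4 < d) :
    ∃ w : ℂ, 0 < w.re ∧ 0 < (w * betaConst d).re := by
  rcases hd with rfl | hd
  · set z : ℂ := ((3 * ((3 : ℝ) - 2) * (3 - 4) : ℝ) : ℂ) ^ (1 / 2 : ℂ) with hz
    have hz2 : z ^ 2 = -3 := by
      have := Complex.cpow_nat_inv_pow ((3 * ((3 : ℝ) - 2) * (3 - 4) : ℝ) : ℂ) two_ne_zero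
      rw [hz]
      rw [one_div]
      push_cast at this ⊢
      rw [this]; norm_num
    have hre : z.re ^ 2 - z.im ^ 2 = -3 := by
      have := congrArg Complex.re hz2
      simpa [pow_two] using this
    have him : z.re * z.im = 0 := by
      have := congrArg Complex.im hz2
      simp [pow_two] at this
      linarith
    have hre0 : z.re = 0 := by
      rcases mul_eq_zero.1 him with h | h
      · exact h
      · rw [h] at hre; nlinarith [sq_nonneg z.re]
    have hb : betaConst 3 = 1 / 3 * (-2 + z) := by
      rw [betaConst, ← hz]; push_cast; ring
    -- The root z is purely imaginary with (Im z)² = 3, so 3 Re(wβ) = −2 + 2·3 = 4, whichever sign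
    -- Im z has.
    refine ⟨⟨1, -2 * z.im⟩, by simp, ?_⟩
    rw [hb]
    have : (1 / 3 * (-2 + z) : ℂ) = ((1 / 3 : ℝ) : ℂ) * (-2 + z) := by push_cast; ring
    rw [this, mul_left_comm, Complex.re_ofReal_mul, Complex.mul_re]
    simp only [Complex.add_re, Complex.add_im, Complex.neg_re, Complex.neg_im, Complex.re_ofNat,
      Complex.im_ofNat, hre0]
    rw [hre0] at hre
    nlinarith
  · refine ⟨1, by simp, ?_⟩
    have h0 : 0 ≤ 3 * (d - 2) * (d - 4) := by
      have : 0 < d - 4 := by linarith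
      have : 0 < d - 2 := by linarith
      positivity
    have h1 : ((3 * (d - 2) * (d - 4) : ℝ) : ℂ) ^ (1 / 2 : ℂ) =
        (((3 * (d - 2) * (d - 4)) ^ (1 / 2 : ℝ) : ℝ) : ℂ) := by
      rw [Complex.ofReal_cpow h0]; push_cast; rfl
    have h2 := Real.rpow_nonneg h0 (1 / 2)
    have : (1 : ℂ) * betaConst d =
        ((1 / 3 * (2 * d - 8 + (3 * (d - 2) * (d - 4)) ^ (1 / 2 : ℝ)) : ℝ) : ℂ) := by
      rw [betaConst, h1]; push_cast; ring
    rw [this, Complex.ofReal_re]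
    linarith

/-- Away from the origin the nonlinearity has a coefficient built from the resolvent potential
`1 / (|x|² + β)` with `β` off the negative half-line. -/
lemma exists_scalarN_eq {n : ℕ} (hn : 5 ≤ n) : ∃ c c' β w : ℂ, c ≠ 0 ∧ 0 < w.re ∧
    0 < (w * β).re ∧ ∀ x : Rn n, x ≠ 0 → ∀ z : ℂ, scalarN n x z = ((n : ℂ) - 4) * z ^ 2 *
      (c - c' * (((‖x‖ ^ 2 : ℝ) : ℂ) * (1 / (((‖x‖ ^ 2 : ℝ) : ℂ) + β))) -
        ((‖x‖ ^ 2 : ℝ) : ℂ) * z) := by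
  by_cases h6 : n = 6
  · subst h6
    -- For n = 6, α = 2 and β = 0, so |x|²φ₀ = 2 off the origin and the coefficient is 3 − 6 = −3.
    -- The potential is switched off by c' = 0, and its parameter 1 is a dummy.
    refine ⟨-3, 0, 1, 1, by simp, by simp, by simp, fun x hx z => ?_⟩
    have hx0 : (((‖x‖ ^ 2 : ℝ) : ℂ)) ≠ 0 := by
      have : ‖x‖ ≠ 0 := by simpa using hx
      exact_mod_cast pow_ne_zero 2 this
    have ha : alphaConst (((6 : ℕ) : ℝ) - 2) = 2 := by
      rw [alphaConst]
      have : ((((6 : ℕ) : ℝ) - 2 - 4) / (3 * (((6 : ℕ) : ℝ) - 2 - 2)) : ℝ) = 0 := by norm_num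
      rw [this]; norm_num
    have hb : betaConst (((6 : ℕ) : ℝ) - 2) = 0 := by
      rw [betaConst]
      have : (3 * (((6 : ℕ) : ℝ) - 2 - 2) * (((6 : ℕ) : ℝ) - 2 - 4) : ℝ) = 0 := by norm_num
      rw [this]; norm_num
    have e : ((‖x‖ ^ 2 : ℝ) : ℂ) * (2 / (((‖x‖ ^ 2 : ℝ) : ℂ) + 0)) = 2 := by
      rw [add_zero, mul_div_cancel₀ _ hx0]
    rw [scalarN, profile, ha, hb]
    linear_combination -3 * (((6 : ℕ) : ℂ) - 4) * z ^ 2 * e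
  · have hd : ((n : ℝ) - 2) = 3 ∨ 4 < (n : ℝ) - 2 := by
      rcases hn.eq_or_lt with rfl | h
      · left; norm_num
      · right
        have : 7 ≤ n := by omega
        have : (7 : ℝ) ≤ n := by exact_mod_cast this
        linarith
    obtain ⟨w, h1, h2⟩ := exists_rotation_beta hd
    refine ⟨3, 3 * alphaConst ((n : ℝ) - 2), _, w, by simp, h1, h2, fun x _ z => ?_⟩
    rw [scalarN, profile]
    ring

lemma norm_sq_add_ne_zero {n : ℕ} {w β : ℂ} (hw : 0 < w.re) (hwβ : 0 < (w * β).re) (x : Rn n) :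
    ((‖x‖ ^ 2 : ℝ) : ℂ) + β ≠ 0 := by
  intro h
  have : (w * (((‖x‖ ^ 2 : ℝ) : ℂ) + β)).re = ‖x‖ ^ 2 * w.re + (w * β).re := by
    rw [mul_add, Complex.add_re, mul_comm w, Complex.re_ofReal_mul]
  rw [h] at this
  simp only [mul_zero, Complex.zero_re] at this
  have : 0 ≤ ‖x‖ ^ 2 * w.re := by positivity
  linarith

lemma contDiff_norm_sq_ofReal {n : ℕ} : ContDiff ℝ ∞ fun x : Rn n => ((‖x‖ ^ 2 : ℝ) : ℂ) :=
  Complex.ofRealCLM.contDiff.comp (contDiff_norm_sq ℝ)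

/-- The product of a test function and a smooth radial function. -/
def mulTest {n : ℕ} (a : Rn n → ℂ) (ha : ContDiff ℝ ∞ a) (har : ∀ x y, ‖x‖ = ‖y‖ → a x = a y)
    (u : RadialTest n) : RadialTest n :=
  ⟨fun x => a x * u.1 x, ha.mul u.2.1, u.2.2.1.mul_left,
    fun x y h => by simp only [har x y h, u.2.2.2 x y h]⟩

/-- The product of two test functions. -/
def prodTest {n : ℕ} (u v : RadialTest n) : RadialTest n := mulTest u.1 u.2.1 u.2.2.2 v

/-- `|x|² u`. -/
def sqTest {n : ℕ} (u : RadialTest n) : RadialTest n :=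
  mulTest (fun x => ((‖x‖ ^ 2 : ℝ) : ℂ)) contDiff_norm_sq_ofReal (fun x y h => by rw [h]) u

/-- `|x|² u / (|x|² + β)`. -/
def potTest {n : ℕ} (β : ℂ) (hβ : ∀ x : Rn n, ((‖x‖ ^ 2 : ℝ) : ℂ) + β ≠ 0) (u : RadialTest n) :
    RadialTest n :=
  mulTest (fun x => ((‖x‖ ^ 2 : ℝ) : ℂ) * (1 / (((‖x‖ ^ 2 : ℝ) : ℂ) + β)))
    (by simp only [one_div]
        exact contDiff_norm_sq_ofReal.mul ((contDiff_norm_sq_ofReal.add contDiff_const).inv hβ))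
    (fun x y h => by rw [h]) u

/-! ### Scaling and interpolation of weighted norms -/

section Scaling

variable {E : Type*} [NormedAddCommGroup E] [InnerProductSpace ℝ E] [FiniteDimensional ℝ E]
  [MeasurableSpace E] [BorelSpace E]

lemma lintegral_comp_smul (f : E → ℝ≥0∞) (hf : Measurable f) {r : ℝ} (hr : 0 < r) :
    ∫⁻ x, f (r • x) = ENNReal.ofReal (r ^ (-(finrank ℝ E : ℝ))) * ∫⁻ x, f x := by
  rw [← lintegral_map hf (measurable_const_smul r), Measure.map_addHaar_smul volume hr.ne',
    lintegral_smul_measure, abs_of_pos (by positivity), Real.rpow_neg hr.le, Real.rpow_natCast,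
    smul_eq_mul]

lemma wNorm_comp_smul (s : ℝ) {G : E → ℝ≥0∞} (hG : Measurable G) {r : ℝ}
    (hr : 0 < r) : wNorm s (fun ξ => G (r • ξ)) =
      ENNReal.ofReal (r ^ (-s - (finrank ℝ E : ℝ) / 2)) * wNorm s G := by
  have : wNorm s (fun ξ => G (r • ξ)) ^ 2 =
      (ENNReal.ofReal (r ^ (-s - (finrank ℝ E : ℝ) / 2)) * wNorm s G) ^ 2 := by
    have h1 : ∀ ξ : E, (‖ξ‖ₑ ^ s * G (r • ξ)) ^ 2 =
        ENNReal.ofReal (r ^ (-2 * s)) * (‖r • ξ‖ₑ ^ s * G (r • ξ)) ^ 2 := by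
      intro ξ
      have h2 : ENNReal.ofReal (r ^ (-2 * s)) * (ENNReal.ofReal r ^ s) ^ 2 = 1 := by
        rw [ENNReal.ofReal_rpow_of_pos hr, ← ENNReal.ofReal_pow (by positivity),
          ← ENNReal.ofReal_mul (by positivity), ← Real.rpow_natCast, ← Real.rpow_mul hr.le,
          ← Real.rpow_add hr]
        have : -2 * s + s * (2 : ℕ) = 0 := by push_cast; ring
        rw [this]; simp
      have h3 : ‖r • ξ‖ₑ ^ s = ENNReal.ofReal r ^ s * ‖ξ‖ₑ ^ s := by
        rw [enorm_smul, Real.enorm_of_nonneg hr.le,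
          ENNReal.mul_rpow_of_ne_top ENNReal.ofReal_ne_top enorm_ne_top]
      rw [h3]
      calc _ = 1 * (‖ξ‖ₑ ^ s * G (r • ξ)) ^ 2 := by rw [one_mul]
        _ = _ := by rw [← h2]; ring
    rw [wNorm_sq, mul_pow, wNorm_sq, lintegral_congr h1,
      lintegral_const_mul _ (by fun_prop),
      lintegral_comp_smul (fun ξ => (‖ξ‖ₑ ^ s * G ξ) ^ 2) (by fun_prop) hr, ← mul_assoc,
      ← ENNReal.ofReal_mul (by positivity), ← ENNReal.ofReal_pow (by positivity),
      ← Real.rpow_add hr, ← Real.rpow_natCast, ← Real.rpow_mul hr.le]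
    congr 3
    push_cast; ring
  exact (ENNReal.pow_right_strictMono two_ne_zero).injective this

/-- Pointwise, |ξ|^t is at most |ξ|^s where |ξ| ≤ 1 and at most |ξ|^r elsewhere. Thus every index
between s₁ and s₂ is controlled by the two endpoints. -/
lemma wNorm_le_add {s t r : ℝ} (h1 : s ≤ t) (h2 : t ≤ r) {G : E → ℝ≥0∞}
    (hG : Measurable G) : wNorm t G ≤ wNorm s G + wNorm r G := by
  have hle : ∀ ξ : E, ‖ξ‖ₑ ^ t * G ξ ≤ ‖ξ‖ₑ ^ s * G ξ + ‖ξ‖ₑ ^ r * G ξ := by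
    intro ξ
    rw [← add_mul]
    gcongr
    rcases le_total ‖ξ‖ₑ 1 with h | h
    · exact (ENNReal.rpow_le_rpow_of_exponent_ge h h1).trans le_self_add
    · exact (ENNReal.rpow_le_rpow_of_exponent_le h h2).trans le_add_self
  calc wNorm t G ≤ eLpNorm (fun ξ => ‖ξ‖ₑ ^ s * G ξ + ‖ξ‖ₑ ^ r * G ξ) 2 volume :=
        eLpNorm_mono_enorm fun ξ => by simpa only [enorm_eq_self] using hle ξ
    _ ≤ _ := eLpNorm_add_le (f := fun ξ => ‖ξ‖ₑ ^ s * G ξ) (g := fun ξ => ‖ξ‖ₑ ^ r * G ξ)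
        (Measurable.aestronglyMeasurable (by fun_prop))
        (Measurable.aestronglyMeasurable (by fun_prop)) (by norm_num)

end Scaling

/-! ### Comparison of the Sobolev norms of test functions -/

/-- The homogeneous Sobolev norm computed with the unitary-frequency Fourier transform. -/
def sobNorm {n : ℕ} (s : ℝ) (u : Rn n → ℂ) : ℝ≥0∞ := wNorm s fun ξ => ‖𝓕 u ξ‖ₑ

lemma fourierT_eq {n : ℕ} (u : Rn n → ℂ) (ξ : Rn n) :
    fourierT u ξ = (((2 * Real.pi) ^ (-(n : ℝ) / 2) : ℝ) : ℂ) * 𝓕 u ((2 * Real.pi)⁻¹ • ξ) := by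
  rw [Real.fourier_eq', fourierT]
  congr 1
  refine integral_congr_ae (Eventually.of_forall fun x => ?_)
  simp only [smul_eq_mul]
  congr 2
  rw [real_inner_smul_right, real_inner_comm ξ x]
  have : (Real.pi : ℂ) ≠ 0 := by exact_mod_cast Real.pi_ne_zero
  push_cast
  field_simp

/-- The two Fourier conventions differ by the dilation ξ ↦ ξ/2π and a normalizing constant; under
the weight |ξ|^s these combine to (2π)^s. -/
lemma ofReal_homInner {n : ℕ} {s : ℝ} (hs : 0 ≤ s) (u : RadialTest n) :
    ENNReal.ofReal (homInner s u.1 u.1).re =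
      (ENNReal.ofReal ((2 * Real.pi) ^ s) * sobNorm s u.1) ^ 2 := by
  have h2pi : 0 < 2 * Real.pi := by positivity
  have e1 : homInner s u.1 u.1 =
      ((∫ ξ, ‖((‖ξ‖ ^ s : ℝ) : ℂ) * fourierT u.1 ξ‖ ^ 2 : ℝ) : ℂ) := by
    rw [homInner, ← integral_complex_ofReal]
    refine integral_congr_ae (Eventually.of_forall fun x => ?_)
    simp only [Complex.conj_mul']
    push_cast
    rfl
  have hint : Integrable fun ξ => ‖((‖ξ‖ ^ s : ℝ) : ℂ) * fourierT u.1 ξ‖ ^ 2 := by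
    refine (integrable_homInner hs u u).norm.congr (Eventually.of_forall fun ξ => ?_)
    simp only [norm_mul, RCLike.norm_conj]; ring
  rw [e1, Complex.ofReal_re, ofReal_integral_eq_lintegral_ofReal hint
    (Eventually.of_forall fun ξ => by positivity)]
  have hm := measurable_enorm_fourier u
  have e2 : ∀ ξ : Rn n, ENNReal.ofReal (‖((‖ξ‖ ^ s : ℝ) : ℂ) * fourierT u.1 ξ‖ ^ 2) =
      ENNReal.ofReal ((2 * Real.pi) ^ (-(n : ℝ) / 2)) ^ 2 *
        (‖ξ‖ₑ ^ s * ‖𝓕 u.1 ((2 * Real.pi)⁻¹ • ξ)‖ₑ) ^ 2 := by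
    intro ξ
    rw [ENNReal.ofReal_pow (norm_nonneg _), ofReal_norm, fourierT_eq, enorm_mul, enorm_mul]
    have a1 : ‖((‖ξ‖ ^ s : ℝ) : ℂ)‖ₑ = ‖ξ‖ₑ ^ s := by
      rw [← ofReal_norm, Complex.norm_real, Real.norm_of_nonneg (by positivity),
        ← ENNReal.ofReal_rpow_of_nonneg (norm_nonneg _) hs, ofReal_norm]
    have a2 : ‖(((2 * Real.pi) ^ (-(n : ℝ) / 2) : ℝ) : ℂ)‖ₑ =
        ENNReal.ofReal ((2 * Real.pi) ^ (-(n : ℝ) / 2)) := by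
      rw [← ofReal_norm, Complex.norm_real, Real.norm_of_nonneg (by positivity)]
    rw [a1, a2]; ring
  have hmc : Measurable fun ξ : Rn n => ‖𝓕 u.1 ((2 * Real.pi)⁻¹ • ξ)‖ₑ :=
    hm.comp (measurable_const_smul _)
  rw [lintegral_congr e2, lintegral_const_mul _ (by fun_prop), ← wNorm_sq,
    wNorm_comp_smul s hm (inv_pos.2 h2pi), ← mul_pow, ← mul_assoc,
    ← ENNReal.ofReal_mul (by positivity), sobNorm]
  congr 3
  rw [Real.inv_rpow h2pi.le, ← Real.rpow_neg h2pi.le, ← Real.rpow_add h2pi]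
  simp only [finrank_euclideanSpace, Fintype.card_fin]
  ring_nf

lemma sobNorm_ne_top {n : ℕ} {s : ℝ} (hs : 0 ≤ s) (u : RadialTest n) : sobNorm s u.1 ≠ ⊤ := by
  intro h
  have := ofReal_homInner hs u
  rw [h, ENNReal.mul_top (by simpa using Real.rpow_pos_of_pos (by positivity) s)] at this
  simp at this

lemma enorm_testPair_sq {n : ℕ} {e : Exponents} (φ : TestPair n e) :
    ‖φ‖ₑ ^ 2 = ENNReal.ofReal (capInner e.s₁ e.s₂ φ.fst φ.fst).re +
      ENNReal.ofReal (capInner (e.s₁ - 1) (e.s₂ - 1) φ.snd φ.snd).re := by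
  have h1 : ‖φ‖ ^ 2 = (pairInner φ φ).re := @norm_sq_eq_re_inner ℂ _ _ _ _ φ
  rw [← ofReal_norm, ← ENNReal.ofReal_pow (norm_nonneg _), h1, pairInner, Complex.add_re,
    ENNReal.ofReal_add (capInner_nonneg _ _ _) (capInner_nonneg _ _ _)]

/-- The norm of `Ḣ^{s₁} ∩ Ḣ^{s₂}` up to equivalence. -/
def capNorm {n : ℕ} (s₁ s₂ : ℝ) (u : Rn n → ℂ) : ℝ≥0∞ := sobNorm s₁ u + sobNorm s₂ u

/-- The auxiliary norm always adds both endpoints, so for s₁ = s₂ it counts the same norm twice. The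
factor 4 covers this case as well as (x+y)² ≤ 4(x²+y²). -/
lemma ofReal_capInner {n : ℕ} {s₁ s₂ : ℝ} (h1 : 0 ≤ s₁) (h2 : s₁ ≤ s₂) (u : RadialTest n) :
    capNorm s₁ s₂ u.1 ^ 2 ≤ 4 * ENNReal.ofReal (capInner s₁ s₂ u.1 u.1).re ∧
    ENNReal.ofReal (capInner s₁ s₂ u.1 u.1).re ≤
      (ENNReal.ofReal ((2 * Real.pi) ^ s₂) * capNorm s₁ s₂ u.1) ^ 2 := by
  have hpi : 1 ≤ 2 * Real.pi := by have := Real.pi_gt_three; linarith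
  have hc : ENNReal.ofReal ((2 * Real.pi) ^ s₁) ≤ ENNReal.ofReal ((2 * Real.pi) ^ s₂) :=
    ENNReal.ofReal_le_ofReal (Real.rpow_le_rpow_of_exponent_le hpi h2)
  have low : ∀ s, 0 ≤ s → sobNorm s u.1 ^ 2 ≤ ENNReal.ofReal (homInner s u.1 u.1).re := by
    intro s hs
    rw [ofReal_homInner hs]
    gcongr
    have : 1 ≤ ENNReal.ofReal ((2 * Real.pi) ^ s) := by
      rw [← ENNReal.ofReal_one]
      exact ENNReal.ofReal_le_ofReal (Real.one_le_rpow hpi hs)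
    calc _ = 1 * sobNorm s u.1 := (one_mul _).symm
      _ ≤ _ := by gcongr
  have l1 := low s₁ h1
  have l2 := low s₂ (h1.trans h2)
  have hsq : ∀ a b : ℝ≥0∞, (a + b) ^ 2 ≤ 4 * (a ^ 2 + b ^ 2) := by
    intro a b
    have : a + b ≤ 2 * max a b := by
      rw [two_mul]; exact add_le_add (le_max_left _ _) (le_max_right _ _)
    calc (a + b) ^ 2 ≤ (2 * max a b) ^ 2 := by gcongr
      _ = 4 * (max a b) ^ 2 := by ring
      _ ≤ _ := by
        gcongr
        rcases max_choice a b with h | h <;> rw [h]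
        · exact le_self_add
        · exact le_add_self
  unfold capInner
  split_ifs with h
  · rw [Complex.add_re, ENNReal.ofReal_add (homInner_nonneg _ _) (homInner_nonneg _ _)]
    refine ⟨(hsq _ _).trans (by gcongr), ?_⟩
    rw [ofReal_homInner h1, ofReal_homInner (h1.trans h2), capNorm, mul_add, add_sq']
    refine le_trans ?_ le_self_add
    gcongr
  · have he : s₂ = s₁ := by linarith
    rw [add_zero, capNorm, he]
    refine ⟨?_, ?_⟩
    · calc _ = 4 * sobNorm s₁ u.1 ^ 2 := by ring
        _ ≤ _ := by gcongr
    · rw [ofReal_homInner h1]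
      gcongr
      exact le_self_add

lemma capNorm_fst_le {n : ℕ} {e : Exponents} (φ : TestPair n e) :
    capNorm e.s₁ e.s₂ φ.fst ≤ 2 * ‖φ‖ₑ := by
  have h1 := e.one_le
  have := (ofReal_capInner (by linarith) e.le (Prod.fst φ)).1
  refine (ENNReal.pow_le_pow_left_iff two_ne_zero).1 ?_
  refine this.trans ?_
  rw [mul_pow, enorm_testPair_sq]
  norm_num
  gcongr
  exact le_self_add

lemma capNorm_snd_le {n : ℕ} {e : Exponents} (φ : TestPair n e) :
    capNorm (e.s₁ - 1) (e.s₂ - 1) φ.snd ≤ 2 * ‖φ‖ₑ := by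
  have h1 := e.one_le
  have h2 := e.le
  have := (ofReal_capInner (s₁ := e.s₁ - 1) (s₂ := e.s₂ - 1) (by linarith) (by linarith)
    (Prod.snd φ)).1
  refine (ENNReal.pow_le_pow_left_iff two_ne_zero).1 ?_
  refine this.trans ?_
  rw [mul_pow, enorm_testPair_sq]
  norm_num
  gcongr
  exact le_add_self

lemma enorm_testPair_le {n : ℕ} {e : Exponents} (φ : TestPair n e) :
    ‖φ‖ₑ ≤ ENNReal.ofReal ((2 * Real.pi) ^ e.s₂) *
      (capNorm e.s₁ e.s₂ φ.fst + capNorm (e.s₁ - 1) (e.s₂ - 1) φ.snd) := by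
  have h1 := e.one_le
  have h2 := e.le
  have hpi : 1 ≤ 2 * Real.pi := by have := Real.pi_gt_three; linarith
  have i1 := (ofReal_capInner (by linarith) e.le (Prod.fst φ)).2
  have i2 := (ofReal_capInner (s₁ := e.s₁ - 1) (s₂ := e.s₂ - 1) (by linarith) (by linarith)
    (Prod.snd φ)).2
  refine (ENNReal.pow_le_pow_left_iff two_ne_zero).1 ?_
  rw [enorm_testPair_sq]
  refine (add_le_add i1 i2).trans ?_
  rw [mul_add, add_sq']
  refine le_trans ?_ le_self_add
  have : ENNReal.ofReal ((2 * Real.pi) ^ (e.s₂ - 1)) ≤ ENNReal.ofReal ((2 * Real.pi) ^ e.s₂) :=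
    ENNReal.ofReal_le_ofReal (Real.rpow_le_rpow_of_exponent_le hpi (by linarith))
  unfold TestPair.fst TestPair.snd
  gcongr

lemma sobNorm_le_capNorm {n : ℕ} {s₁ s₂ s : ℝ} (h1 : s₁ ≤ s) (h2 : s ≤ s₂)
    (u : RadialTest n) : sobNorm s u.1 ≤ capNorm s₁ s₂ u.1 :=
  wNorm_le_add h1 h2 (measurable_enorm_fourier u)

/-! ### Moser-type estimates -/

section Weighted

variable {E : Type*} [NormedAddCommGroup E] [InnerProductSpace ℝ E] [FiniteDimensional ℝ E]
  [MeasurableSpace E] [BorelSpace E]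

/-- A weight exponent allowed for a factor in the convolution estimates. -/
def Subcritical (m a : ℝ) : Prop := 0 ≤ a ∧ 2 * a < m

/-- After distributing |ξ|^k, the factor that receives it is always placed in the space of index a,
so the unweighted estimate is used once in each order. -/
theorem wNorm_lconvolution_weighted [Nontrivial E] {k a b : ℝ} (hk : 0 ≤ k)
    (ha : Subcritical (finrank ℝ E) a) (hb : Subcritical (finrank ℝ E) b)
    (hab : (finrank ℝ E : ℝ) / 2 = a + b) :
    ∃ C : ℝ≥0∞, C ≠ ⊤ ∧ ∀ A B : E → ℝ≥0∞, Measurable A → Measurable B →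
      wNorm k (A ⋆ₗ B) ≤ C * (wNorm (a + k) A * wNorm b B + wNorm b A * wNorm (a + k) B) := by
  obtain ⟨C₁, hC₁, h₁⟩ := wNorm_lconvolution_le (E := E) ha.1 ha.2 hb.1 hb.2 hab
  obtain ⟨C₂, hC₂, h₂⟩ := wNorm_lconvolution_le (E := E) hb.1 hb.2 ha.1 ha.2 (by linarith)
  have h2k : (2 : ℝ≥0∞) ^ k ≠ ⊤ := ENNReal.rpow_ne_top_of_nonneg hk (by norm_num)
  refine ⟨2 ^ k * (C₁ + C₂), ENNReal.mul_ne_top h2k (by simp [hC₁, hC₂]), fun A B hA hB => ?_⟩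
  refine (wNorm_lconvolution_split hk hA hB).trans ?_
  rw [mul_assoc]
  gcongr
  have i1 := h₁ _ _ (measurable_pw k hA) hB
  have i2 := h₂ _ _ hA (measurable_pw k hB)
  rw [wNorm_pw ha.1 hk] at i1 i2
  calc _ ≤ C₁ * (wNorm (a + k) A * wNorm b B) + C₂ * (wNorm b A * wNorm (a + k) B) :=
        add_le_add i1 i2
    _ ≤ (C₁ + C₂) * (wNorm (a + k) A * wNorm b B) +
        (C₁ + C₂) * (wNorm b A * wNorm (a + k) B) := by
        gcongr
        · exact le_self_add
        · exact le_add_self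
    _ = _ := by rw [mul_add]

/-- The indices may depend on which factor carries |ξ|^k. A separate triple when it falls on the
first factor is essential later, when that factor is a fixed potential with few finite norms. -/
theorem wNorm_lconvolution₃_weighted [Nontrivial E] {k a₁ b₁ c₁ a b : ℝ} (hk : 0 ≤ k)
    (ha₁ : Subcritical (finrank ℝ E) a₁) (hb₁ : Subcritical (finrank ℝ E) b₁)
    (hc₁ : Subcritical (finrank ℝ E) c₁) (h1 : (finrank ℝ E : ℝ) = a₁ + b₁ + c₁)
    (ha : Subcritical (finrank ℝ E) a) (hb : Subcritical (finrank ℝ E) b)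
    (hab : (finrank ℝ E : ℝ) = a + b + a) :
    ∃ C : ℝ≥0∞, C ≠ ⊤ ∧ ∀ A B D : E → ℝ≥0∞, Measurable A → Measurable B → Measurable D →
      wNorm k (A ⋆ₗ (B ⋆ₗ D)) ≤ C * (wNorm (a₁ + k) A * wNorm b₁ B * wNorm c₁ D +
        (wNorm a A * wNorm (b + k) B * wNorm a D + wNorm a A * wNorm a B * wNorm (b + k) D)) := by
  obtain ⟨C₁, hC₁, h₁⟩ :=
    wNorm_lconvolution₃_le (E := E) ha₁.1 ha₁.2 hb₁.1 hb₁.2 hc₁.1 hc₁.2 h1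
  obtain ⟨C₂, hC₂, h₂⟩ := wNorm_lconvolution₃_le (E := E) ha.1 ha.2 hb.1 hb.2 ha.1 ha.2 hab
  obtain ⟨C₃, hC₃, h₃⟩ := wNorm_lconvolution₃_le (E := E) ha.1 ha.2 ha.1 ha.2 hb.1 hb.2
    (by linarith)
  have h2k : (2 : ℝ≥0∞) ^ k ≠ ⊤ := ENNReal.rpow_ne_top_of_nonneg hk (by norm_num)
  refine ⟨2 ^ k * (C₁ + 2 ^ k * (C₂ + C₃)), by
    refine ENNReal.mul_ne_top h2k (ENNReal.add_ne_top.2 ⟨hC₁, ENNReal.mul_ne_top h2k ?_⟩)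
    exact ENNReal.add_ne_top.2 ⟨hC₂, hC₃⟩, fun A B D hA hB hD => ?_⟩
  refine (wNorm_lconvolution₃_split hk hA hB hD).trans ?_
  have i1 := h₁ _ _ _ (measurable_pw k hA) hB hD
  have i2 := h₂ _ _ _ hA (measurable_pw k hB) hD
  have i3 := h₃ _ _ _ hA hB (measurable_pw k hD)
  rw [wNorm_pw ha₁.1 hk] at i1
  rw [wNorm_pw hb.1 hk] at i2 i3
  set X := wNorm (a₁ + k) A * wNorm b₁ B * wNorm c₁ D
  set Y := wNorm a A * wNorm (b + k) B * wNorm a D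
  set Z := wNorm a A * wNorm a B * wNorm (b + k) D
  rw [mul_assoc]
  gcongr
  calc _ ≤ C₁ * X + 2 ^ k * (C₂ * Y + C₃ * Z) := by gcongr
    _ ≤ C₁ * X + 2 ^ k * ((C₂ + C₃) * Y + (C₂ + C₃) * Z) := by
        gcongr
        · exact le_self_add
        · exact le_add_self
    _ = C₁ * X + 2 ^ k * (C₂ + C₃) * (Y + Z) := by ring
    _ ≤ (C₁ + 2 ^ k * (C₂ + C₃)) * X + (C₁ + 2 ^ k * (C₂ + C₃)) * (Y + Z) := by
        gcongr
        · exact le_self_add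
        · exact le_add_self
    _ = _ := by ring

end Weighted

lemma nontrivial_Rn {n : ℕ} (hn : 0 < n) : Nontrivial (Rn n) := by
  have : Nonempty (Fin n) := ⟨⟨0, hn⟩⟩
  infer_instance

/-- Moser-type estimate for a product. -/
theorem exists_sobNorm_prodTest_le {n : ℕ} (hn : 3 ≤ n) {k : ℝ} (hk : 0 ≤ k) :
    ∃ C : ℝ≥0∞, C ≠ ⊤ ∧ ∀ u v : RadialTest n, sobNorm k (prodTest u v).1 ≤
      C * (sobNorm (k + 1) u.1 * sobNorm ((n : ℝ) / 2 - 1) v.1 +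
        sobNorm ((n : ℝ) / 2 - 1) u.1 * sobNorm (k + 1) v.1) := by
  have := nontrivial_Rn (n := n) (by omega)
  have hn' : (3 : ℝ) ≤ n := by exact_mod_cast hn
  have hfr : (finrank ℝ (Rn n) : ℝ) = n := by simp
  -- Index 1 is forced by the target: the nonlinearity gains one derivative, so a factor with k + 1
  -- derivatives must yield k.
  obtain ⟨C, hC, h⟩ := wNorm_lconvolution_weighted (E := Rn n) (a := 1) (b := (n : ℝ) / 2 - 1) hk
    ⟨by norm_num, by rw [hfr]; linarith⟩ ⟨by linarith, by rw [hfr]; linarith⟩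
    (by rw [hfr]; ring)
  refine ⟨C, hC, fun u v => ?_⟩
  have h1 : sobNorm k (prodTest u v).1 ≤
      wNorm k ((fun η => ‖𝓕 u.1 η‖ₑ) ⋆ₗ fun η => ‖𝓕 v.1 η‖ₑ) :=
    wNorm_mono fun ξ => enorm_fourier_test_mul_le u v _ (fun x => rfl) ξ
  refine h1.trans ((h _ _ (measurable_enorm_fourier u) (measurable_enorm_fourier v)).trans ?_)
  rw [add_comm 1 k]
  rfl

section Shifted

variable {d : ℕ}

/-- Estimate for `|x|² a v w` in terms of weighted norms of a Fourier majorant of `a`. -/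
theorem exists_sobNorm_majorant_le (hd : 3 ≤ d) {k k₁ : ℝ} (hk : 0 ≤ k) (hk₁ : 0 ≤ k₁)
    (hk₁' : k₁ + 1 ≤ ((d : ℝ) - 1) / 2) (ι : Rn d →ₗᵢ[ℝ] Rn (d + 2)) :
    ∃ C : ℝ≥0∞, C ≠ ⊤ ∧ ∀ (a : Rn (d + 2) → ℂ) (H : Rn d → ℝ≥0∞), Measurable H →
      FourierMajorant ι a H → ∀ v w W : RadialTest (d + 2),
      (∀ x, W.1 x = ((‖x‖ ^ 2 : ℝ) : ℂ) * a x * v.1 x * w.1 x) →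
      sobNorm k W.1 ≤
        C * (wNorm (((d : ℝ) - 1) / 2 - k₁ + k) H * sobNorm (k₁ + 1) v.1 *
            sobNorm (((d : ℝ) - 1) / 2) w.1 +
          (wNorm (((d : ℝ) - 1) / 2) H * sobNorm (1 + k) v.1 * sobNorm (((d : ℝ) - 1) / 2) w.1 +
          wNorm (((d : ℝ) - 1) / 2) H * sobNorm (((d : ℝ) - 1) / 2) v.1 * sobNorm (1 + k) w.1)) := by
  have := nontrivial_Rn (n := d) (by omega)
  have hd' : (3 : ℝ) ≤ d := by exact_mod_cast hd
  have hfr : (finrank ℝ (Rn d) : ℝ) = d := by simp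
  -- The indices (d−1)/2, 1, (d−1)/2 add up to d; k₁ moves regularity from the first factor to the
  -- second when the first carries the extra weight.
  obtain ⟨C, hC, h⟩ := wNorm_lconvolution₃_weighted (E := Rn d) (a₁ := ((d : ℝ) - 1) / 2 - k₁)
    (b₁ := k₁ + 1) (c₁ := ((d : ℝ) - 1) / 2) (a := ((d : ℝ) - 1) / 2) (b := 1) hk
    ⟨by linarith, by rw [hfr]; linarith⟩ ⟨by linarith, by rw [hfr]; linarith⟩
    ⟨by linarith, by rw [hfr]; linarith⟩ (by rw [hfr]; ring)
    ⟨by linarith, by rw [hfr]; linarith⟩ ⟨by linarith, by rw [hfr]; linarith⟩ (by rw [hfr]; ring)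
  obtain ⟨κ, hκ0, hκ, hκe⟩ := exists_wNorm_fourier_eq (d := d) (by omega) ι
  have hinv : ∀ s : ℝ, 0 ≤ s → ∀ u : RadialTest (d + 2),
      wNorm s (shiftMaj ι u.1) = κ⁻¹ * sobNorm s u.1 := by
    intro s hs u
    rw [sobNorm, hκe s hs u, ← mul_assoc, ENNReal.inv_mul_cancel hκ0 hκ, one_mul]
  refine ⟨κ * d ^ 2 * C * κ⁻¹ * κ⁻¹, by finiteness, fun a H hH ha v w W hW => ?_⟩
  have hv := measurable_shiftMaj ι v
  have hw := measurable_shiftMaj ι w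
  have h1 := h H _ _ hH hv hw
  rw [hinv _ (by linarith), hinv _ (by linarith), hinv _ (by linarith), hinv _ (by linarith),
    hinv _ (by linarith)] at h1
  calc sobNorm k W.1 = κ * wNorm k (shiftMaj ι W.1) := hκe k hk W
    _ ≤ κ * wNorm k (fun ξ => (d : ℝ≥0∞) ^ 2 *
          (H ⋆ₗ (shiftMaj ι v.1 ⋆ₗ shiftMaj ι w.1)) ξ) := by
        gcongr
        exact wNorm_mono (shiftMaj_le_lconvolution ι ha v w W hW)
    _ = κ * (d ^ 2 * wNorm k (H ⋆ₗ (shiftMaj ι v.1 ⋆ₗ shiftMaj ι w.1))) := by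
        rw [wNorm_const_mul]
        exact measurable_lconvolution volume hH (measurable_lconvolution volume hv hw)
    _ ≤ _ := by
        refine (mul_le_mul_right (mul_le_mul_right h1 _) _).trans (le_of_eq ?_)
        ring

end Shifted

/-! ### The nonlinearity on test functions -/

section

variable {n : ℕ}

lemma fourier_test_add (u v : RadialTest n) (ξ : Rn n) :
    𝓕 (u + v).1 ξ = 𝓕 u.1 ξ + 𝓕 v.1 ξ := by
  have h1 := (Real.fourierIntegral_convergent_iff ξ).2 (integrable_test u)
  have h2 := (Real.fourierIntegral_convergent_iff ξ).2 (integrable_test v)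
  rw [Real.fourier_eq, Real.fourier_eq, Real.fourier_eq, ← integral_add h1 h2]
  refine integral_congr_ae (Eventually.of_forall fun x => ?_)
  exact smul_add _ _ _

lemma fourier_test_smul (c : ℂ) (u : RadialTest n) (ξ : Rn n) :
    𝓕 (c • u).1 ξ = c * 𝓕 u.1 ξ := by
  rw [Real.fourier_eq, Real.fourier_eq, ← integral_const_mul]
  refine integral_congr_ae (Eventually.of_forall fun x => ?_)
  simp only [Submodule.coe_smul, Pi.smul_apply, smul_eq_mul, Circle.smul_def]
  ring

lemma sobNorm_add_le (s : ℝ) (u v : RadialTest n) :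
    sobNorm s (u + v).1 ≤ sobNorm s u.1 + sobNorm s v.1 := by
  refine (wNorm_mono fun ξ => ?_).trans
    (wNorm_add_le (measurable_enorm_fourier u) (measurable_enorm_fourier v))
  rw [fourier_test_add]
  exact enorm_add_le _ _

lemma sobNorm_smul (s : ℝ) (c : ℂ) (u : RadialTest n) :
    sobNorm s (c • u).1 = ‖c‖ₑ * sobNorm s u.1 := by
  rw [sobNorm, sobNorm, ← wNorm_const_mul _ (measurable_enorm_fourier u)]
  congr 1
  funext ξ
  rw [fourier_test_smul, enorm_mul]

lemma capNorm_add_le (s t : ℝ) (u v : RadialTest n) :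
    capNorm s t (u + v).1 ≤ capNorm s t u.1 + capNorm s t v.1 := by
  unfold capNorm
  calc _ ≤ sobNorm s u.1 + sobNorm s v.1 + (sobNorm t u.1 + sobNorm t v.1) :=
        add_le_add (sobNorm_add_le s u v) (sobNorm_add_le t u v)
    _ = _ := by ring

lemma capNorm_smul (s t : ℝ) (c : ℂ) (u : RadialTest n) :
    capNorm s t (c • u).1 = ‖c‖ₑ * capNorm s t u.1 := by
  unfold capNorm
  rw [sobNorm_smul, sobNorm_smul, mul_add]

lemma capNorm_sub_le (s t : ℝ) (u v : RadialTest n) :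
    capNorm s t (u - v).1 ≤ capNorm s t u.1 + capNorm s t v.1 := by
  have h := capNorm_add_le s t u ((-1 : ℂ) • v)
  rw [capNorm_smul, enorm_neg, enorm_one, one_mul] at h
  have e : u - v = u + (-1 : ℂ) • v := (sub_eq_add_neg u v).trans (congrArg (u + ·) (neg_one_smul ℂ v).symm)
  rwa [e]

lemma capNorm_ne_top {s t : ℝ} (hs : 0 ≤ s) (ht : 0 ≤ t) (u : RadialTest n) :
    capNorm s t u.1 ≠ ⊤ :=
  ENNReal.add_ne_top.2 ⟨sobNorm_ne_top hs u, sobNorm_ne_top ht u⟩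

/-- `𝓗^{s₁,s₂}` is contained in the space with the optimal exponents. -/
def Exponents.Admissible (e : Exponents) (n : ℕ) : Prop :=
  e.s₁ ≤ ((n : ℝ) - 3) / 2 ∧ (n : ℝ) / 2 - 1 ≤ e.s₂

section Estimates

variable {e : Exponents}

/-- It suffices to bound both weights of the target norm. -/
lemma exists_capNorm_le {ι : Type*} {F : ι → RadialTest n} {B : ι → ℝ≥0∞}
    (h : ∀ k ∈ ({e.s₁ - 1, e.s₂ - 1} : Set ℝ), ∃ C : ℝ≥0∞, C ≠ ⊤ ∧
      ∀ i, sobNorm k (F i).1 ≤ C * B i) :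
    ∃ C : ℝ≥0∞, C ≠ ⊤ ∧ ∀ i, capNorm (e.s₁ - 1) (e.s₂ - 1) (F i).1 ≤ C * B i := by
  obtain ⟨C₁, hC₁, h₁⟩ := h (e.s₁ - 1) (by simp)
  obtain ⟨C₂, hC₂, h₂⟩ := h (e.s₂ - 1) (by simp)
  refine ⟨C₁ + C₂, ENNReal.add_ne_top.2 ⟨hC₁, hC₂⟩, fun i => ?_⟩
  rw [add_mul]
  exact add_le_add (h₁ i) (h₂ i)

/-- Both k + 1 and n/2 − 1 lie in [s₁, s₂]; this is where the lower bound on s₂ enters. -/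
theorem exists_capNorm_prodTest_le (hn : 5 ≤ n) (he : e.Admissible n) :
    ∃ C : ℝ≥0∞, C ≠ ⊤ ∧ ∀ p : RadialTest n × RadialTest n,
      capNorm (e.s₁ - 1) (e.s₂ - 1) (prodTest p.1 p.2).1 ≤
        C * (capNorm e.s₁ e.s₂ p.1.1 * capNorm e.s₁ e.s₂ p.2.1) := by
  have h1 := e.one_le
  have h2 := e.le
  have hn' : (5 : ℝ) ≤ n := by exact_mod_cast hn
  obtain ⟨he1, he2⟩ := he
  refine exists_capNorm_le fun k hk => ?_
  have hk : 0 ≤ k ∧ e.s₁ ≤ k + 1 ∧ k + 1 ≤ e.s₂ := by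
    rcases hk with rfl | rfl <;> refine ⟨?_, ?_, ?_⟩ <;> linarith
  obtain ⟨C, hC, h⟩ := exists_sobNorm_prodTest_le (n := n) (by omega) hk.1
  refine ⟨C * 2, ENNReal.mul_ne_top hC (by simp), fun p => (h p.1 p.2).trans ?_⟩
  have a1 := sobNorm_le_capNorm hk.2.1 hk.2.2 p.1
  have a2 := sobNorm_le_capNorm hk.2.1 hk.2.2 p.2
  have b1 := sobNorm_le_capNorm (s₁ := e.s₁) (s := (n : ℝ) / 2 - 1) (by linarith) he2 p.1
  have b2 := sobNorm_le_capNorm (s₁ := e.s₁) (s := (n : ℝ) / 2 - 1) (by linarith) he2 p.2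
  rw [mul_assoc, two_mul]
  gcongr

/-- The potential plays the first factor a in |x|²avw, with its own Fourier majorant; it contributes
only finite constants, so the bound stays bilinear. -/
theorem exists_capNorm_potTest_le (hn : 5 ≤ n) (he : e.Admissible n) {w β : ℂ} (hw : 0 < w.re)
    (hwβ : 0 < (w * β).re) (hβ : ∀ x : Rn n, ((‖x‖ ^ 2 : ℝ) : ℂ) + β ≠ 0) :
    ∃ C : ℝ≥0∞, C ≠ ⊤ ∧ ∀ p : RadialTest n × RadialTest n,
      capNorm (e.s₁ - 1) (e.s₂ - 1) (potTest β hβ (prodTest p.1 p.2)).1 ≤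
        C * (capNorm e.s₁ e.s₂ p.1.1 * capNorm e.s₁ e.s₂ p.2.1) := by
  obtain ⟨d, rfl⟩ : ∃ d, n = d + 2 := ⟨n - 2, by omega⟩
  have h1 := e.one_le
  have h2 := e.le
  have hd : 3 ≤ d := by omega
  have hd' : (3 : ℝ) ≤ d := by exact_mod_cast hd
  obtain ⟨he1, he2⟩ := he
  push_cast at he1 he2
  obtain ⟨ι⟩ := exists_linearIsometry d
  obtain ⟨H, hHm, hH, hHs⟩ := fourierMajorant_resolvent ι hw hwβ
  refine exists_capNorm_le fun k hk => ?_
  have hk : e.s₁ - 1 ≤ k ∧ e.s₁ ≤ 1 + k ∧ 1 + k ≤ e.s₂ := by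
    rcases hk with rfl | rfl <;> refine ⟨?_, ?_, ?_⟩ <;> linarith
  -- This k₁ gives the second factor index s₁, the smallest one controlled, while the potential is
  -- measured at (d−1)/2 + k − (s₁−1). Since k ≥ s₁ − 1, that index is at least (d−1)/2, where its
  -- norm is known to be finite.
  obtain ⟨C, hC, h⟩ := exists_sobNorm_majorant_le (k := k) (k₁ := e.s₁ - 1) hd (by linarith)
    (by linarith) (by linarith) ι
  have f1 := (hHs (((d : ℝ) - 1) / 2 - (e.s₁ - 1) + k) (by linarith) (by linarith)).ne
  have f2 := (hHs (((d : ℝ) - 1) / 2) (by linarith) (by linarith)).ne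
  refine ⟨C * (wNorm (((d : ℝ) - 1) / 2 - (e.s₁ - 1) + k) H +
    (wNorm (((d : ℝ) - 1) / 2) H + wNorm (((d : ℝ) - 1) / 2) H)), by finiteness, fun p =>
    (h _ H hHm hH p.1 p.2 _ fun x => ?_).trans ?_⟩
  · simp only [potTest, prodTest, mulTest]; ring
  have a1 := sobNorm_le_capNorm hk.2.1 hk.2.2 p.1
  have a2 := sobNorm_le_capNorm hk.2.1 hk.2.2 p.2
  have b1 := sobNorm_le_capNorm (s₁ := e.s₁) (s₂ := e.s₂) (s := ((d : ℝ) - 1) / 2) (by linarith)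
    (by linarith) p.1
  have b2 := sobNorm_le_capNorm (s₁ := e.s₁) (s₂ := e.s₂) (s := ((d : ℝ) - 1) / 2) (by linarith)
    (by linarith) p.2
  have c1 := sobNorm_le_capNorm (s₁ := e.s₁) (s₂ := e.s₂) (s := e.s₁ - 1 + 1) (by linarith)
    (by linarith) p.1
  rw [mul_assoc C, add_mul, add_mul]
  simp only [mul_assoc]
  gcongr

/-- The same trilinear estimate with a third test function as a. It uses only the indices k + 1 and
(d−1)/2 = (n−3)/2, both in [s₁, s₂]; here the upper bound on s₁ is needed. -/
theorem exists_capNorm_sqTest_le (hn : 5 ≤ n) (he : e.Admissible n) :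
    ∃ C : ℝ≥0∞, C ≠ ⊤ ∧ ∀ p : RadialTest n × RadialTest n × RadialTest n,
      capNorm (e.s₁ - 1) (e.s₂ - 1) (sqTest (prodTest p.1 (prodTest p.2.1 p.2.2))).1 ≤
        C * (capNorm e.s₁ e.s₂ p.1.1 *
          (capNorm e.s₁ e.s₂ p.2.1.1 * capNorm e.s₁ e.s₂ p.2.2.1)) := by
  obtain ⟨d, rfl⟩ : ∃ d, n = d + 2 := ⟨n - 2, by omega⟩
  have h1 := e.one_le
  have h2 := e.le
  have hd : 3 ≤ d := by omega
  have hd' : (3 : ℝ) ≤ d := by exact_mod_cast hd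
  obtain ⟨he1, he2⟩ := he
  push_cast at he1 he2
  obtain ⟨ι⟩ := exists_linearIsometry d
  obtain ⟨κ, hκ0, hκ, hκe⟩ := exists_wNorm_fourier_eq (d := d) (by omega) ι
  have hinv : ∀ s : ℝ, 0 ≤ s → ∀ u : RadialTest (d + 2),
      wNorm s (shiftMaj ι u.1) = κ⁻¹ * sobNorm s u.1 := by
    intro s hs u
    rw [sobNorm, hκe s hs u, ← mul_assoc, ENNReal.inv_mul_cancel hκ0 hκ, one_mul]
  refine exists_capNorm_le fun k hk => ?_
  have hk : 0 ≤ k ∧ e.s₁ ≤ 1 + k ∧ 1 + k ≤ e.s₂ := by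
    rcases hk with rfl | rfl <;> refine ⟨?_, ?_, ?_⟩ <;> linarith
  -- With this k₁ the estimate is symmetric: one factor has index 1 + k and the other two have
  -- (d−1)/2.
  obtain ⟨C, hC, h⟩ := exists_sobNorm_majorant_le (k := k) (k₁ := ((d : ℝ) - 1) / 2 - 1) hd hk.1
    (by linarith) (by linarith) ι
  have hs1 : ((d : ℝ) - 1) / 2 - (((d : ℝ) - 1) / 2 - 1) + k = 1 + k := by ring
  have hs2 : ((d : ℝ) - 1) / 2 - 1 + 1 = ((d : ℝ) - 1) / 2 := by ring
  rw [hs1, hs2] at h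
  refine ⟨C * (κ⁻¹ * 3), by finiteness, fun p =>
    (h p.1.1 _ (measurable_shiftMaj ι p.1) (fourierMajorant_test ι p.1) p.2.1 p.2.2 _
      fun x => ?_).trans ?_⟩
  · simp only [sqTest, prodTest, mulTest]; ring
  rw [hinv _ (by linarith), hinv _ (by linarith)]
  have a := fun u => sobNorm_le_capNorm hk.2.1 hk.2.2 (n := d + 2) u
  have b := fun u => sobNorm_le_capNorm (s₁ := e.s₁) (s₂ := e.s₂) (s := ((d : ℝ) - 1) / 2)
    (n := d + 2) (by linarith) (by linarith) u
  set X := capNorm e.s₁ e.s₂ p.1.1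
  set Y := capNorm e.s₁ e.s₂ p.2.1.1
  set Z := capNorm e.s₁ e.s₂ p.2.2.1
  calc _ ≤ C * (κ⁻¹ * X * Y * Z + (κ⁻¹ * X * Y * Z + κ⁻¹ * X * Y * Z)) := by
        gcongr
        exacts [a _, b _, b _, b _, a _, b _, b _, b _, a _]
    _ = _ := by ring

end Estimates

/-- The quadratic part of the nonlinearity, polarized. -/
def quadTest (c c' β : ℂ) (hβ : ∀ x : Rn n, ((‖x‖ ^ 2 : ℝ) : ℂ) + β ≠ 0) (u v : RadialTest n) :
    RadialTest n :=
  ((n : ℂ) - 4) • (c • prodTest u v - c' • potTest β hβ (prodTest u v))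

/-- The cubic part of the nonlinearity, polarized. -/
def cubicTest (u v w : RadialTest n) : RadialTest n :=
  ((n : ℂ) - 4) • sqTest (prodTest u (prodTest v w))

lemma quadTest_apply (c c' β : ℂ) (hβ : ∀ x : Rn n, ((‖x‖ ^ 2 : ℝ) : ℂ) + β ≠ 0)
    (u v : RadialTest n) (x : Rn n) : (quadTest c c' β hβ u v).1 x = ((n : ℂ) - 4) *
      (c - c' * (((‖x‖ ^ 2 : ℝ) : ℂ) * (1 / (((‖x‖ ^ 2 : ℝ) : ℂ) + β)))) * (u.1 x * v.1 x) := by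
  change ((n : ℂ) - 4) * (c * (u.1 x * v.1 x) - c' * (((‖x‖ ^ 2 : ℝ) : ℂ) *
    (1 / (((‖x‖ ^ 2 : ℝ) : ℂ) + β)) * (u.1 x * v.1 x))) = _
  ring

lemma cubicTest_apply (u v w : RadialTest n) (x : Rn n) : (cubicTest u v w).1 x =
    ((n : ℂ) - 4) * (((‖x‖ ^ 2 : ℝ) : ℂ) * (u.1 x * (v.1 x * w.1 x))) := rfl

/-- The nonlinearity on test functions. -/
def nonlinTest (c c' β : ℂ) (hβ : ∀ x : Rn n, ((‖x‖ ^ 2 : ℝ) : ℂ) + β ≠ 0) (u : RadialTest n) :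
    RadialTest n := quadTest c c' β hβ u u - cubicTest u u u

/-- Polarization: u² − v² = (u−v)(u+v) and u³ − v³ = (u−v)(u² + uv + v²), so multilinear bounds
yield Lipschitz bounds. -/
lemma nonlinTest_sub (c c' β : ℂ) (hβ : ∀ x : Rn n, ((‖x‖ ^ 2 : ℝ) : ℂ) + β ≠ 0)
    (u v : RadialTest n) : nonlinTest c c' β hβ u - nonlinTest c c' β hβ v =
      quadTest c c' β hβ (u - v) (u + v) -
        (cubicTest (u - v) u u + (cubicTest (u - v) u v + cubicTest (u - v) v v)) := by
  ext x
  change (quadTest c c' β hβ u u).1 x - (cubicTest u u u).1 x -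
    ((quadTest c c' β hβ v v).1 x - (cubicTest v v v).1 x) =
    (quadTest c c' β hβ (u - v) (u + v)).1 x - ((cubicTest (u - v) u u).1 x +
      ((cubicTest (u - v) u v).1 x + (cubicTest (u - v) v v).1 x))
  have h1 : (u - v).1 x = u.1 x - v.1 x := rfl
  have h2 : (u + v).1 x = u.1 x + v.1 x := rfl
  simp only [quadTest_apply, cubicTest_apply, h1, h2]
  ring

/-- One power in each cubic term is absorbed by M, which leaves the same factor, norm of u plus norm
of v, as in the quadratic term. -/
theorem exists_capNorm_nonlinTest_sub_le {e : Exponents} (hn : 5 ≤ n) (he : e.Admissible n)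
    {w : ℂ} (c c' β : ℂ) (hw : 0 < w.re) (hwβ : 0 < (w * β).re)
    (hβ : ∀ x : Rn n, ((‖x‖ ^ 2 : ℝ) : ℂ) + β ≠ 0) :
    ∃ C : ℝ≥0∞, C ≠ ⊤ ∧ ∀ u v : RadialTest n, ∀ M : ℝ≥0∞, capNorm e.s₁ e.s₂ u.1 ≤ M →
      capNorm e.s₁ e.s₂ v.1 ≤ M →
      capNorm (e.s₁ - 1) (e.s₂ - 1) (nonlinTest c c' β hβ u - nonlinTest c c' β hβ v).1 ≤
        C * (1 + M) * (capNorm e.s₁ e.s₂ u.1 + capNorm e.s₁ e.s₂ v.1) *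
          capNorm e.s₁ e.s₂ (u - v).1 := by
  obtain ⟨C₁, hC₁, h₁⟩ := exists_capNorm_prodTest_le hn he
  obtain ⟨C₂, hC₂, h₂⟩ := exists_capNorm_potTest_le hn he hw hwβ hβ
  obtain ⟨C₃, hC₃, h₃⟩ := exists_capNorm_sqTest_le hn he
  set N := ‖(n : ℂ) - 4‖ₑ with hN
  have hNt : N ≠ ⊤ := enorm_ne_top
  have hct : ‖c‖ₑ ≠ ⊤ := enorm_ne_top
  have hct' : ‖c'‖ₑ ≠ ⊤ := enorm_ne_top
  refine ⟨N * (‖c‖ₑ * C₁ + ‖c'‖ₑ * C₂) + N * C₃ * 2, by finiteness, fun u v M hu hv => ?_⟩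
  have hq : ∀ f g : RadialTest n, capNorm (e.s₁ - 1) (e.s₂ - 1) (quadTest c c' β hβ f g).1 ≤
      N * (‖c‖ₑ * C₁ + ‖c'‖ₑ * C₂) * (capNorm e.s₁ e.s₂ f.1 * capNorm e.s₁ e.s₂ g.1) := by
    intro f g
    rw [quadTest, capNorm_smul, mul_assoc, ← hN]
    gcongr
    refine (capNorm_sub_le _ _ _ _).trans ?_
    rw [capNorm_smul, capNorm_smul, add_mul, mul_assoc, mul_assoc]
    gcongr
    · exact h₁ (f, g)
    · exact h₂ (f, g)
  have hc : ∀ f g h : RadialTest n, capNorm (e.s₁ - 1) (e.s₂ - 1) (cubicTest f g h).1 ≤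
      N * C₃ * (capNorm e.s₁ e.s₂ f.1 * (capNorm e.s₁ e.s₂ g.1 * capNorm e.s₁ e.s₂ h.1)) := by
    intro f g h
    rw [cubicTest, capNorm_smul, mul_assoc, ← hN]
    gcongr
    exact h₃ (f, g, h)
  rw [nonlinTest_sub]
  refine (capNorm_sub_le _ _ _ _).trans ?_
  have t1 := hq (u - v) (u + v)
  have t2 := (capNorm_add_le (e.s₁ - 1) (e.s₂ - 1) (cubicTest (u - v) u u)
    (cubicTest (u - v) u v + cubicTest (u - v) v v)).trans (add_le_add (hc _ _ _)
      ((capNorm_add_le _ _ _ _).trans (add_le_add (hc _ _ _) (hc _ _ _))))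
  have t3 := capNorm_add_le e.s₁ e.s₂ u v
  set X := capNorm e.s₁ e.s₂ u.1
  set Y := capNorm e.s₁ e.s₂ v.1
  set D := capNorm e.s₁ e.s₂ (u - v).1
  set A := N * (‖c‖ₑ * C₁ + ‖c'‖ₑ * C₂)
  set B := N * C₃
  calc _ ≤ A * (D * (X + Y)) + (B * (D * (X * X)) + (B * (D * (X * Y)) + B * (D * (Y * Y)))) :=
        add_le_add (t1.trans (by gcongr)) t2
    _ ≤ A * (D * (X + Y)) + (B * (D * (M * X)) + (B * (D * (M * Y)) + B * (D * (M * Y)))) := by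
        gcongr
    -- Nonnegative terms are added so that the sum factors exactly.
    _ ≤ A * (D * (X + Y)) + (B * (D * (M * X)) + (B * (D * (M * Y)) + B * (D * (M * Y)))) +
        (A * (M * D * (X + Y)) + B * (2 * D * (X + Y) + M * D * X)) := le_self_add
    _ = (A + B * 2) * (1 + M) * (X + Y) * D := by ring

end

/-! ### Extension of locally Lipschitz maps to a completion -/

section Extension

variable {X Y : Type*} [SeminormedAddCommGroup X] [NormedAddCommGroup Y] [CompleteSpace Y]

lemma exists_seq_tendsto_completion (U : UniformSpace.Completion X) :
    ∃ φ : ℕ → X, Tendsto (fun k => (φ k : UniformSpace.Completion X)) atTop (𝓝 U) := by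
  have h := UniformSpace.Completion.denseRange_coe (α := X) U
  obtain ⟨v, hv, hvU⟩ := mem_closure_iff_seq_limit.1 h
  choose φ hφ using hv
  exact ⟨φ, by simpa only [hφ] using hvU⟩

lemma tendsto_norm_of_tendsto_coe {U : UniformSpace.Completion X} {φ : ℕ → X}
    (h : Tendsto (fun k => (φ k : UniformSpace.Completion X)) atTop (𝓝 U)) :
    Tendsto (fun k => ‖φ k‖) atTop (𝓝 ‖U‖) := by
  simpa only [UniformSpace.Completion.norm_coe] using h.norm

lemma tendsto_norm_sub_of_tendsto_coe {U V : UniformSpace.Completion X} {φ ψ : ℕ → X}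
    (h : Tendsto (fun k => (φ k : UniformSpace.Completion X)) atTop (𝓝 U))
    (h' : Tendsto (fun k => (ψ k : UniformSpace.Completion X)) atTop (𝓝 V)) :
    Tendsto (fun k => ‖φ k - ψ k‖) atTop (𝓝 ‖U - V‖) := by
  have := (h.sub h').norm
  simpa only [← UniformSpace.Completion.coe_sub, UniformSpace.Completion.norm_coe] using this

/-- A map with a Lipschitz bound on bounded sets extends to the completion. -/
theorem exists_extension_completion (g : X → Y)
    (hg : ∀ M : ℝ, ∃ K : ℝ, 0 < K ∧ ∀ φ ψ : X, ‖φ‖ ≤ M → ‖ψ‖ ≤ M →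
      ‖g φ - g ψ‖ ≤ K * (‖φ‖ + ‖ψ‖) * ‖φ - ψ‖) :
    ∃ F : UniformSpace.Completion X → Y,
      (∀ U, ∀ φ : ℕ → X, Tendsto (fun k => (φ k : UniformSpace.Completion X)) atTop (𝓝 U) →
        Tendsto (fun k => g (φ k)) atTop (𝓝 (F U))) ∧
      ∀ δ : ℝ, 0 < δ → ∃ C : ℝ, 0 < C ∧ ∀ U V : UniformSpace.Completion X, ‖U‖ ≤ δ → ‖V‖ ≤ δ →
        ‖F U - F V‖ ≤ C * (‖U‖ + ‖V‖) * ‖U - V‖ := by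
  -- Approximants of points in the δ-ball may leave it, hence the bound is required on the ball of
  -- radius δ + 1. With U = V the statement gives independence of the approximating sequence, in
  -- general the Lipschitz bound.
  have hlim : ∀ U V : UniformSpace.Completion X, ∀ φ ψ : ℕ → X,
      Tendsto (fun k => (φ k : UniformSpace.Completion X)) atTop (𝓝 U) →
      Tendsto (fun k => (ψ k : UniformSpace.Completion X)) atTop (𝓝 V) → ∀ δ K : ℝ,
      ‖U‖ ≤ δ → ‖V‖ ≤ δ → (∀ φ ψ : X, ‖φ‖ ≤ δ + 1 → ‖ψ‖ ≤ δ + 1 →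
      ‖g φ - g ψ‖ ≤ K * (‖φ‖ + ‖ψ‖) * ‖φ - ψ‖) →
      (∀ᶠ k in atTop, ‖g (φ k) - g (ψ k)‖ ≤ K * (‖φ k‖ + ‖ψ k‖) * ‖φ k - ψ k‖) ∧
      Tendsto (fun k => K * (‖φ k‖ + ‖ψ k‖) * ‖φ k - ψ k‖) atTop
        (𝓝 (K * (‖U‖ + ‖V‖) * ‖U - V‖)) := by
    intro U V φ ψ hφ hψ δ K hU hV hK
    have h1 := tendsto_norm_of_tendsto_coe hφ
    have h2 := tendsto_norm_of_tendsto_coe hψ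
    refine ⟨?_, ((h1.add h2).const_mul K).mul (tendsto_norm_sub_of_tendsto_coe hφ hψ)⟩
    filter_upwards [h1.eventually (eventually_le_nhds (by linarith : ‖U‖ < δ + 1)),
      h2.eventually (eventually_le_nhds (by linarith : ‖V‖ < δ + 1))] with k h1 h2
    exact hK _ _ h1 h2
  have hcau : ∀ U : UniformSpace.Completion X, ∀ φ : ℕ → X,
      Tendsto (fun k => (φ k : UniformSpace.Completion X)) atTop (𝓝 U) →
      CauchySeq fun k => g (φ k) := by
    intro U φ hφ
    have h1 := tendsto_norm_of_tendsto_coe hφ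
    obtain ⟨M, hM⟩ := h1.bddAbove_range
    have hM : ∀ k, ‖φ k‖ ≤ M := fun k => hM ⟨k, rfl⟩
    have hM0 : 0 ≤ M := (norm_nonneg _).trans (hM 0)
    obtain ⟨K, hK, hKle⟩ := hg M
    have hc : CauchySeq φ := by
      have := hφ.cauchySeq
      rw [Metric.cauchySeq_iff] at this ⊢
      simpa only [dist_eq_norm, ← UniformSpace.Completion.coe_sub,
        UniformSpace.Completion.norm_coe] using this
    rw [Metric.cauchySeq_iff] at hc ⊢
    intro ε hε
    obtain ⟨N, hN⟩ := hc (ε / (K * (M + M) + 1)) (by positivity)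
    refine ⟨N, fun m hm k hk => ?_⟩
    have := hN m hm k hk
    rw [dist_eq_norm, lt_div_iff₀ (by positivity)] at this
    rw [dist_eq_norm]
    calc _ ≤ K * (‖φ m‖ + ‖φ k‖) * ‖φ m - φ k‖ := hKle _ _ (hM m) (hM k)
      _ ≤ K * (M + M) * ‖φ m - φ k‖ := by gcongr <;> exact hM _
      _ ≤ ‖φ m - φ k‖ * (K * (M + M) + 1) := by nlinarith [norm_nonneg (φ m - φ k)]
      _ < ε := this
  choose φ₀ hφ₀ using exists_seq_tendsto_completion (X := X)
  choose F hF using fun U => cauchySeq_tendsto_of_complete (hcau U (φ₀ U) (hφ₀ U))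
  refine ⟨F, fun U φ hφ => ?_, fun δ hδ => ?_⟩
  · obtain ⟨K, hK, hKle⟩ := hg (‖U‖ + 1)
    obtain ⟨e1, e2⟩ := hlim U U φ (φ₀ U) hφ (hφ₀ U) ‖U‖ K le_rfl le_rfl hKle
    rw [sub_self, norm_zero, mul_zero] at e2
    have h0 : Tendsto (fun k => g (φ k) - g (φ₀ U k)) atTop (𝓝 0) :=
      squeeze_zero_norm' e1 e2
    simpa using h0.add (hF U)
  · obtain ⟨K, hK, hKle⟩ := hg (δ + 1)
    refine ⟨K, hK, fun U V hU hV => ?_⟩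
    obtain ⟨e1, e2⟩ := hlim U V _ _ (hφ₀ U) (hφ₀ V) δ K hU hV hKle
    exact le_of_tendsto_of_tendsto ((hF U).sub (hF V)).norm e2 e1

end Extension

/-! ### Elements of the completion as pairs of functions -/

section Embedding

variable {n : ℕ}

lemma memLp_test (u : RadialTest n) (p : ℝ≥0∞) : MemLp u.1 p volume :=
  u.2.1.continuous.memLp_of_hasCompactSupport u.2.2.1

lemma fourierInv_fourier_test (u : RadialTest n) : 𝓕⁻ (𝓕 u.1) = u.1 := by
  have hFi : Integrable (𝓕 (testSchwartz u : Rn n → ℂ)) := by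
    rw [← SchwartzMap.fourier_coe]; exact SchwartzMap.integrable _
  exact (testSchwartz u).continuous.fourierInv_fourier_eq (testSchwartz u).integrable hFi

lemma fourier_testSchwartz (u : RadialTest n) :
    (𝓕 (testSchwartz u) : SchwartzMap (Rn n) ℂ) = 𝓕 u.1 := by
  rw [SchwartzMap.fourier_coe]; rfl

lemma one_le_critExp {s : ℝ} (hs0 : 0 ≤ s) (hs : 2 * s < n) : 1 ≤ critExp n s := by
  rw [critExp, ENNReal.one_le_ofReal, le_div_iff₀ (by linarith)]
  linarith

theorem exists_eLpNorm_test_le (hn : 0 < n) {s : ℝ} (hs0 : 0 ≤ s) (hs : 2 * s < n) :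
    ∃ C : ℝ≥0∞, C ≠ ⊤ ∧ ∀ u : RadialTest n,
      eLpNorm u.1 (critExp n s) volume ≤ C * sobNorm s u.1 := by
  have := nontrivial_Rn hn
  have hfr : (finrank ℝ (Rn n) : ℝ) = n := by simp
  obtain ⟨C, hC, h⟩ := sobolev_embedding (E := Rn n) hs0 (by rwa [hfr])
  refine ⟨C, hC, fun u => ?_⟩
  have := h (𝓕 u.1) (continuous_fourier_test u).stronglyMeasurable
    (by rw [← fourier_testSchwartz]; exact SchwartzMap.integrable _)
    (by rw [← fourier_testSchwartz]; exact SchwartzMap.memLp _ 2 volume)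
  rwa [fourierInv_fourier_test, hfr] at this

variable {e : Exponents}

/-- By the Sobolev embedding the component L is a Lipschitz map into a complete Lebesgue space, so
it extends to the completion by uniform continuity. -/
lemma exists_limit_map (hn : 0 < n) {s : ℝ} (hs0 : 0 ≤ s) (hs : 2 * s < n)
    (L : TestPair n e → RadialTest n) (hL : ∀ φ ψ, L (φ - ψ) = L φ - L ψ)
    (hLs : ∀ φ, sobNorm s (L φ).1 ≤ 2 * ‖φ‖ₑ) :
    ∃ J : HSpace n e → Rn n → ℂ, ∀ U, MemLp (J U) (critExp n s) volume ∧
      ∀ φ : ℕ → TestPair n e, Tendsto (fun k => (φ k : HSpace n e)) atTop (𝓝 U) →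
        Tendsto (fun k => eLpNorm ((L (φ k)).1 - J U) (critExp n s) volume) atTop (𝓝 0) := by
  have : Fact (1 ≤ critExp n s) := ⟨one_le_critExp hs0 hs⟩
  obtain ⟨C, hC, h⟩ := exists_eLpNorm_test_le hn hs0 hs
  let T : TestPair n e → Lp ℂ (critExp n s) (volume : Measure (Rn n)) :=
    fun φ => (memLp_test (L φ) _).toLp
  have hT : LipschitzWith (C * 2).toNNReal T := by
    intro φ ψ
    rw [Lp.edist_toLp_toLp, ENNReal.coe_toNNReal (by finiteness), edist_eq_enorm_sub]
    have := h (L φ - L ψ)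
    refine this.trans ?_
    rw [mul_assoc, ← hL]
    gcongr
    exact hLs _
  let J : HSpace n e → Lp ℂ (critExp n s) (volume : Measure (Rn n)) :=
    UniformSpace.Completion.extension T
  refine ⟨fun U => J U, fun U => ⟨Lp.memLp (J U), fun φ hφ => ?_⟩⟩
  have hc := (UniformSpace.Completion.continuous_extension (f := T)).tendsto U
  have h1 := hc.comp hφ
  have h2 := (tendsto_iff_edist_tendsto_0).1 h1
  refine h2.congr fun k => ?_
  rw [Function.comp_apply, UniformSpace.Completion.extension_coe hT.uniformContinuous,
    Lp.edist_def]
  exact eLpNorm_congr_ae ((memLp_test (L (φ k)) _).coeFn_toLp.sub (ae_eq_refl _))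

lemma two_mul_s₁_lt (he : e.Admissible n) : 2 * e.s₁ < n := by
  have := he.1; linarith

lemma sobNorm_fst_le (φ : TestPair n e) : sobNorm e.s₁ φ.fst ≤ 2 * ‖φ‖ₑ :=
  le_self_add.trans (capNorm_fst_le φ)

lemma sobNorm_snd_le (φ : TestPair n e) : sobNorm (e.s₁ - 1) φ.snd ≤ 2 * ‖φ‖ₑ :=
  le_self_add.trans (capNorm_snd_le φ)

/-- The realization of the elements of `𝓗^{s₁,s₂}` as pairs of functions. -/
theorem exists_realization (hs : 2 * e.s₁ < n) :
    ∃ J₁ J₂ : HSpace n e → Rn n → ℂ, ∀ U,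
      MemLp (J₁ U) (critExp n e.s₁) volume ∧ MemLp (J₂ U) (critExp n (e.s₁ - 1)) volume ∧
      ∀ φ : ℕ → TestPair n e, Tendsto (fun k => (φ k : HSpace n e)) atTop (𝓝 U) →
        Tendsto (fun k => eLpNorm ((φ k).fst - J₁ U) (critExp n e.s₁) volume) atTop (𝓝 0) ∧
        Tendsto (fun k => eLpNorm ((φ k).snd - J₂ U) (critExp n (e.s₁ - 1)) volume)
          atTop (𝓝 0) := by
  have h1 := e.one_le
  have hn : 0 < n := by
    rcases Nat.eq_zero_or_pos n with rfl | h
    · norm_num at hs; linarith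
    · exact h
  obtain ⟨J₁, hJ₁⟩ := exists_limit_map (e := e) hn (by linarith) hs (fun φ => Prod.fst φ)
    (fun _ _ => rfl) sobNorm_fst_le
  obtain ⟨J₂, hJ₂⟩ := exists_limit_map (e := e) (s := e.s₁ - 1) hn (by linarith) (by linarith)
    (fun φ => Prod.snd φ) (fun _ _ => rfl) sobNorm_snd_le
  exact ⟨J₁, J₂, fun U => ⟨(hJ₁ U).1, (hJ₂ U).1, fun φ hφ => ⟨(hJ₁ U).2 φ hφ, (hJ₂ U).2 φ hφ⟩⟩⟩

end Embedding

/-! ### Closability of the Sobolev norms -/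

section

variable {n : ℕ}

lemma exists_subseq_ae {α : Type*} [MeasurableSpace α] {μ : Measure α} {p : ℝ≥0∞} (hp : p ≠ 0)
    {f : ℕ → α → ℂ} {g : α → ℂ} (hf : ∀ k, AEStronglyMeasurable (f k) μ)
    (hg : AEStronglyMeasurable g μ)
    (h : Tendsto (fun k => eLpNorm (f k - g) p μ) atTop (𝓝 0)) :
    ∃ ns : ℕ → ℕ, StrictMono ns ∧ ∀ᵐ x ∂μ, Tendsto (fun i => f (ns i) x) atTop (𝓝 (g x)) :=
  (tendstoInMeasure_of_tendsto_eLpNorm hp hf hg h).exists_seq_tendsto_ae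

lemma tendsto_integral_mul_of_eLpNorm {α : Type*} [MeasurableSpace α] {μ : Measure α}
    {p q : ℝ≥0∞} [ENNReal.HolderConjugate p q] {F : ℕ → α → ℂ} {h : α → ℂ}
    (hF : ∀ k, AEStronglyMeasurable (F k) μ) (hh : MemLp h q μ)
    (hlim : Tendsto (fun k => eLpNorm (F k) p μ) atTop (𝓝 0)) :
    Tendsto (fun k => ∫ x, F k x * h x ∂μ) atTop (𝓝 0) := by
  have h1 : Tendsto (fun k => eLpNorm (F k) p μ * eLpNorm h q μ) atTop (𝓝 0) := by
    simpa using ENNReal.Tendsto.mul_const hlim (Or.inr hh.eLpNorm_ne_top)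
  rw [tendsto_zero_iff_enorm_tendsto_zero]
  refine tendsto_of_tendsto_of_tendsto_of_le_of_le tendsto_const_nhds h1 (fun _ => bot_le)
    fun k => ?_
  refine (enorm_integral_le_lintegral_enorm _).trans ?_
  have := eLpNorm_smul_le_mul_eLpNorm (r := 1) hh.aestronglyMeasurable (hF k) (p := p) (q := q)
  rw [eLpNorm_one_eq_lintegral_enorm] at this
  exact this

/-- The weighted Fourier transform. -/
def sobFun (s : ℝ) (u : Rn n → ℂ) (ξ : Rn n) : ℂ := ((‖ξ‖ ^ s : ℝ) : ℂ) * 𝓕 u ξ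

lemma continuous_sobFun {s : ℝ} (hs : 0 ≤ s) (u : RadialTest n) : Continuous (sobFun s u.1) :=
  (Complex.continuous_ofReal.comp (continuous_norm.rpow_const fun _ => Or.inr hs)).mul
    (continuous_fourier_test u)

lemma eLpNorm_sobFun {s : ℝ} (hs : 0 ≤ s) (u : Rn n → ℂ) :
    eLpNorm (sobFun s u) 2 volume = sobNorm s u := by
  unfold sobNorm wNorm
  refine eLpNorm_congr_enorm_ae (Eventually.of_forall fun ξ => ?_)
  rw [sobFun, enorm_mul, enorm_eq_self]
  congr 1
  rw [← ofReal_norm, Complex.norm_real, Real.norm_of_nonneg (by positivity),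
    ← ENNReal.ofReal_rpow_of_nonneg (norm_nonneg _) hs, ofReal_norm]

lemma memLp_sobFun {s : ℝ} (hs : 0 ≤ s) (u : RadialTest n) : MemLp (sobFun s u.1) 2 volume :=
  ⟨(continuous_sobFun hs u).aestronglyMeasurable, by
    rw [eLpNorm_sobFun hs]; exact (sobNorm_ne_top hs u).lt_top⟩

lemma sobFun_sub (s : ℝ) (u v : RadialTest n) :
    sobFun s (u - v).1 = sobFun s u.1 - sobFun s v.1 := by
  funext ξ
  have h := fourier_test_add (u - v) v ξ
  rw [sub_add_cancel] at h
  simp only [sobFun, Pi.sub_apply, h]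
  ring

lemma exists_sobFun_limit {s : ℝ} (hs : 0 ≤ s) {f : ℕ → RadialTest n}
    (hc : Tendsto (fun q : ℕ × ℕ => sobNorm s (f q.1 - f q.2).1) atTop (𝓝 0)) :
    ∃ G : Rn n → ℂ, MemLp G 2 volume ∧
      Tendsto (fun k => eLpNorm (sobFun s (f k).1 - G) 2 volume) atTop (𝓝 0) := by
  let T : ℕ → Lp ℂ 2 (volume : Measure (Rn n)) := fun k => (memLp_sobFun hs (f k)).toLp
  have hT : CauchySeq T := by
    rw [cauchySeq_iff_tendsto_dist_atTop_0]
    have := (ENNReal.tendsto_toReal ENNReal.zero_ne_top).comp hc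
    refine this.congr fun q => ?_
    rw [dist_edist, Lp.edist_toLp_toLp, ← sobFun_sub, eLpNorm_sobFun hs]
    rfl
  obtain ⟨G, hG⟩ := cauchySeq_tendsto_of_complete hT
  refine ⟨G, Lp.memLp G, ?_⟩
  refine ((tendsto_iff_edist_tendsto_0).1 hG).congr fun k => ?_
  rw [Lp.edist_def]
  exact eLpNorm_congr_ae ((memLp_sobFun hs (f k)).coeFn_toLp.sub (ae_eq_refl _))

lemma tendsto_sobNorm_of_limit_eq_zero {s : ℝ} (hs : 0 ≤ s) {f : ℕ → RadialTest n} {G : Rn n → ℂ}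
    (hG : Tendsto (fun k => eLpNorm (sobFun s (f k).1 - G) 2 volume) atTop (𝓝 0))
    (h0 : ∀ᵐ ξ, G ξ = 0) : Tendsto (fun k => sobNorm s (f k).1) atTop (𝓝 0) := by
  refine hG.congr fun k => ?_
  rw [← eLpNorm_sobFun hs]
  refine eLpNorm_congr_ae ?_
  filter_upwards [h0] with ξ hξ
  simp [hξ]

lemma ae_ne_zero (hn : 0 < n) : ∀ᵐ ξ : Rn n, ξ ≠ 0 := by
  have := nontrivial_Rn hn
  exact Measure.ae_ne volume 0

/-- A sequence that is Cauchy in one Sobolev norm and null in another is null in the first. -/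
theorem tendsto_sobNorm_of_tendsto_sobNorm (hn : 0 < n) {s t : ℝ} (hs : 0 ≤ s) (ht : 0 ≤ t)
    {f : ℕ → RadialTest n}
    (hc : Tendsto (fun q : ℕ × ℕ => sobNorm s (f q.1 - f q.2).1) atTop (𝓝 0))
    (h : Tendsto (fun k => sobNorm t (f k).1) atTop (𝓝 0)) :
    Tendsto (fun k => sobNorm s (f k).1) atTop (𝓝 0) := by
  obtain ⟨G, hGm, hG⟩ := exists_sobFun_limit hs hc
  refine tendsto_sobNorm_of_limit_eq_zero hs hG ?_
  have h' : Tendsto (fun k => eLpNorm (sobFun t (f k).1 - 0) 2 volume) atTop (𝓝 0) := by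
    simpa only [sub_zero, eLpNorm_sobFun ht] using h
  obtain ⟨a, ha, hae⟩ := exists_subseq_ae two_ne_zero
    (fun k => (memLp_sobFun hs (f k)).aestronglyMeasurable) hGm.aestronglyMeasurable hG
  obtain ⟨b, hb, hbe⟩ := exists_subseq_ae two_ne_zero (f := fun k => sobFun t (f (a k)).1)
    (g := fun _ => (0 : ℂ))
    (fun k => (memLp_sobFun ht (f (a k))).aestronglyMeasurable) aestronglyMeasurable_const
    (h'.comp ha.tendsto_atTop)
  filter_upwards [hae, hbe, ae_ne_zero hn] with ξ h1 h2 h3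
  have hpos : 0 < ‖ξ‖ := norm_pos_iff.2 h3
  -- Off the origin the two weighted transforms differ by the finite factor |ξ|^{s−t}, so along a
  -- common subsequence both limits vanish almost everywhere.
  have h4 : Tendsto (fun i => ((‖ξ‖ ^ (s - t) : ℝ) : ℂ) * sobFun t (f (a (b i))).1 ξ) atTop
      (𝓝 0) := by
    have h5 := Tendsto.const_mul ((‖ξ‖ ^ (s - t) : ℝ) : ℂ) h2
    rwa [mul_zero] at h5
  refine tendsto_nhds_unique (h1.comp hb.tendsto_atTop) (h4.congr fun i => ?_)
  simp only [sobFun, Function.comp_apply, ← mul_assoc, ← Complex.ofReal_mul]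
  rw [← Real.rpow_add hpos, sub_add_cancel]

/-- The weight |ξ|^s need not be smooth at the origin; the cut-off g removes that point and makes
the product an admissible test function. -/
lemma contDiff_rpow_norm_mul {s : ℝ} {g : Rn n → ℝ} (hg : ContDiff ℝ ∞ g)
    (h0 : tsupport g ⊆ {0}ᶜ) : ContDiff ℝ ∞ fun ξ => ‖ξ‖ ^ s * g ξ := by
  rw [contDiff_iff_contDiffAt]
  intro ξ
  by_cases hξ : ξ ∈ tsupport g
  · have hξ0 : ξ ≠ 0 := h0 hξ
    exact ((contDiffAt_norm ℝ hξ0).rpow_const_of_ne (norm_ne_zero_iff.2 hξ0)).mul hg.contDiffAt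
  · have := notMem_tsupport_iff_eventuallyEq.1 hξ
    refine (contDiffAt_const (c := (0 : ℝ))).congr_of_eventuallyEq ?_
    filter_upwards [this] with η hη
    simp [hη]

/-- A sequence that is Cauchy in a Sobolev norm and null in a Lebesgue norm is null in the
Sobolev norm. -/
theorem tendsto_sobNorm_of_tendsto_eLpNorm (hn : 0 < n) {s : ℝ} (hs : 0 ≤ s) {p : ℝ≥0∞}
    (hp : 1 ≤ p) {f : ℕ → RadialTest n}
    (hc : Tendsto (fun q : ℕ × ℕ => sobNorm s (f q.1 - f q.2).1) atTop (𝓝 0))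
    (h : Tendsto (fun k => eLpNorm (f k).1 p volume) atTop (𝓝 0)) :
    Tendsto (fun k => sobNorm s (f k).1) atTop (𝓝 0) := by
  have : Fact (1 ≤ p) := ⟨hp⟩
  obtain ⟨G, hGm, hG⟩ := exists_sobFun_limit hs hc
  refine tendsto_sobNorm_of_limit_eq_zero hs hG ?_
  have key : ∀ᵐ ξ : Rn n, ξ ∈ ({0}ᶜ : Set (Rn n)) → G ξ = 0 := by
    refine isOpen_compl_singleton.ae_eq_zero_of_integral_contDiff_smul_eq_zero
      ((hGm.locallyIntegrable (by norm_num)).locallyIntegrableOn _) fun g hg hgc hg0 => ?_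
    have hd : ContDiff ℝ ∞ fun ξ => ((‖ξ‖ ^ s * g ξ : ℝ) : ℂ) :=
      Complex.ofRealCLM.contDiff.comp (contDiff_rpow_norm_mul hg hg0)
    have hdc : HasCompactSupport fun ξ => ((‖ξ‖ ^ s * g ξ : ℝ) : ℂ) :=
      hgc.mul_left.comp_left (g := fun r : ℝ => (r : ℂ)) Complex.ofReal_zero
    -- The weight is moved onto the test function: pairing |ξ|^s times the transform of f_k with g
    -- equals pairing f_k with the Schwartz function Ŝ, which tends to 0 by Hölder. Hence the L²
    -- limit G vanishes off the origin.
    let S : SchwartzMap (Rn n) ℂ := hdc.toSchwartzMap hd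
    have hS : ∀ ξ, S ξ = ((‖ξ‖ ^ s * g ξ : ℝ) : ℂ) := fun ξ => rfl
    have hgm : MemLp (fun ξ => (g ξ : ℂ)) 2 (volume : Measure (Rn n)) :=
      (Complex.continuous_ofReal.comp hg.continuous).memLp_of_hasCompactSupport
        (hgc.comp_left (g := fun r : ℝ => (r : ℂ)) Complex.ofReal_zero)
    have l1 : Tendsto (fun k => ∫ ξ, sobFun s (f k).1 ξ * (g ξ : ℂ)) atTop (𝓝 0) := by
      have := tendsto_integral_mul_of_eLpNorm (p := p) (q := p.conjExponent)
        (h := (𝓕 S : SchwartzMap (Rn n) ℂ))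
        (fun k => (memLp_test (f k) p).aestronglyMeasurable) (SchwartzMap.memLp _ _ volume) h
      refine this.congr fun k => ?_
      have h2 := SchwartzMap.integral_fourier_mul_eq (testSchwartz (f k)) S
      rw [fourier_testSchwartz] at h2
      rw [coe_testSchwartz] at h2
      rw [← h2]
      refine integral_congr_ae (Eventually.of_forall fun ξ => ?_)
      simp only [hS, sobFun]
      push_cast; ring
    have l2 : Tendsto (fun k => ∫ ξ, (sobFun s (f k).1 - G) ξ * (g ξ : ℂ)) atTop (𝓝 0) :=
      tendsto_integral_mul_of_eLpNorm (p := 2) (q := 2)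
        (fun k => ((memLp_sobFun hs (f k)).sub hGm).aestronglyMeasurable) hgm hG
    have l3 : ∀ k, ∫ ξ, G ξ * (g ξ : ℂ) = (∫ ξ, sobFun s (f k).1 ξ * (g ξ : ℂ)) -
        ∫ ξ, (sobFun s (f k).1 - G) ξ * (g ξ : ℂ) := by
      intro k
      rw [← integral_sub]
      · refine integral_congr_ae (Eventually.of_forall fun ξ => ?_)
        simp only [Pi.sub_apply]; ring
      · exact (memLp_sobFun hs (f k)).integrable_mul hgm
      · exact ((memLp_sobFun hs (f k)).sub hGm).integrable_mul hgm
    have l4 := (l1.sub l2).congr fun k => (l3 k).symm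
    have l5 := tendsto_nhds_unique l4 tendsto_const_nhds
    rw [sub_zero] at l5
    rw [l5]
    refine integral_congr_ae (Eventually.of_forall fun ξ => ?_)
    simp [mul_comm]
  filter_upwards [key, ae_ne_zero hn] with ξ h1 h2
  exact h1 h2

end

/-! ### Uniqueness and construction of the nonlinear operator -/

section

variable {n : ℕ} {e : Exponents}

/-- A sequence of test functions which is null in every Sobolev norm in which it is Cauchy. -/
def NullIfCauchy (f : ℕ → RadialTest n) : Prop :=
  ∀ s : ℝ, 0 ≤ s → Tendsto (fun q : ℕ × ℕ => sobNorm s (f q.1 - f q.2).1) atTop (𝓝 0) →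
    Tendsto (fun k => sobNorm s (f k).1) atTop (𝓝 0)

/-- Convergence in the completion makes the components Cauchy in all four homogeneous norms, hence
null in each, and these four norms dominate the full one. -/
lemma eq_zero_of_nullIfCauchy {W : HSpace n e} {χ : ℕ → TestPair n e}
    (h : Tendsto (fun k => (χ k : HSpace n e)) atTop (𝓝 W))
    (h₁ : NullIfCauchy fun k => Prod.fst (χ k)) (h₂ : NullIfCauchy fun k => Prod.snd (χ k)) :
    W = 0 := by
  have e1 := e.one_le
  have e2 := e.le
  have hc : Tendsto (fun q : ℕ × ℕ => 2 * ‖χ q.1 - χ q.2‖ₑ) atTop (𝓝 0) := by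
    have h3 := cauchySeq_iff_tendsto_dist_atTop_0.1 h.cauchySeq
    have h4 : Tendsto (fun q : ℕ × ℕ => ENNReal.ofReal ‖χ q.1 - χ q.2‖) atTop (𝓝 0) := by
      rw [← ENNReal.ofReal_zero]
      refine ENNReal.tendsto_ofReal (h3.congr fun q => ?_)
      rw [dist_eq_norm, ← UniformSpace.Completion.coe_sub, UniformSpace.Completion.norm_coe]
    have h5 := ENNReal.Tendsto.const_mul h4 (Or.inr (by norm_num : (2 : ℝ≥0∞) ≠ ⊤))
    rw [mul_zero] at h5
    exact h5.congr fun q => by rw [ofReal_norm]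
  have hcap : ∀ s, ∀ L : TestPair n e → RadialTest n, (∀ φ ψ, L (φ - ψ) = L φ - L ψ) →
      (∀ φ, sobNorm s (L φ).1 ≤ 2 * ‖φ‖ₑ) →
      Tendsto (fun q : ℕ × ℕ => sobNorm s (L (χ q.1) - L (χ q.2)).1) atTop (𝓝 0) := by
    intro s L hL hLs
    refine tendsto_of_tendsto_of_tendsto_of_le_of_le tendsto_const_nhds hc (fun _ => bot_le)
      fun q => ?_
    change sobNorm s (L (χ q.1) - L (χ q.2)).1 ≤ _
    rw [← hL]
    exact hLs _
  have t1 := h₁ e.s₁ (by linarith) (hcap e.s₁ (fun φ => Prod.fst φ) (fun _ _ => rfl)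
    fun φ => le_self_add.trans (capNorm_fst_le φ))
  have t2 := h₁ e.s₂ (by linarith) (hcap e.s₂ (fun φ => Prod.fst φ) (fun _ _ => rfl)
    fun φ => le_add_self.trans (capNorm_fst_le φ))
  have t3 := h₂ (e.s₁ - 1) (by linarith) (hcap (e.s₁ - 1) (fun φ => Prod.snd φ) (fun _ _ => rfl)
    fun φ => le_self_add.trans (capNorm_snd_le φ))
  have t4 := h₂ (e.s₂ - 1) (by linarith) (hcap (e.s₂ - 1) (fun φ => Prod.snd φ) (fun _ _ => rfl)
    fun φ => le_add_self.trans (capNorm_snd_le φ))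
  have t5 := ENNReal.Tendsto.const_mul (a := ENNReal.ofReal ((2 * Real.pi) ^ e.s₂))
    ((t1.add t2).add (t3.add t4)) (Or.inr ENNReal.ofReal_ne_top)
  simp only [add_zero, mul_zero] at t5
  have t6 : Tendsto (fun k => ‖χ k‖ₑ) atTop (𝓝 0) :=
    tendsto_of_tendsto_of_tendsto_of_le_of_le tendsto_const_nhds t5 (fun _ => bot_le)
      fun k => enorm_testPair_le (χ k)
  have t7 : Tendsto (fun k => ‖χ k‖) atTop (𝓝 0) := by
    have := (ENNReal.tendsto_toReal ENNReal.zero_ne_top).comp t6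
    simpa [Function.comp_def] using this
  exact norm_eq_zero.1 (tendsto_nhds_unique (tendsto_norm_of_tendsto_coe h) t7)

lemma pos_of_two_mul_lt (hs : 2 * e.s₁ < n) : 0 < n := by
  have := e.one_le
  rcases Nat.eq_zero_or_pos n with rfl | h
  · norm_num at hs; linarith
  · exact h

/-- Two sequences with the same Lebesgue limit have a difference that is null in the Lebesgue norm,
and closability upgrades this to Sobolev norms. -/
lemma nullIfCauchy_sub (hn : 0 < n) {p : ℝ≥0∞} (hp : 1 ≤ p) {f g : ℕ → RadialTest n}
    {u : Rn n → ℂ} (hu : MemLp u p volume)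
    (hf : Tendsto (fun k => eLpNorm ((f k).1 - u) p volume) atTop (𝓝 0))
    (hg : Tendsto (fun k => eLpNorm ((g k).1 - u) p volume) atTop (𝓝 0)) :
    NullIfCauchy fun k => f k - g k := by
  intro s hs hc
  refine tendsto_sobNorm_of_tendsto_eLpNorm hn hs hp hc ?_
  have h0 := hf.add hg
  rw [add_zero] at h0
  refine tendsto_of_tendsto_of_tendsto_of_le_of_le tendsto_const_nhds h0 (fun _ => bot_le)
    fun k => ?_
  have e : (f k - g k).1 = ((f k).1 - u) - ((g k).1 - u) := by
    funext x
    change (f k).1 x - (g k).1 x = ((f k).1 x - u x) - ((g k).1 x - u x)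
    ring
  change eLpNorm (f k - g k).1 p volume ≤ _
  rw [e]
  exact eLpNorm_sub_le ((memLp_test (f k) p).aestronglyMeasurable.sub hu.aestronglyMeasurable)
    ((memLp_test (g k) p).aestronglyMeasurable.sub hu.aestronglyMeasurable) hp

/-- An element of `𝓗^{s₁,s₂}` is determined by the functions it represents. -/
theorem Represents.unique (hs : 2 * e.s₁ < n) {U V : HSpace n e} {a b : Rn n → ℂ}
    (hU : Represents U a b) (hV : Represents V a b) : U = V := by
  have hn := pos_of_two_mul_lt hs
  have e1 := e.one_le
  obtain ⟨ha, hb, φ, hφ, hφ1, hφ2⟩ := hU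
  obtain ⟨-, -, ψ, hψ, hψ1, hψ2⟩ := hV
  have hχ : Tendsto (fun k => ((φ k - ψ k : TestPair n e) : HSpace n e)) atTop (𝓝 (U - V)) := by
    simpa only [UniformSpace.Completion.coe_sub] using hφ.sub hψ
  exact sub_eq_zero.1 (eq_zero_of_nullIfCauchy hχ
    (nullIfCauchy_sub hn (one_le_critExp (by linarith) hs) ha hφ1 hψ1)
    (nullIfCauchy_sub hn (one_le_critExp (by linarith) (by linarith)) hb hφ2 hψ2))

section Nonlinearity

variable (c c' β : ℂ) (hβ : ∀ x : Rn n, ((‖x‖ ^ 2 : ℝ) : ℂ) + β ≠ 0)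

/-- The nonlinear operator on test pairs. -/
def nonlinPair (φ : TestPair n e) : TestPair n e :=
  ((0, nonlinTest c c' β hβ (Prod.fst φ)) : RadialTest n × RadialTest n)

lemma capNorm_zero (s t : ℝ) : capNorm s t (0 : RadialTest n).1 = 0 := by
  have := capNorm_smul s t 0 (0 : RadialTest n)
  rwa [smul_zero, enorm_zero, zero_mul] at this

theorem exists_norm_nonlinPair_sub_le (hn : 5 ≤ n) (he : e.Admissible n) {w : ℂ}
    (hw : 0 < w.re) (hwβ : 0 < (w * β).re) (M : ℝ) :
    ∃ K : ℝ, 0 < K ∧ ∀ φ ψ : TestPair n e, ‖φ‖ ≤ M → ‖ψ‖ ≤ M →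
      ‖nonlinPair c c' β hβ φ - nonlinPair c c' β hβ ψ‖ ≤ K * (‖φ‖ + ‖ψ‖) * ‖φ - ψ‖ := by
  obtain ⟨C, hC, h⟩ := exists_capNorm_nonlinTest_sub_le (e := e) hn he c c' β hw hwβ hβ
  set K : ℝ≥0∞ := ENNReal.ofReal ((2 * Real.pi) ^ e.s₂) * (C * (1 + 2 * ENNReal.ofReal M) * 2 * 2)
    with hK
  have hKt : K ≠ ⊤ := by rw [hK]; finiteness
  refine ⟨K.toReal + 1, by positivity, fun φ ψ hφ hψ => ?_⟩
  have hb : ∀ φ : TestPair n e, ‖φ‖ ≤ M → capNorm e.s₁ e.s₂ φ.fst ≤ 2 * ENNReal.ofReal M := by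
    intro φ hφ
    refine (capNorm_fst_le φ).trans ?_
    rw [← ofReal_norm]
    gcongr
  have h1 := h (Prod.fst φ) (Prod.fst ψ) (2 * ENNReal.ofReal M) (hb φ hφ) (hb ψ hψ)
  have h2 : ‖nonlinPair c c' β hβ φ - nonlinPair c c' β hβ ψ‖ₑ ≤
      K * (‖φ‖ₑ + ‖ψ‖ₑ) * ‖φ - ψ‖ₑ := by
    refine (enorm_testPair_le _).trans ?_
    have z : (nonlinPair c c' β hβ φ - nonlinPair c c' β hβ ψ).fst = (0 : RadialTest n).1 := by
      change ((0 : RadialTest n) - 0).1 = _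
      rw [sub_zero]
    rw [z, capNorm_zero, zero_add]
    calc _ ≤ ENNReal.ofReal ((2 * Real.pi) ^ e.s₂) * (C * (1 + 2 * ENNReal.ofReal M) *
          (2 * ‖φ‖ₑ + 2 * ‖ψ‖ₑ) * (2 * ‖φ - ψ‖ₑ)) := by
          gcongr
          refine h1.trans ?_
          gcongr
          · exact capNorm_fst_le φ
          · exact capNorm_fst_le ψ
          · exact capNorm_fst_le (φ - ψ)
      _ = _ := by rw [hK]; ring
  have h3 := ENNReal.toReal_mono (by finiteness) h2
  rw [ENNReal.toReal_mul, ENNReal.toReal_mul, ENNReal.toReal_add (by finiteness) (by finiteness)]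
    at h3
  simp only [toReal_enorm] at h3
  refine h3.trans ?_
  gcongr
  linarith

/-- Norm limits are compared along a common subsequence that converges almost everywhere; there z ↦
N(x,z) is continuous for each fixed x. The formula for N is needed only off the origin, a null set.
-/
lemma ae_tendsto_nonlinTest {p q : ℝ≥0∞} (hp : p ≠ 0) (hq : 1 ≤ q) (hn : 0 < n)
    (hN : ∀ x : Rn n, x ≠ 0 → ∀ z : ℂ, scalarN n x z = ((n : ℂ) - 4) * z ^ 2 *
      (c - c' * (((‖x‖ ^ 2 : ℝ) : ℂ) * (1 / (((‖x‖ ^ 2 : ℝ) : ℂ) + β))) -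
        ((‖x‖ ^ 2 : ℝ) : ℂ) * z)) {f : ℕ → RadialTest n} {u v : Rn n → ℂ}
    (hu : MemLp u p volume) (hv : MemLp v q volume)
    (h1 : Tendsto (fun k => eLpNorm ((f k).1 - u) p volume) atTop (𝓝 0))
    (h2 : Tendsto (fun k => eLpNorm ((nonlinTest c c' β hβ (f k)).1 - v) q volume) atTop (𝓝 0)) :
    v =ᵐ[volume] fun x => scalarN n x (u x) := by
  obtain ⟨a, ha, hae⟩ := exists_subseq_ae hp
    (fun k => (memLp_test (f k) p).aestronglyMeasurable) hu.aestronglyMeasurable h1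
  obtain ⟨b, hb, hbe⟩ := exists_subseq_ae (by positivity)
    (f := fun k => (nonlinTest c c' β hβ (f (a k))).1)
    (fun k => (memLp_test _ q).aestronglyMeasurable) hv.aestronglyMeasurable
    (h2.comp ha.tendsto_atTop)
  filter_upwards [hae, hbe, ae_ne_zero hn] with x h3 h4 h5
  have h6 : Tendsto (fun i => scalarN n x ((f (a (b i))).1 x)) atTop (𝓝 (scalarN n x (u x))) := by
    have : Continuous (scalarN n x) := by unfold scalarN; fun_prop
    exact (this.tendsto _).comp (h3.comp hb.tendsto_atTop)
  refine tendsto_nhds_unique h4 (h6.congr fun i => ?_)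
  rw [hN x h5]
  change _ = (quadTest c c' β hβ _ _).1 x - (cubicTest _ _ _).1 x
  rw [quadTest_apply, cubicTest_apply]
  ring

end Nonlinearity

/-- The extension of N from test pairs represents N(·,u₁) by almost everywhere convergence. Any
competitor represents the same functions, and an element is determined by these. -/
theorem exists_nonlinearity (hn : 5 ≤ n) (he : e.Admissible n) :
    ∃ F : HSpace n e → HSpace n e, IsNonlinearity F ∧
      (∀ G : HSpace n e → HSpace n e, IsNonlinearity G → G = F) ∧
      ∀ δ : ℝ, 0 < δ → ∃ C : ℝ, 0 < C ∧ ∀ U V : HSpace n e, ‖U‖ ≤ δ → ‖V‖ ≤ δ →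
        ‖F U - F V‖ ≤ C * (‖U‖ + ‖V‖) * ‖U - V‖ := by
  have hs := two_mul_s₁_lt he
  have e1 := e.one_le
  have hn0 : 0 < n := by omega
  have hp₁ : 1 ≤ critExp n e.s₁ := one_le_critExp (by linarith) hs
  have hp₂ : 1 ≤ critExp n (e.s₁ - 1) := one_le_critExp (by linarith) (by linarith)
  obtain ⟨c, c', β, w, -, hw, hwβ, hN⟩ := exists_scalarN_eq hn
  have hβ := norm_sq_add_ne_zero (n := n) hw hwβ
  obtain ⟨J₁, J₂, hJ⟩ := exists_realization (n := n) hs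
  obtain ⟨F, hF, hFL⟩ := exists_extension_completion
    (fun φ : TestPair n e => (nonlinPair c c' β hβ φ : HSpace n e)) fun M => by
      obtain ⟨K, hK, h⟩ := exists_norm_nonlinPair_sub_le (e := e) c c' β hβ hn he hw hwβ M
      refine ⟨K, hK, fun φ ψ hφ hψ => ?_⟩
      rw [← UniformSpace.Completion.coe_sub, UniformSpace.Completion.norm_coe]
      exact h φ ψ hφ hψ
  have hF' : IsNonlinearity F := by
    intro U
    obtain ⟨φ, hφ⟩ := exists_seq_tendsto_completion U
    refine ⟨⟨J₁ U, J₂ U, (hJ U).1, (hJ U).2.1, φ, hφ, (hJ U).2.2 φ hφ⟩, fun u₁ u₂ hu => ?_⟩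
    obtain ⟨hu₁, -, ψ, hψ, hψ₁, -⟩ := hu
    have hlim := hF U ψ hψ
    obtain ⟨-, hm, hr⟩ := hJ (F U)
    obtain ⟨hr₁, hr₂⟩ := hr _ hlim
    have hae := ae_tendsto_nonlinTest c c' β hβ (by positivity) hp₂ hn0 hN hu₁ hm hψ₁ hr₂
    refine ⟨MemLp.zero, (memLp_congr_ae hae).1 hm, _, hlim, ?_, ?_⟩
    · refine tendsto_const_nhds.congr fun k => ?_
      have : (nonlinPair c c' β hβ (ψ k)).fst - 0 = (0 : Rn n → ℂ) := sub_zero _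
      rw [this, eLpNorm_zero]
    · refine hr₂.congr fun k => eLpNorm_congr_ae ?_
      filter_upwards [hae] with x hx
      simp only [Pi.sub_apply, hx]
  refine ⟨F, hF', fun G hG => funext fun U => ?_, hFL⟩
  obtain ⟨⟨u₁, u₂, hu⟩, h⟩ := hG U
  exact (h u₁ u₂ hu).unique hs ((hF' U).2 u₁ u₂ hu)

end

/-! ### Dilations and the separation of degrees -/

section

variable {n : ℕ}

/-- The dilation `u(r·)` of a test function. -/
def dilTest (r : ℝ) (hr : 0 < r) (u : RadialTest n) : RadialTest n :=
  ⟨fun x => u.1 (r • x), u.2.1.comp (contDiff_const_smul r), u.2.2.1.comp_smul hr.ne',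
    fun x y h => u.2.2.2 _ _ (by rw [norm_smul, norm_smul, h])⟩

lemma fourier_dilTest {r : ℝ} (hr : 0 < r) (u : RadialTest n) (ξ : Rn n) :
    𝓕 (dilTest r hr u).1 ξ = ((r ^ (-(n : ℝ)) : ℝ) : ℂ) * 𝓕 u.1 (r⁻¹ • ξ) := by
  have h := Measure.integral_comp_smul (volume : Measure (Rn n))
    (fun y => Real.fourierChar (-inner ℝ y (r⁻¹ • ξ)) • u.1 y) r
  rw [Real.fourier_eq, Real.fourier_eq]
  have e1 : ∀ v : Rn n, inner ℝ (r • v) (r⁻¹ • ξ) = inner ℝ v ξ := by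
    intro v
    rw [real_inner_smul_left, real_inner_smul_right, mul_inv_cancel_left₀ hr.ne']
  simp only [e1] at h
  change ∫ v, Real.fourierChar (-inner ℝ v ξ) • u.1 (r • v) = _
  rw [h, finrank_euclideanSpace, Fintype.card_fin, abs_of_pos (by positivity),
    Real.rpow_neg hr.le, Real.rpow_natCast, Complex.real_smul]

lemma sobNorm_dilTest (s : ℝ) {r : ℝ} (hr : 0 < r) (u : RadialTest n) :
    sobNorm s (dilTest r hr u).1 = ENNReal.ofReal (r ^ (s - (n : ℝ) / 2)) * sobNorm s u.1 := by
  have h1 : (fun ξ => ‖𝓕 (dilTest r hr u).1 ξ‖ₑ) =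
      fun ξ => ENNReal.ofReal (r ^ (-(n : ℝ))) * ‖𝓕 u.1 (r⁻¹ • ξ)‖ₑ := by
    funext ξ
    rw [fourier_dilTest, enorm_mul, ← ofReal_norm, Complex.norm_real,
      Real.norm_of_nonneg (by positivity)]
  have hm := measurable_enorm_fourier u
  have hmc : Measurable fun ξ : Rn n => ‖𝓕 u.1 (r⁻¹ • ξ)‖ₑ := hm.comp (measurable_const_smul _)
  rw [sobNorm, h1, wNorm_const_mul _ hmc,
    wNorm_comp_smul s hm (inv_pos.2 hr), ← mul_assoc, ← ENNReal.ofReal_mul (by positivity), sobNorm]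
  congr 2
  rw [Real.inv_rpow hr.le, ← Real.rpow_neg hr.le, ← Real.rpow_add hr]
  simp only [finrank_euclideanSpace, Fintype.card_fin]
  ring_nf

lemma sobNorm_ne_zero (hn : 0 < n) {s : ℝ} (hs : 0 ≤ s) {u : RadialTest n} (hu : u ≠ 0) :
    sobNorm s u.1 ≠ 0 := by
  intro h
  rw [← eLpNorm_sobFun hs,
    eLpNorm_eq_zero_iff (memLp_sobFun hs u).aestronglyMeasurable two_ne_zero] at h
  have h1 : 𝓕 u.1 =ᵐ[volume] fun _ => (0 : ℂ) := by
    filter_upwards [h, ae_ne_zero hn] with ξ h2 h3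
    have : ((‖ξ‖ ^ s : ℝ) : ℂ) ≠ 0 := by
      exact_mod_cast (Real.rpow_pos_of_pos (norm_pos_iff.2 h3) s).ne'
    exact (mul_eq_zero.1 h2).resolve_left this
  have h2 : 𝓕 u.1 = fun _ => (0 : ℂ) :=
    (continuous_fourier_test u).ae_eq_iff_eq volume continuous_const |>.1 h1
  apply hu
  ext x
  rw [← fourierInv_fourier_test u, h2, Real.fourierInv_eq]
  simp

/-- A radial bump function. -/
def bumpTest (n : ℕ) : RadialTest n :=
  ⟨fun x => (Real.smoothTransition (1 - ‖x‖ ^ 2) : ℂ), by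
      have h : ContDiff ℝ ∞ fun x : Rn n => Real.smoothTransition (1 - ‖x‖ ^ 2) :=
        Real.smoothTransition.contDiff.comp (contDiff_const.sub (contDiff_norm_sq ℝ))
      exact Complex.ofRealCLM.contDiff.comp h, by
      refine HasCompactSupport.of_support_subset_isCompact
        (isCompact_closedBall (0 : Rn n) 1) fun x hx => ?_
      by_contra h
      rw [mem_closedBall_zero_iff, not_le] at h
      refine hx ?_
      simp only [Complex.ofReal_eq_zero]
      exact Real.smoothTransition.zero_of_nonpos (by nlinarith),
    fun x y h => by simp only [h]⟩

lemma bumpTest_ne_zero {x : Rn n} (hx : ‖x‖ < 1) : (bumpTest n).1 x ≠ 0 := by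
  have : 0 < Real.smoothTransition (1 - ‖x‖ ^ 2) :=
    Real.smoothTransition.pos_of_pos (by nlinarith [norm_nonneg x])
  change (Real.smoothTransition (1 - ‖x‖ ^ 2) : ℂ) ≠ 0
  exact_mod_cast this.ne'

/-- Fatou's lemma: the norm is lower semicontinuous under pointwise convergence on the Fourier side.
-/
lemma wNorm_eq_zero_of_tendsto {E : Type*} [NormedAddCommGroup E] [InnerProductSpace ℝ E]
    [FiniteDimensional ℝ E] [MeasurableSpace E] [BorelSpace E] {s : ℝ} (hs : 0 ≤ s)
    {F : ℕ → E → ℝ≥0∞} {G : E → ℝ≥0∞} (hF : ∀ m, Measurable (F m))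
    (hlim : ∀ ξ, Tendsto (fun m => F m ξ) atTop (𝓝 (G ξ)))
    (h0 : Tendsto (fun m => wNorm s (F m)) atTop (𝓝 0)) : wNorm s G = 0 := by
  have h1 : ∀ ξ : E, (‖ξ‖ₑ ^ s * G ξ) ^ 2 =
      liminf (fun m => (‖ξ‖ₑ ^ s * F m ξ) ^ 2) atTop := by
    intro ξ
    have : ‖ξ‖ₑ ^ s ≠ ⊤ := ENNReal.rpow_ne_top_of_nonneg hs enorm_ne_top
    exact ((ENNReal.Tendsto.pow (ENNReal.Tendsto.const_mul (hlim ξ) (Or.inr this))).liminf_eq).symm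
  have h2 : wNorm s G ^ 2 ≤ 0 := by
    rw [wNorm_sq, lintegral_congr h1]
    refine (lintegral_liminf_le fun m => by have := hF m; fun_prop).trans (le_of_eq ?_)
    have h3 := ENNReal.Tendsto.pow (n := 2) h0
    simp only [wNorm_sq] at h3
    rw [h3.liminf_eq]
    simp
  exact pow_eq_zero_iff two_ne_zero |>.1 (le_antisymm h2 bot_le)

/-- Real-valued version of the norm of `Ḣ^{s₁} ∩ Ḣ^{s₂}` on test functions. -/
def capReal (s t : ℝ) (u : RadialTest n) : ℝ := (capNorm s t u.1).toReal

lemma capReal_smul (s t : ℝ) (c : ℂ) (u : RadialTest n) :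
    capReal s t (c • u) = ‖c‖ * capReal s t u := by
  rw [capReal, capNorm_smul, ENNReal.toReal_mul, toReal_enorm, capReal]

lemma capReal_add_le {s t : ℝ} (hs : 0 ≤ s) (ht : 0 ≤ t) (u v : RadialTest n) :
    capReal s t (u + v) ≤ capReal s t u + capReal s t v := by
  have h1 := capNorm_ne_top hs ht u
  have h2 := capNorm_ne_top hs ht v
  rw [capReal, capReal, capReal, ← ENNReal.toReal_add h1 h2]
  exact ENNReal.toReal_mono (by finiteness) (capNorm_add_le s t u v)

lemma capReal_eq {s t : ℝ} (hs : 0 ≤ s) (ht : 0 ≤ t) (u : RadialTest n) :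
    capReal s t u = (sobNorm s u.1).toReal + (sobNorm t u.1).toReal :=
  ENNReal.toReal_add (sobNorm_ne_top hs u) (sobNorm_ne_top ht u)

lemma toReal_sobNorm_dilTest (s : ℝ) {r : ℝ} (hr : 0 < r) (u : RadialTest n) :
    (sobNorm s (dilTest r hr u).1).toReal = r ^ (s - (n : ℝ) / 2) * (sobNorm s u.1).toReal := by
  rw [sobNorm_dilTest, ENNReal.toReal_mul, ENNReal.toReal_ofReal (by positivity)]

section Bounds

variable {e : Exponents} {c c' β : ℂ} {hβ : ∀ x : Rn n, ((‖x‖ ^ 2 : ℝ) : ℂ) + β ≠ 0}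

lemma isNOf_nonlinPair (hn : 0 < n)
    (hN : ∀ x : Rn n, x ≠ 0 → ∀ z : ℂ, scalarN n x z = ((n : ℂ) - 4) * z ^ 2 *
      (c - c' * (((‖x‖ ^ 2 : ℝ) : ℂ) * (1 / (((‖x‖ ^ 2 : ℝ) : ℂ) + β))) -
        ((‖x‖ ^ 2 : ℝ) : ℂ) * z)) (φ : TestPair n e) : IsNOf φ (nonlinPair c c' β hβ φ) := by
  refine ⟨rfl, ?_⟩
  filter_upwards [ae_ne_zero hn] with x hx
  rw [hN x hx]
  change (quadTest c c' β hβ _ _).1 x - (cubicTest _ _ _).1 x = _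
  rw [quadTest_apply, cubicTest_apply, TestPair.fst]
  ring

/-- The test pair `(f, 0)`. -/
def fstPair (e : Exponents) (f : RadialTest n) : TestPair n e :=
  ((f, 0) : RadialTest n × RadialTest n)

lemma norm_fstPair_le (f : RadialTest n) : ‖fstPair e f‖ ≤
      (2 * Real.pi) ^ e.s₂ * capReal e.s₁ e.s₂ f := by
  have h1 := e.one_le
  have h2 := e.le
  have h := enorm_testPair_le (fstPair e f)
  have hc : capNorm e.s₁ e.s₂ f.1 ≠ ⊤ := capNorm_ne_top (by linarith) (by linarith) f
  change _ ≤ ENNReal.ofReal ((2 * Real.pi) ^ e.s₂) *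
    (capNorm e.s₁ e.s₂ f.1 + capNorm (e.s₁ - 1) (e.s₂ - 1) (0 : RadialTest n).1) at h
  rw [capNorm_zero, add_zero] at h
  have h3 := ENNReal.toReal_mono (by finiteness) h
  rwa [toReal_enorm, ENNReal.toReal_mul, ENNReal.toReal_ofReal (by positivity)] at h3

/-- The Lipschitz bound compared with the zero pair, at which the nonlinearity vanishes. -/
lemma exists_capReal_nonlinTest_le (hn : 0 < n)
    (hN : ∀ x : Rn n, x ≠ 0 → ∀ z : ℂ, scalarN n x z = ((n : ℂ) - 4) * z ^ 2 *
      (c - c' * (((‖x‖ ^ 2 : ℝ) : ℂ) * (1 / (((‖x‖ ^ 2 : ℝ) : ℂ) + β))) -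
        ((‖x‖ ^ 2 : ℝ) : ℂ) * z)) (hL : LipschitzNearZero n e) :
    ∃ ε > 0, ∃ K ≥ 0, ∀ f : RadialTest n, capReal e.s₁ e.s₂ f ≤ ε →
      capReal (e.s₁ - 1) (e.s₂ - 1) (nonlinTest c c' β hβ f) ≤ K * capReal e.s₁ e.s₂ f := by
  have h1 := e.one_le
  have h2 := e.le
  obtain ⟨δ, hδ, C, h⟩ := hL
  set P : ℝ := (2 * Real.pi) ^ e.s₂ with hP
  have hP0 : 0 < P := by positivity
  refine ⟨δ / P, by positivity, 2 * (|C| * P), by positivity, fun f hf => ?_⟩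
  set φ : TestPair n e := fstPair e f with hφ
  have hφn : ‖φ‖ ≤ P * capReal e.s₁ e.s₂ f := norm_fstPair_le f
  have hφδ : ‖φ‖ ≤ δ := by
    rw [le_div_iff₀ hP0] at hf
    linarith
  have h0 : IsNOf (0 : TestPair n e) (0 : TestPair n e) := by
    refine ⟨rfl, Eventually.of_forall fun x => ?_⟩
    change (0 : ℂ) = scalarN n x 0
    simp [scalarN]
  have h3 := h φ 0 (nonlinPair c c' β hβ φ) 0 hφδ (by rw [norm_zero]; exact hδ.le)
    (isNOf_nonlinPair hn hN φ) h0
  rw [sub_zero, sub_zero] at h3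
  have h4 : capReal (e.s₁ - 1) (e.s₂ - 1) (nonlinTest c c' β hβ f) ≤
      2 * ‖nonlinPair c c' β hβ φ‖ := by
    have := ENNReal.toReal_mono (by finiteness) (capNorm_snd_le (nonlinPair c c' β hβ φ))
    rwa [ENNReal.toReal_mul, toReal_enorm] at this
  calc _ ≤ 2 * ‖nonlinPair c c' β hβ φ‖ := h4
    _ ≤ 2 * (C * ‖φ‖) := by gcongr
    _ ≤ 2 * (|C| * ‖φ‖) := by gcongr; exact le_abs_self C
    _ ≤ 2 * (|C| * (P * capReal e.s₁ e.s₂ f)) := by gcongr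
    _ = _ := by ring

/-- Local Lipschitz continuity separates into homogeneous bounds for the quadratic and the cubic
part. -/
theorem exists_homogeneous_bounds (hn : 0 < n)
    (hN : ∀ x : Rn n, x ≠ 0 → ∀ z : ℂ, scalarN n x z = ((n : ℂ) - 4) * z ^ 2 *
      (c - c' * (((‖x‖ ^ 2 : ℝ) : ℂ) * (1 / (((‖x‖ ^ 2 : ℝ) : ℂ) + β))) -
        ((‖x‖ ^ 2 : ℝ) : ℂ) * z)) (hL : LipschitzNearZero n e) :
    ∃ K ≥ 0, ∀ f : RadialTest n, 0 < capReal e.s₁ e.s₂ f →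
      capReal (e.s₁ - 1) (e.s₂ - 1) (quadTest c c' β hβ f f) ≤ K * capReal e.s₁ e.s₂ f ^ 2 ∧
      capReal (e.s₁ - 1) (e.s₂ - 1) (cubicTest f f f) ≤ K * capReal e.s₁ e.s₂ f ^ 3 := by
  have h1 := e.one_le
  have h2 := e.le
  obtain ⟨ε, hε, K, hK, h⟩ := exists_capReal_nonlinTest_le (hβ := hβ) hn hN hL
  -- The quadratic part is even and the cubic part is odd, so adding and subtracting the values at f
  -- and −f isolates each one.
  have hneg : ∀ f : RadialTest n, capReal e.s₁ e.s₂ ((-1 : ℂ) • f) = capReal e.s₁ e.s₂ f := by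
    intro f; rw [capReal_smul]; simp
  have hsmall : ∀ f : RadialTest n, capReal e.s₁ e.s₂ f ≤ ε →
      capReal (e.s₁ - 1) (e.s₂ - 1) (quadTest c c' β hβ f f) ≤ K * capReal e.s₁ e.s₂ f ∧
      capReal (e.s₁ - 1) (e.s₂ - 1) (cubicTest f f f) ≤ K * capReal e.s₁ e.s₂ f := by
    intro f hf
    have a1 := h f hf
    have a2 := h ((-1 : ℂ) • f) (by rwa [hneg])
    rw [hneg] at a2
    have hm : ((-1 : ℂ) • f).1 = fun x => -f.1 x := by
      funext x; change (-1 : ℂ) * f.1 x = _; ring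
    have q1 : quadTest c c' β hβ f f = ((1 / 2 : ℂ)) • (nonlinTest c c' β hβ f +
        nonlinTest c c' β hβ ((-1 : ℂ) • f)) := by
      ext x
      change _ = (1 / 2 : ℂ) * ((quadTest c c' β hβ f f).1 x - (cubicTest f f f).1 x +
        ((quadTest c c' β hβ ((-1 : ℂ) • f) ((-1 : ℂ) • f)).1 x -
          (cubicTest ((-1 : ℂ) • f) ((-1 : ℂ) • f) ((-1 : ℂ) • f)).1 x))
      simp only [quadTest_apply, cubicTest_apply, hm]
      ring
    have q2 : cubicTest f f f = ((1 / 2 : ℂ)) • (nonlinTest c c' β hβ ((-1 : ℂ) • f) +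
        (-1 : ℂ) • nonlinTest c c' β hβ f) := by
      ext x
      change _ = (1 / 2 : ℂ) * ((quadTest c c' β hβ ((-1 : ℂ) • f) ((-1 : ℂ) • f)).1 x -
          (cubicTest ((-1 : ℂ) • f) ((-1 : ℂ) • f) ((-1 : ℂ) • f)).1 x +
        (-1 : ℂ) * ((quadTest c c' β hβ f f).1 x - (cubicTest f f f).1 x))
      simp only [quadTest_apply, cubicTest_apply, hm]
      ring
    have hhalf : ‖(1 / 2 : ℂ)‖ = 1 / 2 := by norm_num
    constructor
    · rw [q1, capReal_smul, hhalf]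
      have := capReal_add_le (s := e.s₁ - 1) (t := e.s₂ - 1) (by linarith) (by linarith)
        (nonlinTest c c' β hβ f) (nonlinTest c c' β hβ ((-1 : ℂ) • f))
      linarith
    · rw [q2, capReal_smul, hhalf]
      have := capReal_add_le (s := e.s₁ - 1) (t := e.s₂ - 1) (by linarith) (by linarith)
        (nonlinTest c c' β hβ ((-1 : ℂ) • f)) ((-1 : ℂ) • nonlinTest c c' β hβ f)
      rw [capReal_smul, norm_neg, norm_one, one_mul] at this
      linarith
  -- Rescaling the amplitude of f to norm ε and undoing it by homogeneity gives K/ε for degree two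
  -- and K/ε² for degree three; the sum serves both.
  refine ⟨K / ε + K / ε ^ 2, by positivity, fun f hf => ?_⟩
  set M := capReal e.s₁ e.s₂ f with hM
  set t : ℝ := ε / M with ht
  have ht0 : 0 < t := by positivity
  have htf : capReal e.s₁ e.s₂ ((t : ℂ) • f) = ε := by
    rw [capReal_smul, Complex.norm_real, Real.norm_of_nonneg ht0.le, ← hM, ht]
    field_simp
  obtain ⟨b1, b2⟩ := hsmall _ htf.le
  have hm : ((t : ℂ) • f).1 = fun x => (t : ℂ) * f.1 x := rfl
  have q1 : quadTest c c' β hβ ((t : ℂ) • f) ((t : ℂ) • f) =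
      ((t ^ 2 : ℝ) : ℂ) • quadTest c c' β hβ f f := by
    ext x
    change _ = ((t ^ 2 : ℝ) : ℂ) * (quadTest c c' β hβ f f).1 x
    simp only [quadTest_apply, hm]
    push_cast; ring
  have q2 : cubicTest ((t : ℂ) • f) ((t : ℂ) • f) ((t : ℂ) • f) =
      ((t ^ 3 : ℝ) : ℂ) • cubicTest f f f := by
    ext x
    change _ = ((t ^ 3 : ℝ) : ℂ) * (cubicTest f f f).1 x
    simp only [cubicTest_apply, hm]
    push_cast; ring
  rw [q1, capReal_smul, Complex.norm_real, Real.norm_of_nonneg (by positivity), htf] at b1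
  rw [q2, capReal_smul, Complex.norm_real, Real.norm_of_nonneg (by positivity), htf] at b2
  set A := capReal (e.s₁ - 1) (e.s₂ - 1) (quadTest c c' β hβ f f)
  set B := capReal (e.s₁ - 1) (e.s₂ - 1) (cubicTest f f f)
  constructor
  · have e1 : A = (t ^ 2 * A) * (M ^ 2 / ε ^ 2) := by rw [ht]; field_simp
    calc A = (t ^ 2 * A) * (M ^ 2 / ε ^ 2) := e1
      _ ≤ (K * ε) * (M ^ 2 / ε ^ 2) := by gcongr
      _ = K / ε * M ^ 2 := by field_simp
      _ ≤ (K / ε + K / ε ^ 2) * M ^ 2 := by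
        gcongr
        exact le_add_of_nonneg_right (by positivity)
  · have e1 : B = (t ^ 3 * B) * (M ^ 3 / ε ^ 3) := by rw [ht]; field_simp
    calc B = (t ^ 3 * B) * (M ^ 3 / ε ^ 3) := e1
      _ ≤ (K * ε) * (M ^ 3 / ε ^ 3) := by gcongr
      _ = K / ε ^ 2 * M ^ 3 := by field_simp
      _ ≤ (K / ε + K / ε ^ 2) * M ^ 3 := by
        gcongr
        exact le_add_of_nonneg_left (by positivity)

end Bounds

end

/-! ### Necessity of the exponents -/

section

variable {n : ℕ} {e : Exponents} {c c' β : ℂ} {hβ : ∀ x : Rn n, ((‖x‖ ^ 2 : ℝ) : ℂ) + β ≠ 0}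

lemma tendsto_rpow_natCast_add_one {γ : ℝ} (hγ : γ < 0) :
    Tendsto (fun m : ℕ => ((m : ℝ) + 1) ^ γ) atTop (𝓝 0) := by
  have h := (tendsto_rpow_neg_atTop (neg_pos.2 hγ)).comp
    (tendsto_natCast_atTop_atTop.atTop_add (tendsto_const_nhds (x := (1 : ℝ))))
  refine h.congr fun m => ?_
  simp only [Function.comp_apply, neg_neg]

lemma dilTest_apply {r : ℝ} (hr : 0 < r) (u : RadialTest n) (x : Rn n) :
    (dilTest r hr u).1 x = u.1 (r • x) := rfl

lemma prodTest_apply (u v : RadialTest n) (x : Rn n) :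
    (prodTest u v).1 x = u.1 x * v.1 x := rfl

lemma bumpTest_apply (x : Rn n) :
    (bumpTest n).1 x = (Real.smoothTransition (1 - ‖x‖ ^ 2) : ℂ) := rfl

lemma prodTest_bumpTest_ne_zero : prodTest (bumpTest n) (bumpTest n) ≠ 0 := by
  intro h
  have h0 : (bumpTest n).1 0 * (bumpTest n).1 0 = 0 := congrFun (congrArg Subtype.val h) 0
  have := bumpTest_ne_zero (x := (0 : Rn n)) (by simp)
  exact this (mul_self_eq_zero.1 h0)

lemma cubicTest_bumpTest_ne_zero (hn : 5 ≤ n) :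
    cubicTest (bumpTest n) (bumpTest n) (bumpTest n) ≠ 0 := by
  intro h
  have hc : ((n : ℂ) - 4) ≠ 0 := by
    rw [sub_ne_zero]; exact_mod_cast (by omega : n ≠ 4)
  -- The weight |x|² vanishes at the origin, so the cubic part is tested at a nonzero point inside
  -- the support of the bump.
  set x : Rn n := EuclideanSpace.single ⟨0, by omega⟩ (1 / 2 : ℝ) with hx
  have hxn : ‖x‖ = 1 / 2 := by
    rw [hx, PiLp.norm_single]; norm_num
  have h0 : (cubicTest (bumpTest n) (bumpTest n) (bumpTest n)).1 x = 0 :=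
    congrFun (congrArg Subtype.val h) x
  have hb := bumpTest_ne_zero (x := x) (by rw [hxn]; norm_num)
  rw [cubicTest_apply, hxn] at h0
  simp [hc, hb] at h0

lemma capReal_pos (hn : 0 < n) {u : RadialTest n} (hu : u ≠ 0) : 0 < capReal e.s₁ e.s₂ u := by
  have h1 := e.one_le
  have h2 := e.le
  rw [capReal_eq (by linarith) (by linarith)]
  exact add_pos_of_pos_of_nonneg (ENNReal.toReal_pos (sobNorm_ne_zero hn (by linarith) hu)
    (sobNorm_ne_top (by linarith) u)) ENNReal.toReal_nonneg

lemma dilTest_ne_zero {r : ℝ} (hr : 0 < r) {u : RadialTest n} (hu : u ≠ 0) :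
    dilTest r hr u ≠ 0 := by
  intro h
  apply hu
  ext x
  have := congrFun (congrArg Subtype.val h) (r⁻¹ • x)
  change u.1 (r • r⁻¹ • x) = 0 at this
  rwa [smul_inv_smul₀ hr.ne'] at this

lemma bumpTest_ne (n : ℕ) : bumpTest n ≠ 0 := fun h =>
  bumpTest_ne_zero (x := (0 : Rn n)) (by simp) (congrFun (congrArg Subtype.val h) 0)

/-- The rescaled quadratic parts at high concentration. -/
def concQuad (c c' β : ℂ) (hβ : ∀ x : Rn n, ((‖x‖ ^ 2 : ℝ) : ℂ) + β ≠ 0) (r : ℝ) (hr : 0 < r) :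
    RadialTest n :=
  dilTest r⁻¹ (inv_pos.2 hr) (quadTest c c' β hβ (dilTest r hr (bumpTest n))
    (dilTest r hr (bumpTest n)))

/-- Undoing the dilation replaces the coefficient by its value at y/r, which tends to (n−4)c and
stays bounded on the unit ball, outside which the bump vanishes; dominated convergence applies. -/
lemma tendsto_fourier_concQuad (ξ : Rn n) :
    Tendsto (fun m : ℕ => 𝓕 (concQuad c c' β hβ ((m : ℝ) + 1) (by positivity)).1 ξ) atTop
      (𝓝 (𝓕 ((((n : ℂ) - 4) * c) • prodTest (bumpTest n) (bumpTest n)).1 ξ)) := by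
  set a : Rn n → ℂ := fun x => ((n : ℂ) - 4) *
    (c - c' * (((‖x‖ ^ 2 : ℝ) : ℂ) * (1 / (((‖x‖ ^ 2 : ℝ) : ℂ) + β)))) with ha
  have hac : Continuous a := by
    have h1 : Continuous fun x : Rn n => ((‖x‖ ^ 2 : ℝ) : ℂ) := contDiff_norm_sq_ofReal.continuous
    exact continuous_const.mul (continuous_const.sub (continuous_const.mul
      (h1.mul (continuous_const.div (h1.add continuous_const) hβ))))
  obtain ⟨A, hA⟩ := (isCompact_closedBall (0 : Rn n) 1).exists_bound_of_continuousOn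
    hac.continuousOn
  have hval : ∀ (m : ℕ) (y : Rn n), (concQuad c c' β hβ ((m : ℝ) + 1) (by positivity)).1 y =
      a (((m : ℝ) + 1)⁻¹ • y) * (prodTest (bumpTest n) (bumpTest n)).1 y := by
    intro m y
    have hm : ((m : ℝ) + 1) ≠ 0 := by positivity
    rw [concQuad, dilTest_apply, quadTest_apply, dilTest_apply, smul_inv_smul₀ hm, prodTest_apply]
  have hbound : ∀ (m : ℕ) (y : Rn n),
      ‖(concQuad c c' β hβ ((m : ℝ) + 1) (by positivity)).1 y‖ ≤
        A * ‖(prodTest (bumpTest n) (bumpTest n)).1 y‖ := by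
    intro m y
    rw [hval, norm_mul]
    by_cases hy : ‖y‖ ≤ 1
    · gcongr
      refine hA _ ?_
      rw [mem_closedBall_zero_iff, norm_smul, norm_inv, Real.norm_of_nonneg (by positivity)]
      exact mul_le_one₀ (inv_le_one_of_one_le₀ (by linarith [(m.cast_nonneg : (0 : ℝ) ≤ m)]))
        (norm_nonneg _) hy
    · have : (prodTest (bumpTest n) (bumpTest n)).1 y = 0 := by
        rw [prodTest_apply, bumpTest_apply, Real.smoothTransition.zero_of_nonpos (by nlinarith),
          Complex.ofReal_zero, zero_mul]
      simp [this]
  simp only [Real.fourier_eq]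
  refine tendsto_integral_of_dominated_convergence
    (fun y => A * ‖(prodTest (bumpTest n) (bumpTest n)).1 y‖) (fun m => ?_)
    ((integrable_test _).norm.const_mul A) (fun m => Eventually.of_forall fun y => ?_)
    (Eventually.of_forall fun y => ?_)
  · exact ((Real.fourierIntegral_convergent_iff ξ).2 (integrable_test _)).aestronglyMeasurable
  · rw [Circle.norm_smul]; exact hbound m y
  · refine Tendsto.const_smul ?_ _
    simp only [hval]
    have hy : ((((n : ℂ) - 4) * c) • prodTest (bumpTest n) (bumpTest n)).1 y =
      ((n : ℂ) - 4) * c * (prodTest (bumpTest n) (bumpTest n)).1 y := rfl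
    rw [hy]
    refine Tendsto.mul_const _ ?_
    have h0 : a 0 = ((n : ℂ) - 4) * c := by simp [ha]
    rw [← h0]
    refine (hac.tendsto 0).comp ?_
    have h1 : Tendsto (fun m : ℕ => ((m : ℝ) + 1)⁻¹) atTop (𝓝 0) := by
      simpa only [one_div] using tendsto_one_div_add_atTop_nhds_zero_nat (𝕜 := ℝ)
    simpa using h1.smul_const y

/-- Bumps concentrated at scale 1/r have norm of order at most r^{s₂−n/2}. Rescaled back, the
quadratic part has Ḣ^{s₂−1} norm at most of order r^{s₂+1−n/2}, which would tend to 0 if s₂ < n/2 −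
1, although the limit is a nonzero multiple of the squared bump. This is where c ≠ 0 matters. -/
theorem le_s₂_of_quadratic_bound (hn : 5 ≤ n) (hc : c ≠ 0) {K : ℝ} (hK : 0 ≤ K)
    (h : ∀ f : RadialTest n, 0 < capReal e.s₁ e.s₂ f →
      capReal (e.s₁ - 1) (e.s₂ - 1) (quadTest c c' β hβ f f) ≤ K * capReal e.s₁ e.s₂ f ^ 2) :
    (n : ℝ) / 2 - 1 ≤ e.s₂ := by
  have e1 := e.one_le
  have e2 := e.le
  have hn0 : 0 < n := by omega
  by_contra! hlt
  have hc4 : ((n : ℂ) - 4) ≠ 0 := by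
    rw [sub_ne_zero]; exact_mod_cast (by omega : n ≠ 4)
  set A := capReal e.s₁ e.s₂ (bumpTest n) with hA
  have hbound : ∀ m : ℕ,
      (sobNorm (e.s₂ - 1) (concQuad c c' β hβ ((m : ℝ) + 1) (by positivity)).1).toReal ≤
        K * A ^ 2 * ((m : ℝ) + 1) ^ (e.s₂ + 1 - (n : ℝ) / 2) := by
    intro m
    have hr : (0 : ℝ) < (m : ℝ) + 1 := by positivity
    have hr1 : (1 : ℝ) ≤ (m : ℝ) + 1 := by linarith [(m.cast_nonneg : (0 : ℝ) ≤ m)]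
    set r := (m : ℝ) + 1
    set f := dilTest r hr (bumpTest n)
    have hf : capReal e.s₁ e.s₂ f ≤ r ^ (e.s₂ - (n : ℝ) / 2) * A := by
      rw [capReal_eq (by linarith) (by linarith), toReal_sobNorm_dilTest, toReal_sobNorm_dilTest,
        hA, capReal_eq (by linarith) (by linarith), mul_add]
      have : r ^ (e.s₁ - (n : ℝ) / 2) ≤ r ^ (e.s₂ - (n : ℝ) / 2) :=
        Real.rpow_le_rpow_of_exponent_le hr1 (by linarith)
      gcongr
    have hpos := capReal_pos (e := e) hn0 (dilTest_ne_zero hr (bumpTest_ne n))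
    have h1 : (sobNorm (e.s₂ - 1) (quadTest c c' β hβ f f).1).toReal ≤
        K * capReal e.s₁ e.s₂ f ^ 2 := by
      refine le_trans ?_ (h f hpos)
      rw [capReal_eq (by linarith) (by linarith)]
      exact le_add_of_nonneg_left ENNReal.toReal_nonneg
    rw [concQuad, toReal_sobNorm_dilTest]
    calc _ ≤ r⁻¹ ^ (e.s₂ - 1 - (n : ℝ) / 2) * (K * (r ^ (e.s₂ - (n : ℝ) / 2) * A) ^ 2) := by
          gcongr
          refine h1.trans ?_
          gcongr
      _ = K * A ^ 2 * (r⁻¹ ^ (e.s₂ - 1 - (n : ℝ) / 2) * (r ^ (e.s₂ - (n : ℝ) / 2)) ^ 2) := by ring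
      _ = _ := by
          rw [Real.inv_rpow hr.le, ← Real.rpow_neg hr.le, ← Real.rpow_mul_natCast hr.le,
            ← Real.rpow_add hr]
          congr 2
          push_cast; ring
  have hlim : Tendsto (fun m : ℕ =>
      (sobNorm (e.s₂ - 1) (concQuad c c' β hβ ((m : ℝ) + 1) (by positivity)).1).toReal)
      atTop (𝓝 0) := by
    refine squeeze_zero (fun m => ENNReal.toReal_nonneg) hbound ?_
    have := (tendsto_rpow_natCast_add_one
      (by linarith : e.s₂ + 1 - (n : ℝ) / 2 < 0)).const_mul (K * A ^ 2)
    rwa [mul_zero] at this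
  have hlim' : Tendsto (fun m : ℕ =>
      sobNorm (e.s₂ - 1) (concQuad c c' β hβ ((m : ℝ) + 1) (by positivity)).1) atTop (𝓝 0) := by
    have := ENNReal.tendsto_ofReal hlim
    rw [ENNReal.ofReal_zero] at this
    exact this.congr fun m => ENNReal.ofReal_toReal (sobNorm_ne_top (by linarith) _)
  have hz := wNorm_eq_zero_of_tendsto (by linarith : 0 ≤ e.s₂ - 1)
    (fun m => measurable_enorm_fourier _)
    (fun ξ => (tendsto_fourier_concQuad (c := c) (c' := c') (hβ := hβ) ξ).enorm) hlim'
  exact sobNorm_ne_zero hn0 (by linarith)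
    (smul_ne_zero (mul_ne_zero hc4 hc) prodTest_bumpTest_ne_zero) hz

/-- The cubic part is exactly homogeneous under dilations, so no limit is needed. Bumps spread to
scale R turn the bound into a fixed positive norm being at most a multiple of R^{n−3−2s₁}, which is
absurd for large R if s₁ > (n−3)/2. -/
theorem s₁_le_of_cubic_bound (hn : 5 ≤ n) {K : ℝ} (hK : 0 ≤ K)
    (h : ∀ f : RadialTest n, 0 < capReal e.s₁ e.s₂ f →
      capReal (e.s₁ - 1) (e.s₂ - 1) (cubicTest f f f) ≤ K * capReal e.s₁ e.s₂ f ^ 3) :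
    e.s₁ ≤ ((n : ℝ) - 3) / 2 := by
  have e1 := e.one_le
  have e2 := e.le
  have hn0 : 0 < n := by omega
  by_contra! hlt
  set A := capReal e.s₁ e.s₂ (bumpTest n) with hA
  set σ := (sobNorm (e.s₁ - 1) (cubicTest (bumpTest n) (bumpTest n) (bumpTest n)).1).toReal with hσ
  have hσ0 : 0 < σ := ENNReal.toReal_pos
    (sobNorm_ne_zero hn0 (by linarith) (cubicTest_bumpTest_ne_zero hn))
    (sobNorm_ne_top (by linarith) _)
  have hbound : ∀ m : ℕ, σ ≤ K * A ^ 3 * ((m : ℝ) + 1) ^ ((n : ℝ) - 3 - 2 * e.s₁) := by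
    intro m
    have hR : (0 : ℝ) < (m : ℝ) + 1 := by positivity
    have hR1 : (1 : ℝ) ≤ (m : ℝ) + 1 := by linarith [(m.cast_nonneg : (0 : ℝ) ≤ m)]
    set R := (m : ℝ) + 1
    have hr : 0 < R⁻¹ := inv_pos.2 hR
    have hr1 : R⁻¹ ≤ 1 := inv_le_one_of_one_le₀ hR1
    set r := R⁻¹ with hrR
    set f := dilTest r hr (bumpTest n)
    have hf : capReal e.s₁ e.s₂ f ≤ r ^ (e.s₁ - (n : ℝ) / 2) * A := by
      rw [capReal_eq (by linarith) (by linarith), toReal_sobNorm_dilTest, toReal_sobNorm_dilTest,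
        hA, capReal_eq (by linarith) (by linarith), mul_add]
      have : r ^ (e.s₂ - (n : ℝ) / 2) ≤ r ^ (e.s₁ - (n : ℝ) / 2) :=
        Real.rpow_le_rpow_of_exponent_ge hr hr1 (by linarith)
      gcongr
    have hpos := capReal_pos (e := e) hn0 (dilTest_ne_zero hr (bumpTest_ne n))
    have h1 : (sobNorm (e.s₁ - 1) (cubicTest f f f).1).toReal ≤ K * capReal e.s₁ e.s₂ f ^ 3 := by
      refine le_trans ?_ (h f hpos)
      rw [capReal_eq (by linarith) (by linarith)]
      exact le_add_of_nonneg_right ENNReal.toReal_nonneg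
    -- The factor r² is what the weight |x|² loses when the dilation is undone.
    have h2 : cubicTest (bumpTest n) (bumpTest n) (bumpTest n) =
        ((r ^ 2 : ℝ) : ℂ) • dilTest r⁻¹ (inv_pos.2 hr) (cubicTest f f f) := by
      ext x
      change _ = ((r ^ 2 : ℝ) : ℂ) * (cubicTest f f f).1 (r⁻¹ • x)
      have h3 : f.1 (r⁻¹ • x) = (bumpTest n).1 x := by
        change (bumpTest n).1 (r • r⁻¹ • x) = _
        rw [smul_inv_smul₀ hr.ne']
      have h4 : ((r ^ 2 : ℝ) : ℂ) * ((‖r⁻¹ • x‖ ^ 2 : ℝ) : ℂ) = ((‖x‖ ^ 2 : ℝ) : ℂ) := by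
        rw [← Complex.ofReal_mul, norm_smul, norm_inv, Real.norm_of_nonneg hr.le, mul_pow,
          ← mul_assoc, ← mul_pow, mul_inv_cancel₀ hr.ne', one_pow, one_mul]
      rw [cubicTest_apply, cubicTest_apply, h3, ← h4]
      ring
    have h5 : σ = r ^ 2 * (r⁻¹ ^ (e.s₁ - 1 - (n : ℝ) / 2) *
        (sobNorm (e.s₁ - 1) (cubicTest f f f).1).toReal) := by
      rw [hσ, h2, sobNorm_smul, ENNReal.toReal_mul, toReal_sobNorm_dilTest, toReal_enorm,
        Complex.norm_real, Real.norm_of_nonneg (by positivity)]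
    rw [h5]
    calc _ ≤ r ^ 2 * (r⁻¹ ^ (e.s₁ - 1 - (n : ℝ) / 2) *
          (K * (r ^ (e.s₁ - (n : ℝ) / 2) * A) ^ 3)) := by
          gcongr
          refine h1.trans ?_
          gcongr
      _ = K * A ^ 3 * (r ^ 2 * r⁻¹ ^ (e.s₁ - 1 - (n : ℝ) / 2) *
          (r ^ (e.s₁ - (n : ℝ) / 2)) ^ 3) := by ring
      _ = _ := by
          rw [Real.inv_rpow hr.le, ← Real.rpow_neg hr.le, ← Real.rpow_natCast r 2,
            ← Real.rpow_mul_natCast hr.le, ← Real.rpow_add hr, ← Real.rpow_add hr, hrR,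
            Real.inv_rpow hR.le, ← Real.rpow_neg hR.le]
          congr 2
          push_cast; ring
  have hlim := (tendsto_rpow_natCast_add_one
    (by linarith : (n : ℝ) - 3 - 2 * e.s₁ < 0)).const_mul (K * A ^ 3)
  rw [mul_zero] at hlim
  exact absurd (ge_of_tendsto' hlim hbound) (not_le.2 hσ0)

theorem LipschitzNearZero.admissible (hn : 5 ≤ n) (hL : LipschitzNearZero n e) :
    e.Admissible n := by
  obtain ⟨c, c', β, w, hc, hw, hwβ, hN⟩ := exists_scalarN_eq hn
  obtain ⟨K, hK, h⟩ := exists_homogeneous_bounds (hβ := norm_sq_add_ne_zero (n := n) hw hwβ)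
    (by omega) hN hL
  exact ⟨s₁_le_of_cubic_bound hn hK fun f hf => (h f hf).2,
    le_s₂_of_quadratic_bound hn hc hK fun f hf => (h f hf).1⟩

/-! ### The inclusion into the optimal space -/

section Inclusion

/-- The change of exponents on test pairs is linear. -/
def changeLinear (n : ℕ) (e e' : Exponents) : TestPair n e →ₗ[ℂ] TestPair n e' where
  toFun φ := φ.change e'
  map_add' _ _ := rfl
  map_smul' _ _ := rfl

lemma exists_norm_change_le {e' : Exponents} (h1 : e.s₁ ≤ e'.s₁) (h2 : e'.s₂ ≤ e.s₂) :
    ∃ C : ℝ, ∀ φ : TestPair n e, ‖changeLinear n e e' φ‖ ≤ C * ‖φ‖ := by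
  have e1 := e.one_le
  have e2 := e.le
  have e3 := e'.le
  have hcap : ∀ s t s' t' : ℝ, s ≤ s' → s' ≤ t' → t' ≤ t → ∀ u : RadialTest n,
      capNorm s' t' u.1 ≤ 2 * capNorm s t u.1 := by
    intro s t s' t' a b c u
    rw [two_mul]
    exact add_le_add (sobNorm_le_capNorm a (b.trans c) u) (sobNorm_le_capNorm (a.trans b) c u)
  refine ⟨(2 * Real.pi) ^ e'.s₂ * 8, fun φ => ?_⟩
  have h : ‖changeLinear n e e' φ‖ₑ ≤ ENNReal.ofReal ((2 * Real.pi) ^ e'.s₂) * (8 * ‖φ‖ₑ) := by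
    refine (enorm_testPair_le _).trans ?_
    gcongr
    have a1 := hcap e.s₁ e.s₂ e'.s₁ e'.s₂ h1 e3 h2 (Prod.fst φ)
    have a2 := hcap (e.s₁ - 1) (e.s₂ - 1) (e'.s₁ - 1) (e'.s₂ - 1) (by linarith) (by linarith)
      (by linarith) (Prod.snd φ)
    calc _ ≤ 2 * capNorm e.s₁ e.s₂ φ.fst + 2 * capNorm (e.s₁ - 1) (e.s₂ - 1) φ.snd :=
          add_le_add a1 a2
      _ ≤ 2 * (2 * ‖φ‖ₑ) + 2 * (2 * ‖φ‖ₑ) := by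
          gcongr
          · exact capNorm_fst_le φ
          · exact capNorm_snd_le φ
      _ = 8 * ‖φ‖ₑ := by ring
  have h3 := ENNReal.toReal_mono (by finiteness) h
  rw [toReal_enorm, ENNReal.toReal_mul, ENNReal.toReal_ofReal (by positivity), ENNReal.toReal_mul,
    toReal_enorm] at h3
  rw [mul_assoc]
  exact h3

/-- Continuity is interpolation between the endpoint weights. For injectivity, approximants of a
kernel element are null in the weaker norm and Cauchy in the stronger one, hence null in the latter;
the argument stays on the Fourier side and so requires no realization by functions, which may fail
for large s₁. -/
theorem exists_inclusion (hn : 0 < n) {e' : Exponents} (h1 : e.s₁ ≤ e'.s₁) (h2 : e'.s₂ ≤ e.s₂) :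
    ∃ j : HSpace n e →L[ℂ] HSpace n e', Function.Injective j ∧
      ∀ φ : TestPair n e, j (φ : HSpace n e) = ((φ.change e' : TestPair n e') : HSpace n e') := by
  have e1 := e'.one_le
  obtain ⟨C, hC⟩ := exists_norm_change_le (n := n) h1 h2
  let T : TestPair n e →L[ℂ] TestPair n e' := (changeLinear n e e').mkContinuous C hC
  let j := T.completion
  have hj : ∀ φ : TestPair n e, j (φ : HSpace n e) =
      ((φ.change e' : TestPair n e') : HSpace n e') := fun φ => T.completion_apply_coe φ
  refine ⟨j, (injective_iff_map_eq_zero j).2 fun U hU => ?_, hj⟩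
  obtain ⟨φ, hφ⟩ := exists_seq_tendsto_completion U
  have t1 : Tendsto (fun k => ((φ k).change e' : HSpace n e')) atTop (𝓝 0) := by
    have := (j.continuous.tendsto U).comp hφ
    rw [hU] at this
    exact this.congr fun k => hj (φ k)
  have t2 := tendsto_norm_of_tendsto_coe t1
  rw [norm_zero] at t2
  have t3 : Tendsto (fun k => 2 * ‖(φ k).change e'‖ₑ) atTop (𝓝 0) := by
    have := ENNReal.tendsto_ofReal t2
    rw [ENNReal.ofReal_zero] at this
    have h5 := ENNReal.Tendsto.const_mul this (Or.inr (by norm_num : (2 : ℝ≥0∞) ≠ ⊤))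
    rw [mul_zero] at h5
    exact h5.congr fun q => by rw [ofReal_norm]
  refine eq_zero_of_nullIfCauchy hφ (fun s hs hc => ?_) fun s hs hc => ?_
  · refine tendsto_sobNorm_of_tendsto_sobNorm hn hs (by linarith : 0 ≤ e'.s₁) hc ?_
    exact tendsto_of_tendsto_of_tendsto_of_le_of_le tendsto_const_nhds t3 (fun _ => bot_le)
      fun k => sobNorm_fst_le ((φ k).change e')
  · refine tendsto_sobNorm_of_tendsto_sobNorm hn hs (by linarith : 0 ≤ e'.s₁ - 1) hc ?_
    exact tendsto_of_tendsto_of_tendsto_of_le_of_le tendsto_const_nhds t3 (fun _ => bot_le)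
      fun k => sobNorm_snd_le ((φ k).change e')

end Inclusion

end

end YangMillsNonlin

end

theorem proposition4p7 (n : ℕ) (hn : 5 ≤ n) :
    (∀ e : YangMillsNonlin.Exponents, e.s₁ ≤ ((n : ℝ) - 3) / 2 → (n : ℝ) / 2 - 1 ≤ e.s₂ →
      ∃ F : YangMillsNonlin.HSpace n e → YangMillsNonlin.HSpace n e,
        YangMillsNonlin.IsNonlinearity F ∧
        (∀ G : YangMillsNonlin.HSpace n e → YangMillsNonlin.HSpace n e,
          YangMillsNonlin.IsNonlinearity G → G = F) ∧
        ∀ δ : ℝ, 0 < δ → ∃ C : ℝ, 0 < C ∧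
          ∀ U V : YangMillsNonlin.HSpace n e, ‖U‖ ≤ δ → ‖V‖ ≤ δ →
            ‖F U - F V‖ ≤ C * (‖U‖ + ‖V‖) * ‖U - V‖) ∧
    (∀ e : YangMillsNonlin.Exponents, YangMillsNonlin.LipschitzNearZero n e →
      e.s₁ ≤ ((n : ℝ) - 3) / 2 ∧ (n : ℝ) / 2 - 1 ≤ e.s₂ ∧
      ∃ j : YangMillsNonlin.HSpace n e →L[ℂ]
          YangMillsNonlin.HSpace n (YangMillsNonlin.optExponents n hn),
        Function.Injective j ∧
        ∀ φ : YangMillsNonlin.TestPair n e,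
          j (φ : YangMillsNonlin.HSpace n e) =
            ((φ.change (YangMillsNonlin.optExponents n hn) :
              YangMillsNonlin.TestPair n (YangMillsNonlin.optExponents n hn)) :
              YangMillsNonlin.HSpace n (YangMillsNonlin.optExponents n hn))) := by
  refine ⟨fun e h1 h2 => YangMillsNonlin.exists_nonlinearity hn ⟨h1, h2⟩, fun e hL => ?_⟩
  obtain ⟨h1, h2⟩ := YangMillsNonlin.LipschitzNearZero.admissible hn hL
  exact ⟨h1, h2, YangMillsNonlin.exists_inclusion (by omega) h1 h2⟩
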